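/- Conventions. A \emph{geometry} is a homogeneous space $M=G/G_p$ that is connected and simply connected, where $G$ is a connected Lie group acting faithfully on $M$ with compact point stabilizers. It is a \emph{model geometry} if some lattice $\Gamma\subset G$ (a discrete subgroup such that $G/\Gamma$ carries a nonzero finite $G$-invariant Borel measure) acts freely on $M$; then $\Gamma\backslash G/G_p$ is called a (finite-volume) manifold modeled on $M$. Let $\widetilde{\mathrm{SL}_2}$ be the universal cover of $\mathrm{SL}(2,\mathbb{R})$, let $S^3$ be the group of unit quaternions, let $K$ be $S^3$ or $\widetilde{\mathrm{SL}_2}$, and let $\tilde G=\widetilde{\mathrm{SL}_2}\times K\times\mathbb{R}$. Let $r:\mathbb{R}\to\widetilde{\mathrm{SL}_2}$ be the one-parameter group lifting the rotations of the plane by the angle $\pi x$. Let $c:\mathbb{R}\to K$ be $c(y)=e^{\pi i y}$ if $K=S^3$, and $c=r$ if $K=\widetilde{\mathrm{SL}_2}$. (So $r(x)$ is central exactly if $x\in\mathbb{Z}$, and likewise $c(y)$.) For $a,b\in\mathbb{R}$ put $$\tau_{a,b}:\mathbb{R}^2\to\tilde G,\qquad \tau_{a,b}(x,y)=\bigl(r(x),\,c(y),\,xa+yb\bigr).$$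 Consider $M_{a,b}=\tilde G/\tau_{a,b}(\mathbb{R}^2)$ as a homogeneous space of $G_{a,b}$, the quotient of $\tilde G$ by the kernel of its action on $M_{a,b}$. \textbf{Theorem.} \begin{enumerate} \item For all real numbers $a,b$ (in particular also when $a/b$ is irrational) and for both choices of $K$, $M_{a,b}$ is a model geometry. Moreover, the lattice $\Gamma\subset G_{a,b}$ acting freely on $M_{a,b}$ can be chosen such that the preimage of $\Gamma$ in $\tilde G$ projects, under $\tilde G\to\widetilde{\mathrm{SL}_2}$, onto the full preimage in $\widetilde{\mathrm{SL}_2}$ of a punctured-surface group $\Gamma_0\subset\mathrm{PSL}(2,\mathbb{R})$, that is, of a torsion-free lattice $\Gamma_0$ in $\mathrm{PSL}(2,\mathbb{R})$ that is not cocompact. \item Let $K=S^3$. For $a,b,a',b'>0$ the homogeneous spaces $M_{a,b}$ and $M_{a',b'}$ are isomorphic (that is, there are an isomorphism $\varphi:G_{a,b}\to G_{a',b'}$ of topological groups and a $\varphi$-equivariant homeomorphism $M_{a,b}\to M_{a',b'}$) if and only if $a/b=a'/b'$. So the model geometries $\widetilde{\mathrm{SL}_2}\times_\alpha S^3:=M_{a,b}$,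 where $\alpha=a/b\in(0,\infty)$, are well defined and pairwise non-isomorphic; they form an uncountable family. \end{enumerate} -/

import Mathlib

open scoped MatrixGroups Quaternion

noncomputable section

/-! ### The universal cover of `SL(2, ℝ)`

Identifying `ℝ²` with `ℂ`, a real `2 × 2` matrix is the map `z ↦ α z + β z̄` for unique complex
numbers `α`, `β`, and its determinant is `|α|² - |β|²`.  On `SL(2, ℝ)` we have `α ≠ 0`, and
`g ↦ α g / |α g|` is a homotopy equivalence onto the circle (the angle of the rotation in the polar
decomposition of `g`).  So the universal cover consists of the pairs of `g` and a choice of an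
argument of `α g`. -/

/-- The complex-linear part `α` of `g`, seen as the real-linear map `z ↦ α z + β z̄` of `ℂ`. -/
def slAlpha (g : SL(2, ℝ)) : ℂ := ⟨(g 0 0 + g 1 1) / 2, (g 1 0 - g 0 1) / 2⟩

/-- The complex-antilinear part `β` of `g`, seen as the real-linear map `z ↦ α z + β z̄` of `ℂ`. -/
def slBeta (g : SL(2, ℝ)) : ℂ := ⟨(g 0 0 - g 1 1) / 2, (g 1 0 + g 0 1) / 2⟩

theorem slAlpha_one : slAlpha 1 = 1 := by
  apply Complex.ext <;> simp [slAlpha]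

theorem slAlpha_inv (g : SL(2, ℝ)) : slAlpha g⁻¹ = (starRingEnd ℂ) (slAlpha g) := by
  apply Complex.ext <;> simp [slAlpha, Matrix.SpecialLinearGroup.SL2_inv_expl] <;> ring

theorem slAlpha_mul (g h : SL(2, ℝ)) :
    slAlpha (g * h) = slAlpha g * slAlpha h + slBeta g * (starRingEnd ℂ) (slBeta h) := by
  apply Complex.ext <;>
    simp [slAlpha, slBeta, Matrix.SpecialLinearGroup.coe_mul, Matrix.mul_apply,
      Fin.sum_univ_two] <;>
    ring

theorem slBeta_mul (g h : SL(2, ℝ)) :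
    slBeta (g * h) = slAlpha g * slBeta h + slBeta g * (starRingEnd ℂ) (slAlpha h) := by
  apply Complex.ext <;>
    simp [slAlpha, slBeta, Matrix.SpecialLinearGroup.coe_mul, Matrix.mul_apply,
      Fin.sum_univ_two] <;>
    ring

theorem normSq_slAlpha (g : SL(2, ℝ)) :
    Complex.normSq (slAlpha g) = 1 + Complex.normSq (slBeta g) := by
  have h := g.det_coe
  rw [Matrix.det_fin_two] at h
  simp only [slAlpha, slBeta, Complex.normSq_apply]
  linear_combination h

theorem norm_slBeta_lt (g : SL(2, ℝ)) : ‖slBeta g‖ < ‖slAlpha g‖ := by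
  have h := normSq_slAlpha g
  rw [Complex.normSq_eq_norm_sq, Complex.normSq_eq_norm_sq] at h
  exact lt_of_pow_lt_pow_left₀ 2 (norm_nonneg _) (by linarith)

theorem slAlpha_ne_zero (g : SL(2, ℝ)) : slAlpha g ≠ 0 :=
  norm_pos_iff.1 ((norm_nonneg _).trans_lt (norm_slBeta_lt g))

theorem continuous_slAlpha : Continuous slAlpha := by
  have e : slAlpha = fun g : SL(2, ℝ) ↦
      (((g 0 0 + g 1 1) / 2 : ℝ) : ℂ) + (((g 1 0 - g 0 1) / 2 : ℝ) : ℂ) * Complex.I := by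
    funext g
    apply Complex.ext <;> simp [slAlpha]
  rw [e]
  fun_prop

theorem continuous_slBeta : Continuous slBeta := by
  have e : slBeta = fun g : SL(2, ℝ) ↦
      (((g 0 0 - g 1 1) / 2 : ℝ) : ℂ) + (((g 1 0 + g 0 1) / 2 : ℝ) : ℂ) * Complex.I := by
    funext g
    apply Complex.ext <;> simp [slBeta]
  rw [e]
  fun_prop

theorem slAlpha_ratio_re_pos (g h : SL(2, ℝ)) :
    0 < (slAlpha (g * h) / (slAlpha g * slAlpha h)).re := by
  have hg := slAlpha_ne_zero g
  have hh := slAlpha_ne_zero h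
  have e : slAlpha (g * h) / (slAlpha g * slAlpha h) =
      1 + slBeta g * (starRingEnd ℂ) (slBeta h) / (slAlpha g * slAlpha h) := by
    rw [slAlpha_mul]; field_simp
  have hlt : ‖slBeta g * (starRingEnd ℂ) (slBeta h) / (slAlpha g * slAlpha h)‖ < 1 := by
    rw [norm_div, norm_mul, norm_mul, Complex.norm_conj,
      div_lt_one (mul_pos (norm_pos_iff.2 hg) (norm_pos_iff.2 hh))]
    exact mul_lt_mul'' (norm_slBeta_lt g) (norm_slBeta_lt h) (norm_nonneg _) (norm_nonneg _)
  have := Complex.abs_re_le_norm (slBeta g * (starRingEnd ℂ) (slBeta h) / (slAlpha g * slAlpha h))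
  rw [e, Complex.add_re, Complex.one_re]
  linarith [neg_abs_le (slBeta g * (starRingEnd ℂ) (slBeta h) / (slAlpha g * slAlpha h)).re]

/-- `arg α(gh) - arg α(g) - arg α(h)`, normalized to lie in `(-π/2, π/2)`. -/
def slCocycle (g h : SL(2, ℝ)) : ℝ := (slAlpha (g * h) / (slAlpha g * slAlpha h)).arg

theorem abs_slCocycle_lt (g h : SL(2, ℝ)) : |slCocycle g h| < Real.pi / 2 :=
  Complex.abs_arg_lt_pi_div_two_iff.2 (Or.inl (slAlpha_ratio_re_pos g h))

/-- The real number `t` is an argument of `α g`. -/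
def IsSlArg (g : SL(2, ℝ)) (t : ℝ) : Prop :=
  slAlpha g = ‖slAlpha g‖ * Complex.exp (t * Complex.I)

theorem IsSlArg.one : IsSlArg 1 0 := by
  simp [IsSlArg, slAlpha_one]

theorem IsSlArg.arg (g : SL(2, ℝ)) : IsSlArg g (slAlpha g).arg :=
  (Complex.norm_mul_exp_arg_mul_I _).symm

theorem IsSlArg.mul {g h : SL(2, ℝ)} {s t : ℝ} (hg : IsSlArg g s) (hh : IsSlArg h t) :
    IsSlArg (g * h) (s + t + slCocycle g h) := by
  unfold IsSlArg at *
  have e := Complex.norm_mul_exp_arg_mul_I (slAlpha (g * h) / (slAlpha g * slAlpha h))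
  change _ * Complex.exp ((slCocycle g h : ℝ) * Complex.I) = _ at e
  have h1 := slAlpha_ne_zero g
  have h2 := slAlpha_ne_zero h
  have n1 : (‖slAlpha g‖ : ℂ) ≠ 0 := by simpa using h1
  have n2 : (‖slAlpha h‖ : ℂ) ≠ 0 := by simpa using h2
  rw [eq_div_iff (mul_ne_zero h1 h2), norm_div, norm_mul] at e
  generalize slAlpha (g * h) = c at *
  generalize slAlpha g = a at *
  generalize slAlpha h = b at *
  push_cast at e ⊢
  rw [add_mul, add_mul, Complex.exp_add, Complex.exp_add]
  calc c = ‖c‖ / (‖a‖ * ‖b‖) * Complex.exp (slCocycle g h * Complex.I) * (a * b) := e.symm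
    _ = ‖c‖ / (‖a‖ * ‖b‖) * Complex.exp (slCocycle g h * Complex.I) *
        ((‖a‖ * Complex.exp (s * Complex.I)) * (‖b‖ * Complex.exp (t * Complex.I))) := by
      rw [← hg, ← hh]
    _ = _ := by field_simp

theorem IsSlArg.inv {g : SL(2, ℝ)} {s : ℝ} (hg : IsSlArg g s) : IsSlArg g⁻¹ (-s) := by
  unfold IsSlArg at *
  rw [slAlpha_inv, Complex.norm_conj]
  nth_rewrite 1 [hg]
  simp [← Complex.exp_conj]

theorem IsSlArg.eq_of_abs_sub_lt {g : SL(2, ℝ)} {s t : ℝ} (hs : IsSlArg g s)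
    (ht : IsSlArg g t) (h : |s - t| < 2 * Real.pi) : s = t := by
  unfold IsSlArg at *
  have n1 : (‖slAlpha g‖ : ℂ) ≠ 0 := by simpa using slAlpha_ne_zero g
  have e := mul_left_cancel₀ n1 (hs.symm.trans ht)
  rw [Complex.exp_eq_exp_iff_exists_int] at e
  obtain ⟨n, hn⟩ := e
  have hn' : s = t + n * (2 * Real.pi) := by
    have := congrArg Complex.im hn
    simpa using this
  have hpi := Real.two_pi_pos
  rw [hn', add_sub_cancel_left, abs_mul, abs_of_pos hpi] at h
  have h1 : |(n : ℝ)| < 1 := by nlinarith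
  have h0 : n = 0 := by
    rw [← Int.abs_lt_one_iff]; exact_mod_cast h1
  simp [hn', h0]

/-- The universal cover of `SL(2, ℝ)`: matrices `mat` with an argument `arg` of `α mat`. -/
structure SL2Tilde : Type where
  mat : SL(2, ℝ)
  arg : ℝ
  isArg : IsSlArg mat arg

namespace SL2Tilde

/-- The topology of a subspace of `SL(2, ℝ) × ℝ`. -/
instance : TopologicalSpace SL2Tilde :=
  TopologicalSpace.induced (fun p ↦ (p.mat, p.arg)) inferInstance

theorem isInducing : Topology.IsInducing fun p : SL2Tilde ↦ (p.mat, p.arg) := ⟨rfl⟩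

theorem continuous_mat : Continuous mat := isInducing.continuous.fst

theorem continuous_arg : Continuous arg := isInducing.continuous.snd

theorem ext' {p q : SL2Tilde} (h1 : p.mat = q.mat) (h : |p.arg - q.arg| < 2 * Real.pi) :
    p = q := by
  obtain ⟨g, s, hp⟩ := p
  obtain ⟨g', t, hq⟩ := q
  obtain rfl : g = g' := h1
  obtain rfl : s = t := hp.eq_of_abs_sub_lt hq h
  rfl

instance : One SL2Tilde := ⟨⟨1, 0, IsSlArg.one⟩⟩

instance : Mul SL2Tilde :=
  ⟨fun p q ↦ ⟨p.mat * q.mat, p.arg + q.arg + slCocycle p.mat q.mat, p.isArg.mul q.isArg⟩⟩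

instance : Inv SL2Tilde := ⟨fun p ↦ ⟨p.mat⁻¹, -p.arg, p.isArg.inv⟩⟩

theorem one_mat : (1 : SL2Tilde).mat = 1 := rfl

theorem one_arg : (1 : SL2Tilde).arg = 0 := rfl

theorem mul_mat (p q : SL2Tilde) : (p * q).mat = p.mat * q.mat := rfl

theorem mul_arg (p q : SL2Tilde) :
    (p * q).arg = p.arg + q.arg + slCocycle p.mat q.mat := rfl

theorem inv_mat (p : SL2Tilde) : (p⁻¹).mat = p.mat⁻¹ := rfl

theorem inv_arg (p : SL2Tilde) : (p⁻¹).arg = -p.arg := rfl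

instance : Group SL2Tilde :=
  Group.ofLeftAxioms
    (fun p q r ↦ by
      have h1 := abs_lt.1 (abs_slCocycle_lt p.mat q.mat)
      have h2 := abs_lt.1 (abs_slCocycle_lt (p.mat * q.mat) r.mat)
      have h3 := abs_lt.1 (abs_slCocycle_lt q.mat r.mat)
      have h4 := abs_lt.1 (abs_slCocycle_lt p.mat (q.mat * r.mat))
      refine ext' (by simp [mul_mat, mul_assoc]) ?_
      simp only [mul_mat, mul_arg]
      rw [abs_lt]
      constructor <;> linarith [h1.1, h1.2, h2.1, h2.2, h3.1, h3.2, h4.1, h4.2])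
    (fun p ↦ by
      have h1 := abs_lt.1 (abs_slCocycle_lt 1 p.mat)
      refine ext' (by simp [mul_mat, one_mat]) ?_
      simp only [mul_arg, one_mat, one_arg]
      rw [abs_lt]
      constructor <;> linarith [h1.1, h1.2, Real.pi_pos])
    (fun p ↦ by
      have h1 := abs_lt.1 (abs_slCocycle_lt p.mat⁻¹ p.mat)
      refine ext' (by simp [mul_mat, one_mat, inv_mat]) ?_
      simp only [mul_arg, inv_mat, one_arg, inv_arg]
      rw [abs_lt]
      constructor <;> linarith [h1.1, h1.2, Real.pi_pos])

instance : IsTopologicalGroup SL2Tilde where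
  continuous_mul := by
    have m1 : Continuous fun x : SL2Tilde × SL2Tilde ↦ x.1.mat := continuous_mat.comp continuous_fst
    have m2 : Continuous fun x : SL2Tilde × SL2Tilde ↦ x.2.mat := continuous_mat.comp continuous_snd
    have a1 : Continuous fun x : SL2Tilde × SL2Tilde ↦ x.1.arg := continuous_arg.comp continuous_fst
    have a2 : Continuous fun x : SL2Tilde × SL2Tilde ↦ x.2.arg := continuous_arg.comp continuous_snd
    have hc : Continuous fun x : SL2Tilde × SL2Tilde ↦ slCocycle x.1.mat x.2.mat := by
      refine continuous_iff_continuousAt.2 fun x ↦ ?_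
      refine (Complex.continuousAt_arg (Or.inl (slAlpha_ratio_re_pos x.1.mat x.2.mat))).comp
        (f := fun x : SL2Tilde × SL2Tilde ↦ slAlpha (x.1.mat * x.2.mat) /
          (slAlpha x.1.mat * slAlpha x.2.mat)) ?_
      exact ((continuous_slAlpha.comp (m1.mul m2)).div
        ((continuous_slAlpha.comp m1).mul (continuous_slAlpha.comp m2))
        (fun y ↦ mul_ne_zero (slAlpha_ne_zero _) (slAlpha_ne_zero _))).continuousAt
    exact isInducing.continuous_iff.2 ((m1.mul m2).prodMk ((a1.add a2).add hc))
  continuous_inv :=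
    isInducing.continuous_iff.2 (continuous_mat.inv.prodMk continuous_arg.neg)

/-- The covering homomorphism onto `SL(2, ℝ)`. -/
def toSL : SL2Tilde →* SL(2, ℝ) where
  toFun p := p.mat
  map_one' := rfl
  map_mul' _ _ := rfl

theorem toSL_surjective : Function.Surjective toSL := fun g ↦ ⟨⟨g, _, IsSlArg.arg g⟩, rfl⟩

theorem toSL_isOpenMap : IsOpenMap toSL := by
  refine IsOpenMap.of_sections fun p ↦ ?_
  have h0 := slAlpha_ne_zero p.mat
  refine ⟨fun g ↦ ⟨g, p.arg + (slAlpha g / slAlpha p.mat).arg, ?_⟩, ?_, ?_, fun g ↦ rfl⟩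
  · have hp : slAlpha p.mat = ‖slAlpha p.mat‖ * Complex.exp (p.arg * Complex.I) := p.isArg
    have e := Complex.norm_mul_exp_arg_mul_I (slAlpha g / slAlpha p.mat)
    have n1 : (‖slAlpha p.mat‖ : ℂ) ≠ 0 := by simpa using h0
    rw [eq_div_iff h0, norm_div] at e
    unfold IsSlArg
    generalize (slAlpha g / slAlpha p.mat).arg = t at *
    push_cast at e ⊢
    rw [add_mul, Complex.exp_add]
    calc slAlpha g = ‖slAlpha g‖ / ‖slAlpha p.mat‖ * Complex.exp (t * Complex.I) *
          slAlpha p.mat := e.symm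
      _ = ‖slAlpha g‖ / ‖slAlpha p.mat‖ * Complex.exp (t * Complex.I) *
          (‖slAlpha p.mat‖ * Complex.exp (p.arg * Complex.I)) := by rw [← hp]
      _ = _ := by field_simp
  · refine isInducing.continuousAt_iff.2 ?_
    refine continuousAt_id.prodMk (continuousAt_const.add ?_)
    refine ContinuousAt.comp (f := fun g ↦ slAlpha g / slAlpha p.mat) (g := Complex.arg) ?_ ?_
    · refine Complex.continuousAt_arg ?_
      change slAlpha p.mat / slAlpha p.mat ∈ Complex.slitPlane
      rw [div_self h0]
      exact Complex.one_mem_slitPlane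
    · exact (continuous_slAlpha.div_const _).continuousAt
  · refine ext' rfl ?_
    change |p.arg + (slAlpha p.mat / slAlpha p.mat).arg - p.arg| < _
    rw [div_self h0, Complex.arg_one]
    simp [Real.pi_pos]

/-- `SL2Tilde` is a covering space of `SL(2, ℝ)`. -/
theorem isCoveringMap_toSL : IsCoveringMap toSL := by
  have hq : Topology.IsQuotientMap toSL :=
    toSL_isOpenMap.isQuotientMap continuous_mat toSL_surjective
  refine (hq.isQuotientCoveringMap_of_isDiscrete_ker_monoidHom ?_).isCoveringMap
  have hd : DiscreteTopology toSL.ker := by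
    refine discreteTopology_of_isOpen_singleton_one ?_
    have hV : IsOpen {p : toSL.ker | |p.1.arg| < 2 * Real.pi} :=
      isOpen_lt (continuous_arg.comp continuous_subtype_val).abs continuous_const
    convert hV
    ext p
    simp only [Set.mem_singleton_iff, Set.mem_ofPred_eq]
    constructor
    · rintro rfl
      change |(0 : ℝ)| < _
      simpa using Real.pi_pos
    · intro h
      refine Subtype.ext (ext' p.2 ?_)
      change |p.1.arg - 0| < _
      simpa using h
  exact ⟨hd⟩

end SL2Tilde

/-- The element of `SL(2, ℝ)` with the given `α` and `β`. -/
def slOfAlphaBeta (A B : ℂ) (h : Complex.normSq A = 1 + Complex.normSq B) : SL(2, ℝ) :=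
  ⟨!![A.re + B.re, B.im - A.im; A.im + B.im, A.re - B.re], by
    rw [Complex.normSq_apply, Complex.normSq_apply] at h
    rw [Matrix.det_fin_two_of]
    linear_combination h⟩

theorem slAlpha_slOfAlphaBeta (A B : ℂ) (h : Complex.normSq A = 1 + Complex.normSq B) :
    slAlpha (slOfAlphaBeta A B h) = A := by
  apply Complex.ext <;> (simp [slAlpha, slOfAlphaBeta]; try ring)

theorem slBeta_slOfAlphaBeta (A B : ℂ) (h : Complex.normSq A = 1 + Complex.normSq B) :
    slBeta (slOfAlphaBeta A B h) = B := by
  apply Complex.ext <;> (simp [slBeta, slOfAlphaBeta]; try ring)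

theorem sl_ext {g h : SL(2, ℝ)} (ha : slAlpha g = slAlpha h) (hb : slBeta g = slBeta h) :
    g = h := by
  have h1 := congrArg Complex.re ha
  have h2 := congrArg Complex.im ha
  have h3 := congrArg Complex.re hb
  have h4 := congrArg Complex.im hb
  simp only [slAlpha, slBeta] at h1 h2 h3 h4
  ext i j
  fin_cases i <;> fin_cases j <;> simp <;> linarith

namespace SL2Tilde

theorem normSq_sqrt_mul_exp (B : ℂ) (t : ℝ) :
    Complex.normSq (√(1 + Complex.normSq B) * Complex.exp (t * Complex.I)) =
      1 + Complex.normSq B := by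
  rw [map_mul, Complex.normSq_ofReal, Complex.normSq_eq_norm_sq (Complex.exp _),
    Complex.norm_exp_ofReal_mul_I, Real.mul_self_sqrt (by linarith [Complex.normSq_nonneg B])]
  simp

/-- The coordinates `(β, θ)` identify `SL2Tilde` with `ℂ × ℝ`. -/
def homeoProd : SL2Tilde ≃ₜ ℂ × ℝ where
  toFun p := (slBeta p.mat, p.arg)
  invFun q :=
    { mat := slOfAlphaBeta (√(1 + Complex.normSq q.1) * Complex.exp (q.2 * Complex.I)) q.1
        (normSq_sqrt_mul_exp _ _)
      arg := q.2
      isArg := by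
        rw [IsSlArg, slAlpha_slOfAlphaBeta, norm_mul, Complex.norm_exp_ofReal_mul_I,
          Complex.norm_real, Real.norm_of_nonneg (Real.sqrt_nonneg _), mul_one] }
  left_inv p := by
    refine ext' (sl_ext ?_ ?_) (by simp [Real.pi_pos])
    · rw [slAlpha_slOfAlphaBeta, ← normSq_slAlpha, Complex.normSq_eq_norm_sq,
        Real.sqrt_sq (norm_nonneg _)]
      exact p.isArg.symm
    · rw [slBeta_slOfAlphaBeta]
  right_inv q := by
    simp [slBeta_slOfAlphaBeta]
  continuous_toFun := (continuous_slBeta.comp continuous_mat).prodMk continuous_arg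
  continuous_invFun := by
    refine isInducing.continuous_iff.2 (Continuous.prodMk ?_ continuous_snd)
    refine Topology.IsInducing.subtypeVal.continuous_iff.2 (continuous_matrix fun i j ↦ ?_)
    have hn : Continuous fun q : ℂ × ℝ ↦ Complex.normSq q.1 :=
      Complex.continuous_normSq.comp continuous_fst
    have hA : Continuous fun q : ℂ × ℝ ↦
        (√(1 + Complex.normSq q.1) : ℂ) * Complex.exp (q.2 * Complex.I) := by fun_prop
    have hr := Complex.continuous_re.comp hA
    have hi := Complex.continuous_im.comp hA
    have hr' : Continuous fun q : ℂ × ℝ ↦ q.1.re := Complex.continuous_re.comp continuous_fst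
    have hi' : Continuous fun q : ℂ × ℝ ↦ q.1.im := Complex.continuous_im.comp continuous_fst
    fin_cases i <;> fin_cases j
    · exact hr.add hr'
    · exact hi'.sub hi
    · exact hi.add hi'
    · exact hr.sub hr'

instance : SimplyConnectedSpace SL2Tilde :=
  homeoProd.toHomotopyEquiv.simplyConnectedSpace

theorem normSq_exp_mul_I (t : ℝ) :
    Complex.normSq (Complex.exp (t * Complex.I)) = 1 + Complex.normSq 0 := by
  rw [Complex.normSq_eq_norm_sq, Complex.norm_exp_ofReal_mul_I]
  simp

/-- The one-parameter group of rotations: `x` goes to the lift of the rotation of the plane by the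
angle `π x`, so that exactly the integers go to the center. -/
def rot : Multiplicative ℝ →* SL2Tilde where
  toFun x :=
    { mat := slOfAlphaBeta (Complex.exp ((Real.pi * x.toAdd : ℝ) * Complex.I)) 0
        (normSq_exp_mul_I _)
      arg := Real.pi * x.toAdd
      isArg := by
        rw [IsSlArg, slAlpha_slOfAlphaBeta, Complex.norm_exp_ofReal_mul_I]
        simp }
  map_one' := by
    refine ext' (sl_ext ?_ ?_) ?_
    · simp [slAlpha_slOfAlphaBeta, one_mat, slAlpha_one]
    · rw [slBeta_slOfAlphaBeta]
      apply Complex.ext <;> simp [one_mat, slBeta]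
    · simp [one_arg, Real.pi_pos]
  map_mul' x y := by
    refine ext' (sl_ext ?_ ?_) ?_
    · rw [mul_mat, slAlpha_mul]
      simp only [slAlpha_slOfAlphaBeta, slBeta_slOfAlphaBeta, zero_mul, add_zero]
      rw [← Complex.exp_add, toAdd_mul]
      congr 1
      push_cast
      ring
    · rw [mul_mat, slBeta_mul]
      simp [slBeta_slOfAlphaBeta]
    · simp only [mul_arg, toAdd_mul, mul_add, sub_add_cancel_left, abs_neg]
      exact (abs_slCocycle_lt _ _).trans (by linarith [Real.pi_pos])

end SL2Tilde

/-! ### The three-sphere -/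

/-- The group of unit quaternions. -/
abbrev S3 : Type := Metric.sphere (0 : ℍ[ℝ]) 1

/-- The one-parameter group `y ↦ exp(π i y)`, so that exactly the integers go to the center
`{1, -1}`. -/
def S3.rot : Multiplicative ℝ →* S3 where
  toFun y := ⟨(Complex.exp ((Real.pi * y.toAdd : ℝ) * Complex.I) : ℂ), by
    have h : ∀ z : ℂ, ‖(z : ℍ[ℝ])‖ = ‖z‖ := fun z ↦ by
      rw [← sq_eq_sq₀ (norm_nonneg _) (norm_nonneg _), sq, ← Quaternion.normSq_eq_norm_mul_self,
        Quaternion.normSq_def', ← Complex.normSq_eq_norm_sq, Complex.normSq_apply]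
      simp
      ring
    rw [mem_sphere_zero_iff_norm, h, Complex.norm_exp_ofReal_mul_I]⟩
  map_one' := by
    apply Subtype.ext
    simp
  map_mul' x y := by
    apply Subtype.ext
    rw [Metric.unitSphere.coe_mul, ← Quaternion.coeComplex_mul, ← Complex.exp_add]
    rw [toAdd_mul]
    push_cast
    rw [mul_add, add_mul]

/-! ### Geometries and lattices -/

open scoped Manifold ContDiff in
/-- The topological group `G` is a Lie group, that is, it carries a smooth structure (of some
dimension) for which the group operations are smooth. -/
def AdmitsLieGroupStructure (G : Type) [Group G] [TopologicalSpace G] : Prop :=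
  T2Space G ∧ SecondCountableTopology G ∧
    ∃ (n : ℕ) (_ : ChartedSpace (EuclideanSpace ℝ (Fin n)) G), LieGroup (𝓡 n) ∞ G

/-- `G ⧸ H` is a geometry: `G` is a connected Lie group that acts faithfully and with compact point
stabilizers on the simply-connected (in particular connected) space `G ⧸ H`. -/
structure IsGeometry (G : Type) [Group G] [TopologicalSpace G] (H : Subgroup G) : Prop where
  lieGroup : AdmitsLieGroupStructure G
  connected : ConnectedSpace G
  faithful : FaithfulSMul G (G ⧸ H)
  compact_stabilizer : ∀ x : G ⧸ H, IsCompact (MulAction.stabilizer G x : Set G)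
  simplyConnected : SimplyConnectedSpace (G ⧸ H)

/-- `Γ` is a lattice in `G`: a discrete subgroup for which `G ⧸ Γ` carries a nonzero finite
`G`-invariant Borel measure. -/
def IsLattice {G : Type} [Group G] [TopologicalSpace G] (Γ : Subgroup G) : Prop :=
  DiscreteTopology Γ ∧
    ∃ μ : @MeasureTheory.Measure (G ⧸ Γ) (borel (G ⧸ Γ)), μ ≠ 0 ∧ μ Set.univ < ⊤ ∧
      ∀ (g : G) (s : Set (G ⧸ Γ)), @MeasurableSet (G ⧸ Γ) (borel (G ⧸ Γ)) s →
        μ ((fun x ↦ g • x) ⁻¹' s) = μ s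

/-- `Γ` acts freely on `G ⧸ H`. -/
def ActsFreely {G : Type} [Group G] (Γ H : Subgroup G) : Prop :=
  ∀ γ ∈ Γ, ∀ x : G ⧸ H, γ • x = x → γ = 1

/-- `G ⧸ H` is a model geometry: a geometry for which some lattice of `G` acts freely. -/
def IsModelGeometry (G : Type) [Group G] [TopologicalSpace G] (H : Subgroup G) : Prop :=
  IsGeometry G H ∧ ∃ Γ : Subgroup G, IsLattice Γ ∧ ActsFreely Γ H

/-- `G ⧸ H` and `G' ⧸ H'` are isomorphic as homogeneous spaces: there are an isomorphism of
topological groups and a homeomorphism of the spaces that is equivariant along it. -/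
def HomogeneousIso (G : Type) [Group G] [TopologicalSpace G] (H : Subgroup G)
    (G' : Type) [Group G'] [TopologicalSpace G'] (H' : Subgroup G') : Prop :=
  ∃ (φ : G ≃ₜ* G') (F : (G ⧸ H) ≃ₜ (G' ⧸ H')), ∀ (g : G) (x : G ⧸ H), F (g • x) = φ g • F x

/-- `Γ` is the fundamental group of a punctured surface, embedded as the deck group of a complete
hyperbolic structure of finite area: a torsion-free lattice in `PSL(2, ℝ)` that is not
cocompact. -/
def IsPuncturedSurfaceGroup (Γ : Subgroup PSL(2, ℝ)) : Prop :=
  IsLattice Γ ∧ (∀ γ ∈ Γ, ∀ n : ℕ, 0 < n → γ ^ n = 1 → γ = 1) ∧ ¬ CompactSpace (PSL(2, ℝ) ⧸ Γ)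

/-! ### The homogeneous spaces `(SL2Tilde × K × ℝ) ⧸ τ_{a,b}(ℝ²)` -/

/-- The homomorphism `τ_{a,b} : (x, y) ↦ (rot x, c y, a x + b y)`, where `c` is a one-parameter
group of `K`. -/
def tau {K : Type} [Group K] (c : Multiplicative ℝ →* K) (a b : ℝ) :
    Multiplicative (ℝ × ℝ) →* SL2Tilde × K × Multiplicative ℝ where
  toFun p := (SL2Tilde.rot (.ofAdd p.toAdd.1), c (.ofAdd p.toAdd.2),
    .ofAdd (p.toAdd.1 * a + p.toAdd.2 * b))
  map_one' := by
    simp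
  map_mul' p q := by
    refine Prod.ext ?_ (Prod.ext ?_ ?_)
    · simp
    · simp
    · simp only [toAdd_mul, Prod.fst_add, Prod.snd_add, Prod.snd_mul, ← ofAdd_add]
      congr 1
      ring

/-- The group `G` acting faithfully on `M = (SL2Tilde × K × ℝ) ⧸ τ_{a,b}(ℝ²)`: the quotient of
`SL2Tilde × K × ℝ` by the kernel of its action on `M`, that is, by the normal core of
`τ_{a,b}(ℝ²)`. -/
abbrev TauGroup {K : Type} [Group K] (c : Multiplicative ℝ →* K) (a b : ℝ) : Type :=
  (SL2Tilde × K × Multiplicative ℝ) ⧸ (tau c a b).range.normalCore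

/-- The image of `τ_{a,b}(ℝ²)` in `G`: the stabilizer of the base point, so that `M` is the quotient
of `G` by it. -/
abbrev TauStabilizer {K : Type} [Group K] (c : Multiplicative ℝ →* K) (a b : ℝ) :
    Subgroup (TauGroup c a b) :=
  (tau c a b).range.map (QuotientGroup.mk' (tau c a b).range.normalCore)

/-- `M = (SL2Tilde × K × ℝ) ⧸ τ_{a,b}(ℝ²)` has a quotient by a freely acting lattice of `G` whose
preimage in `SL2Tilde × K × ℝ` projects onto the preimage in `SL2Tilde` of the fundamental group of
a punctured surface. -/
def HasPuncturedSurfaceQuotient {K : Type} [Group K] [TopologicalSpace K]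
    (c : Multiplicative ℝ →* K) (a b : ℝ) : Prop :=
  ∃ Γ : Subgroup (TauGroup c a b), IsLattice Γ ∧ ActsFreely Γ (TauStabilizer c a b) ∧
    ∃ Γ₀ : Subgroup PSL(2, ℝ), IsPuncturedSurfaceGroup Γ₀ ∧
      (Γ.comap (QuotientGroup.mk' (tau c a b).range.normalCore)).map
          (MonoidHom.fst SL2Tilde (K × Multiplicative ℝ)) =
        Γ₀.comap ((QuotientGroup.mk' (Subgroup.center SL(2, ℝ))).comp SL2Tilde.toSL)

end

/-!
Write `N` for the kernel of the action of `G̃ = SL2Tilde × K × ℝ` on `M = G̃ ⧸ τ(ℝ²)` and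
`G = G̃ ⧸ N`. In either factor, every noncentral element of the rotation group has a conjugate
outside the rotation group. Hence `N = τ(ℤ²)` (`IsCircleLike.mem_normalCore`), a discrete central
subgroup, and the stabilizer of the base point is the compact torus `τ(ℝ²) / τ(ℤ²)`.

**The geometry.** The group `G̃` has a global chart in which its operations are smooth: `SL2Tilde`
is `ℂ × ℝ` in the coordinates `(β, θ)`, and `S3 × ℝ` is the group of nonzero quaternions. Composed
with local inverses of the covering `G̃ → G`, it gives the atlas of `G`
(`IsSmoothChart.admitsLieGroupStructure`). As for `M`, the function `β e^{iθ}` is a coordinate on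
`SL2Tilde ⧸ rot ℝ`, which is therefore a plane. If `b ≠ 0`, the last factor of `G̃` can be used up
to normalize the second, and `M` is homeomorphic to `ℂ × K`; if `b = 0`, it is homeomorphic to
`ℂ × ℝ × K ⧸ c(ℝ)`. So `M` is simply connected: the space `SL2Tilde` and its quotient are
contractible, and `S3` and `S3 ⧸ rot ℝ` are spheres (by the Hopf map), which are simply connected
(`simplyConnectedSpace_sphere`).

**The lattice.** The preimage `Λ` of `Γ(2)` in `SL2Tilde` is the product of a free group and the
group of central rotations (`levelTwoHom_injective`, by ping-pong; `mem_levelTwo_iff`, by a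
Euclidean algorithm). So there is a homomorphism `φ : Λ → ℝ` that takes the rotation by `π` to any
given number `a` (`levelTwoChar`). The subgroup `{(g, k, φ g + ψ k + j s)}` of `G̃`, where `k` runs
over a lattice in `K`, `ψ` is a real character of that lattice and `j` runs over the integers, is a
lattice for any `s > 0`. It contains `τ(ℤ²)` for a suitable choice of `ψ` and `s`: while `φ` absorbs
`a`, the number `b` is absorbed by `ψ` if `K = SL2Tilde`, and by `s` if `K = S3`; so the ratio of
`a` and `b` does not matter. The image in `G` is then a lattice (`IsCircleLike.hasPuncturedSurfaceQuotient`). It acts freely, because the traces of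
the elements of `Γ(2)` are congruent to `2` modulo `4`, so that no noncentral rotation is conjugate
to an element of `Λ` (`SL2Tilde.exists_int_of_conj_rot_mem_levelTwo`). Its covolume is finite
because `Λ` and finitely many translates of a Siegel set of finite volume cover `SL2Tilde`
(`SL2Tilde.exists_cover_levelTwo`, `isLattice_of_cover`). All groups in question are unimodular,
`SL2Tilde` because it is perfect.

**The invariant.** Let `K = S3`. An isomorphism can be assumed to match the stabilizer tori. In the
torus, the elements with relatively compact conjugacy class are the `τ(0, y)`, and the elements that
commute with all conjugates of those are the `τ(x, 0)`. So the isomorphism acts on the two circles,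
and does so by signs (`S3.exists_sign_fst`, `S3.exists_sign_snd`). The elements `τ(x, y)` with
`x a + y b = 0` have a trivial component in `ℝ` and so lie in the commutator subgroup, and their
images do as well; this forces `x a' = ± y b'` (`S3.exists_int_of_commutator`), and hence
`a / b = a' / b'` by positivity. Conversely, scaling the factor `ℝ` of `G̃` multiplies `a` and `b`
by the same number (`S3.homogeneousIso_scale`).
-/

noncomputable section

/-! ### Rotations and principal lifts in the universal cover of `SL(2, ℝ)` -/

namespace SL2Tilde

theorem rot_arg (x : ℝ) : (rot (.ofAdd x)).arg = Real.pi * x := rfl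

theorem slAlpha_rot (x : ℝ) :
    slAlpha (rot (.ofAdd x)).mat = Complex.exp ((Real.pi * x : ℝ) * Complex.I) :=
  slAlpha_slOfAlphaBeta _ _ (normSq_exp_mul_I _)

theorem slBeta_rot (x : ℝ) : slBeta (rot (.ofAdd x)).mat = 0 :=
  slBeta_slOfAlphaBeta _ _ (normSq_exp_mul_I _)

theorem rot_mat (x : ℝ) : ((rot (.ofAdd x)).mat : Matrix (Fin 2) (Fin 2) ℝ) =
    !![Real.cos (Real.pi * x), -Real.sin (Real.pi * x);
      Real.sin (Real.pi * x), Real.cos (Real.pi * x)] := by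
  change !![_, _; _, _] = _
  rw [Complex.exp_ofReal_mul_I_re, Complex.exp_ofReal_mul_I_im]
  simp

theorem continuous_rot : Continuous fun x : ℝ ↦ rot (.ofAdd x) := by
  refine isInducing.continuous_iff.2 (Continuous.prodMk ?_ (continuous_const.mul continuous_id))
  refine Topology.IsInducing.subtypeVal.continuous_iff.2 ?_
  refine Continuous.congr (f := fun x : ℝ ↦ !![Real.cos (Real.pi * x), -Real.sin (Real.pi * x);
      Real.sin (Real.pi * x), Real.cos (Real.pi * x)]) ?_ fun x ↦ (rot_mat x).symm
  refine continuous_matrix fun i j ↦ ?_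
  fin_cases i <;> fin_cases j <;> simp <;> fun_prop

theorem rot_add (x y : ℝ) : rot (.ofAdd (x + y)) = rot (.ofAdd x) * rot (.ofAdd y) := by
  rw [ofAdd_add, map_mul]

theorem rot_zero : rot (.ofAdd 0) = 1 := by rw [ofAdd_zero, map_one]

theorem rot_neg (x : ℝ) : rot (.ofAdd (-x)) = (rot (.ofAdd x))⁻¹ := by rw [ofAdd_neg, map_inv]

theorem slCocycle_eq_zero_left {g h : SL(2, ℝ)} (hg : slBeta g = 0) : slCocycle g h = 0 := by
  rw [slCocycle, slAlpha_mul, hg, zero_mul, add_zero,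
    div_self (mul_ne_zero (slAlpha_ne_zero _) (slAlpha_ne_zero _)), Complex.arg_one]

theorem slCocycle_eq_zero_right {g h : SL(2, ℝ)} (hh : slBeta h = 0) : slCocycle g h = 0 := by
  rw [slCocycle, slAlpha_mul, hh, map_zero, mul_zero, add_zero,
    div_self (mul_ne_zero (slAlpha_ne_zero _) (slAlpha_ne_zero _)), Complex.arg_one]

theorem arg_rot_mul (x : ℝ) (p : SL2Tilde) : (rot (.ofAdd x) * p).arg = Real.pi * x + p.arg := by
  rw [mul_arg, slCocycle_eq_zero_left (slBeta_rot x), rot_arg, add_zero]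

theorem arg_mul_rot (p : SL2Tilde) (x : ℝ) : (p * rot (.ofAdd x)).arg = p.arg + Real.pi * x := by
  rw [mul_arg, slCocycle_eq_zero_right (slBeta_rot x), rot_arg, add_zero]

theorem arg_rot_conj (x : ℝ) (p : SL2Tilde) :
    (rot (.ofAdd x) * p * (rot (.ofAdd x))⁻¹).arg = p.arg := by
  rw [← rot_neg, arg_mul_rot, arg_rot_mul]
  ring

theorem abs_mul_arg_sub_lt (p q : SL2Tilde) : |(p * q).arg - (p.arg + q.arg)| < Real.pi / 2 := by
  rw [mul_arg, add_sub_cancel_left]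
  exact abs_slCocycle_lt _ _

/-- The elements over the rotation group are the lifted rotations. -/
theorem eq_rot_of_slBeta_eq_zero {p : SL2Tilde} (h : slBeta p.mat = 0) :
    p = rot (.ofAdd (p.arg / Real.pi)) := by
  have hpi := Real.pi_ne_zero
  have hn : ‖slAlpha p.mat‖ = 1 := by
    have := normSq_slAlpha p.mat
    rw [h, map_zero, add_zero, Complex.normSq_eq_norm_sq] at this
    nlinarith [norm_nonneg (slAlpha p.mat)]
  refine ext' (sl_ext ?_ ?_) ?_
  · rw [slAlpha_rot, mul_div_cancel₀ _ hpi]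
    have := p.isArg
    rw [IsSlArg, hn] at this
    simpa using this
  · rw [h, slBeta_rot]
  · rw [rot_arg, mul_div_cancel₀ _ hpi, sub_self, abs_zero]
    exact Real.two_pi_pos

theorem rot_injective {x y : ℝ} (h : rot (.ofAdd x) = rot (.ofAdd y)) : x = y := by
  have := congrArg SL2Tilde.arg h
  rw [rot_arg, rot_arg] at this
  exact mul_left_cancel₀ Real.pi_ne_zero this

theorem exists_int_of_sin_eq_zero {x : ℝ} (h : Real.sin (Real.pi * x) = 0) : ∃ n : ℤ, x = n := by
  obtain ⟨n, hn⟩ := Real.sin_eq_zero_iff.1 h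
  exact ⟨n, mul_left_cancel₀ Real.pi_ne_zero (by rw [← hn, mul_comm])⟩

theorem sin_pi_mul_int (n : ℤ) : Real.sin (Real.pi * n) = 0 := by
  rw [mul_comm]; exact Real.sin_int_mul_pi n

theorem rot_int_mul (n : ℤ) (p : SL2Tilde) :
    rot (.ofAdd (n : ℝ)) * p = p * rot (.ofAdd (n : ℝ)) := by
  have hr : (starRingEnd ℂ) (Complex.exp ((Real.pi * n : ℝ) * Complex.I)) =
      Complex.exp ((Real.pi * n : ℝ) * Complex.I) := by
    apply Complex.ext
    · simp
    · rw [Complex.conj_im, Complex.exp_ofReal_mul_I_im, sin_pi_mul_int]; simp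
  refine ext' (sl_ext ?_ ?_) ?_
  · simp only [mul_mat, slAlpha_mul, slBeta_rot, slAlpha_rot, map_zero]
    ring
  · simp only [mul_mat, slBeta_mul, slBeta_rot, slAlpha_rot, hr]
    ring
  · rw [arg_rot_mul, arg_mul_rot, add_comm, sub_self, abs_zero]
    exact Real.two_pi_pos

/-- The kernel of the map to `PSL(2, ℝ)` consists of the lifted rotations by multiples of `π`. -/
theorem eq_rot_int {p : SL2Tilde} (hb : slBeta p.mat = 0) (ha : (slAlpha p.mat).im = 0) :
    ∃ n : ℤ, p = rot (.ofAdd (n : ℝ)) := by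
  have h := eq_rot_of_slBeta_eq_zero hb
  rw [h, slAlpha_rot, Complex.exp_ofReal_mul_I_im] at ha
  obtain ⟨n, hn⟩ := exists_int_of_sin_eq_zero ha
  exact ⟨n, hn ▸ h⟩

theorem eq_rot_int_of_mat {p : SL2Tilde} (h01 : p.mat 0 1 = 0) (h10 : p.mat 1 0 = 0)
    (h : p.mat 0 0 = p.mat 1 1) : ∃ n : ℤ, p = rot (.ofAdd (n : ℝ)) := by
  apply eq_rot_int
  · apply Complex.ext <;> simp [slBeta, h01, h10, h]
  · simp [slAlpha, h01, h10]

theorem exists_rot_int_mul {p q : SL2Tilde} (h : p.mat = q.mat) :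
    ∃ n : ℤ, p = rot (.ofAdd (n : ℝ)) * q := by
  obtain ⟨n, hn⟩ : ∃ n : ℤ, p * q⁻¹ = rot (.ofAdd (n : ℝ)) := by
    have e : (p * q⁻¹).mat = 1 := by rw [mul_mat, inv_mat, h, mul_inv_cancel]
    apply eq_rot_int_of_mat <;> simp [e]
  exact ⟨n, by rw [← hn, inv_mul_cancel_right]⟩

/-- The lift of `g` whose argument is the principal value. -/
def principal (g : SL(2, ℝ)) : SL2Tilde := ⟨g, (slAlpha g).arg, IsSlArg.arg g⟩

theorem principal_mat (g : SL(2, ℝ)) : (principal g).mat = g := rfl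

theorem principal_one : principal 1 = 1 := by
  refine ext' rfl ?_
  change |(slAlpha 1).arg - 0| < _
  rw [slAlpha_one, Complex.arg_one]
  simp [Real.pi_pos]

theorem abs_arg_principal {g : SL(2, ℝ)} (hg : 0 < (slAlpha g).re) :
    |(principal g).arg| < Real.pi / 2 :=
  Complex.abs_arg_lt_pi_div_two_iff.2 (Or.inl hg)

/-- The cocycle and the three arguments are less than `π / 2` in absolute value, so that the
arguments of the two sides differ by less than `2 π`. -/
theorem principal_mul {g h : SL(2, ℝ)} (hg : 0 < (slAlpha g).re) (hh : 0 < (slAlpha h).re)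
    (hgh : 0 < (slAlpha (g * h)).re) : principal (g * h) = principal g * principal h := by
  refine ext' rfl ?_
  have h1 := abs_lt.1 (abs_arg_principal hg)
  have h2 := abs_lt.1 (abs_arg_principal hh)
  have h3 := abs_lt.1 (abs_arg_principal hgh)
  have h4 := abs_lt.1 (abs_slCocycle_lt g h)
  rw [mul_arg, principal_mat, principal_mat, abs_lt]
  constructor <;> linarith [h1.1, h1.2, h2.1, h2.2, h3.1, h3.2, h4.1, h4.2]

end SL2Tilde

/-- The upper triangular matrix with diagonal `exp l`, `exp (-l)`, written as the product of a
diagonal and a unipotent matrix. -/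
def slUpper (l u : ℝ) : SL(2, ℝ) :=
  ⟨!![Real.exp l, Real.exp l * u; 0, Real.exp (-l)], by
    rw [Matrix.det_fin_two_of, ← Real.exp_add]; simp⟩

theorem slUpper_coe (l u : ℝ) : (slUpper l u : Matrix (Fin 2) (Fin 2) ℝ) =
    !![Real.exp l, Real.exp l * u; 0, Real.exp (-l)] := rfl

theorem slUpper_mul (l u m v : ℝ) :
    slUpper l u * slUpper m v = slUpper (l + m) (v + Real.exp (-(2 * m)) * u) := by
  apply Subtype.ext
  have h1 : Real.exp (-(2 * m)) = Real.exp (-m) * Real.exp (-m) := by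
    rw [← Real.exp_add]; congr 1; ring
  have h2 : Real.exp m * Real.exp (-m) = 1 := by rw [← Real.exp_add]; simp
  rw [Matrix.SpecialLinearGroup.coe_mul]
  simp only [slUpper_coe]
  ext i j
  fin_cases i <;> fin_cases j <;> simp [Matrix.mul_apply, Fin.sum_univ_two, Real.exp_add, h1]
  · linear_combination (-Real.exp l * Real.exp (-m) * u) * h2
  · ring

theorem slAlpha_slUpper_re (l u : ℝ) : 0 < (slAlpha (slUpper l u)).re := by
  simp [slAlpha, slUpper]
  positivity

namespace SL2Tilde

/-- The lift to `SL2Tilde` of the group of upper triangular matrices with positive diagonal. -/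
def upper (l u : ℝ) : SL2Tilde := principal (slUpper l u)

theorem upper_mat (l u : ℝ) : (upper l u).mat = slUpper l u := rfl

theorem upper_mul (l u m v : ℝ) :
    upper l u * upper m v = upper (l + m) (v + Real.exp (-(2 * m)) * u) := by
  unfold upper
  rw [← slUpper_mul, principal_mul] <;> try apply slAlpha_slUpper_re
  rw [slUpper_mul]
  apply slAlpha_slUpper_re

theorem upper_zero : upper 0 0 = 1 := by
  rw [upper, ← principal_one]
  congr 1
  apply Subtype.ext
  simp [slUpper, Matrix.one_fin_two]

theorem upper_inv (l u : ℝ) : (upper l u)⁻¹ = upper (-l) (-(Real.exp (2 * l) * u)) := by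
  rw [inv_eq_iff_mul_eq_one, upper_mul, ← upper_zero]
  congr 1 <;> simp

theorem abs_upper_arg (l u : ℝ) : |(upper l u).arg| < Real.pi / 2 :=
  abs_arg_principal (slAlpha_slUpper_re l u)

theorem upper_arg_of_diag (l : ℝ) : (upper l 0).arg = 0 := by
  change (slAlpha _).arg = 0
  rw [Complex.arg_eq_zero_iff]
  refine ⟨(slAlpha_slUpper_re l 0).le, ?_⟩
  simp [slAlpha, slUpper]

/-- The Iwasawa decomposition. -/
theorem exists_eq_rot_mul_upper (p : SL2Tilde) :
    ∃ x l u : ℝ, p = rot (.ofAdd x) * upper l u := by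
  set z : ℂ := ⟨p.mat 0 0, p.mat 1 0⟩ with hz
  have hdet := p.mat.det_coe
  rw [Matrix.det_fin_two] at hdet
  have hz0 : z ≠ 0 := by
    intro h
    have h1 := congrArg Complex.re h
    have h2 := congrArg Complex.im h
    simp only [hz, Complex.zero_re, Complex.zero_im] at h1 h2
    rw [h1, h2] at hdet
    simp at hdet
  have hr : 0 < ‖z‖ := norm_pos_iff.2 hz0
  have e := Complex.norm_mul_exp_arg_mul_I z
  have e1 := congrArg Complex.re e
  have e2 := congrArg Complex.im e
  rw [Complex.re_ofReal_mul, Complex.exp_ofReal_mul_I_re] at e1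
  rw [Complex.im_ofReal_mul, Complex.exp_ofReal_mul_I_im] at e2
  change _ = p.mat 0 0 at e1
  change _ = p.mat 1 0 at e2
  set c := Real.cos z.arg
  set s := Real.sin z.arg
  have hcs : c ^ 2 + s ^ 2 = 1 := Real.cos_sq_add_sin_sq _
  set r := ‖z‖
  set b := p.mat 0 1
  set d := p.mat 1 1
  obtain ⟨n, hn⟩ := exists_rot_int_mul (p := p) (q := rot (.ofAdd (z.arg / Real.pi)) *
      upper (Real.log r) ((c * b + s * d) / r)) (by
    apply Subtype.ext
    rw [mul_mat, Matrix.SpecialLinearGroup.coe_mul, rot_mat, mul_div_cancel₀ _ Real.pi_ne_zero]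
    simp only [upper_mat, slUpper_coe, Real.exp_log hr, Real.exp_neg]
    rw [← e1, ← e2] at hdet
    have hdet' : r * (c * d - b * s) = 1 := by linear_combination hdet
    have hri : r⁻¹ = c * d - b * s := inv_eq_of_mul_eq_one_right hdet'
    rw [hri]
    have hrr : r * ((c * b + s * d) / r) = c * b + s * d := by field_simp
    rw [hrr]
    ext i j
    fin_cases i <;> fin_cases j <;> simp [Matrix.mul_apply, Fin.sum_univ_two]
    · linarith [e1]
    · change b = _
      linear_combination (-b) * hcs
    · linarith [e2]
    · change d = _
      linear_combination (-d) * hcs)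
  exact ⟨_, _, _, by rw [← mul_assoc, ← rot_add] at hn; exact hn⟩

theorem rot_half_mat : ((rot (.ofAdd (1 / 2))).mat : Matrix (Fin 2) (Fin 2) ℝ) =
    !![0, -1; 1, 0] := by
  rw [rot_mat]; simp [← div_eq_mul_inv]

theorem rot_half_conj_diag (l : ℝ) :
    rot (.ofAdd (1 / 2)) * upper l 0 * (rot (.ofAdd (1 / 2)))⁻¹ = upper (-l) 0 := by
  rw [mul_inv_eq_iff_eq_mul]
  refine ext' (Subtype.ext ?_) ?_
  · simp only [mul_mat, Matrix.SpecialLinearGroup.coe_mul, rot_half_mat, upper_mat, slUpper_coe]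
    ext i j
    fin_cases i <;> fin_cases j <;> simp [Matrix.mul_apply, Fin.sum_univ_two]
  · rw [arg_rot_mul, arg_mul_rot, upper_arg_of_diag, upper_arg_of_diag]
    simp [Real.pi_pos]

theorem rot_half_conj_unipotent_mat (v : ℝ) :
    ((rot (.ofAdd (1 / 2)) * upper 0 (-v) * (rot (.ofAdd (1 / 2)))⁻¹).mat :
      Matrix (Fin 2) (Fin 2) ℝ) = !![1, 0; v, 1] := by
  have hinv : ((rot (.ofAdd (-(1 / 2)))).mat : Matrix (Fin 2) (Fin 2) ℝ) = !![0, 1; -1, 0] := by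
    rw [rot_mat]; simp [← div_eq_mul_inv]
  rw [mul_mat, mul_mat, ← rot_neg, Matrix.SpecialLinearGroup.coe_mul,
    Matrix.SpecialLinearGroup.coe_mul, rot_half_mat, hinv, upper_mat, slUpper_coe]
  ext i j
  fin_cases i <;> fin_cases j <;> simp [Matrix.mul_apply, Fin.sum_univ_two]

open Real in
/-- `SL2Tilde` is perfect: the diagonal and the unipotent elements are commutators, small rotations
are products of unipotent and upper triangular elements, and all of these generate `SL2Tilde`. -/
theorem commutator_eq_top : commutator SL2Tilde = ⊤ := by
  have hnorm : (commutator SL2Tilde).Normal := inferInstance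
  have hcomm : ∀ p q : SL2Tilde, p * q * p⁻¹ * q⁻¹ ∈ commutator SL2Tilde := fun p q ↦
    Subgroup.commutator_mem_commutator (Subgroup.mem_top p) (Subgroup.mem_top q)
  have hn : ∀ u, upper 0 u ∈ commutator SL2Tilde := fun u ↦ by
    convert hcomm (upper (Real.log 2 / 2) 0) (upper 0 u) using 1
    rw [upper_inv, upper_inv, upper_mul, upper_mul, upper_mul]
    congr 1
    · simp
    · simp [mul_div_cancel₀, Real.exp_log]
      ring
  have hd : ∀ l, upper l 0 ∈ commutator SL2Tilde := fun l ↦ by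
    convert hcomm (rot (.ofAdd (1 / 2))) (upper (-(l / 2)) 0) using 1
    rw [rot_half_conj_diag, upper_inv, upper_mul]
    congr 1 <;> simp
  have hu : ∀ l u, upper l u ∈ commutator SL2Tilde := fun l u ↦ by
    have := mul_mem (hd l) (hn u)
    rw [upper_mul] at this
    simpa using this
  -- a small rotation is the quotient of a lower and an upper triangular matrix
  have hr : ∀ x : ℝ, |x| < 1 / 2 → rot (.ofAdd x) ∈ commutator SL2Tilde := fun x hx ↦ by
    set p := rot (.ofAdd (1 / 2)) * upper 0 (-tan (π * x)) * (rot (.ofAdd (1 / 2)))⁻¹ with hp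
    have hpc : p ∈ commutator SL2Tilde := hnorm.conj_mem _ (hn _) _
    have hpm := rot_half_conj_unipotent_mat (tan (π * x))
    rw [← hp] at hpm
    have hpa : |p.arg| < π / 2 := by
      rw [hp, arg_rot_conj]; exact abs_upper_arg _ _
    obtain ⟨y, l, u, h⟩ := exists_eq_rot_mul_upper p
    have harg : p.arg = π * y + (upper l u).arg := by rw [h, arg_rot_mul]
    have hua := abs_lt.1 (abs_upper_arg l u)
    have hpa := abs_lt.1 hpa
    have hm := hpm
    rw [h, mul_mat, Matrix.SpecialLinearGroup.coe_mul, rot_mat] at hm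
    have h00 := congrFun (congrFun hm 0) 0
    have h10 := congrFun (congrFun hm 1) 0
    simp [upper_mat, slUpper_coe, Matrix.mul_apply, Fin.sum_univ_two] at h00 h10
    have hl := Real.exp_pos l
    have hcos : 0 < cos (π * y) := by
      by_contra hc
      nlinarith
    have hpi := Real.pi_pos
    have hy : π * y ∈ Set.Ioo (-(π / 2)) (π / 2) := by
      have h1 : π * y < π := by linarith [hua.1, hpa.2]
      have h2 : -π < π * y := by linarith [hua.2, hpa.1]
      constructor
      · by_contra hc
        have := Real.cos_nonpos_of_pi_div_two_le_of_le (x := -(π * y)) (by linarith) (by linarith)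
        rw [Real.cos_neg] at this
        linarith
      · by_contra hc
        have := Real.cos_nonpos_of_pi_div_two_le_of_le (x := π * y) (by linarith) (by linarith)
        linarith
    have hx' : π * x ∈ Set.Ioo (-(π / 2)) (π / 2) := by
      rw [abs_lt] at hx
      constructor <;> nlinarith [hx.1, hx.2]
    have htan : tan (π * x) = tan (π * y) := by
      rw [← h10, tan_eq_sin_div_cos, eq_div_iff hcos.ne']
      linear_combination sin (π * y) * h00
    have hxy : x = y :=
      mul_left_cancel₀ hpi.ne' (Real.injOn_tan hx' hy htan)
    rw [hxy, eq_mul_inv_of_mul_eq h.symm]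
    exact mul_mem hpc (inv_mem (hu _ _))
  rw [eq_top_iff]
  intro p _
  obtain ⟨x, l, u, rfl⟩ := exists_eq_rot_mul_upper p
  refine mul_mem ?_ (hu _ _)
  obtain ⟨n, hn⟩ := exists_nat_gt (2 * |x|)
  have hn0 : (0 : ℝ) < n := lt_of_le_of_lt (by positivity) hn
  have e : rot (.ofAdd x) = rot (.ofAdd (x / n)) ^ n := by
    rw [← map_pow, ← ofAdd_nsmul, nsmul_eq_mul, mul_div_cancel₀ _ hn0.ne']
  rw [e]
  refine pow_mem (hr _ ?_) _
  rw [abs_div, Nat.abs_cast, div_lt_iff₀ hn0]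
  linarith

end SL2Tilde

/-! ### Lattices from sets of finite measure -/

open MeasureTheory in
/-- If the translates of `S` under a discrete group `Γ` cover `G`, then `S` contains a fundamental
domain: cover `G` by countably many translates of a set that injects into `G ⧸ Γ`, and keep from
each piece the points whose orbits do not meet the previous ones. -/
theorem exists_isFundamentalDomain_subset {G : Type*} [Group G] [TopologicalSpace G]
    [IsTopologicalGroup G] [SecondCountableTopology G] [MeasurableSpace G] [BorelSpace G]
    (Γ : Subgroup G) [DiscreteTopology Γ] (μ : Measure G) {S : Set G} (hS : MeasurableSet S)
    (hcov : ∀ g : G, ∃ γ ∈ Γ, g * γ ∈ S) :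
    ∃ F ⊆ S, IsFundamentalDomain Γ.op F μ := by
  have hc : Countable Γ := countable_of_Lindelof_of_discrete
  obtain ⟨V, hVo, hV1, hV⟩ : ∃ V : Set G, IsOpen V ∧ (1 : G) ∈ V ∧
      ∀ x ∈ V, ∀ y ∈ V, x⁻¹ * y ∈ Γ → x = y := by
    obtain ⟨U, hU, h⟩ := isOpen_induced_iff.1 (isOpen_discrete ({1} : Set Γ))
    have h1 : (1 : G) ∈ U := by
      have : (1 : Γ) ∈ Subtype.val ⁻¹' U := h ▸ rfl
      exact this
    have hcont : Continuous fun q : G × G ↦ q.1⁻¹ * q.2 := by fun_prop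
    have hn : (fun q : G × G ↦ q.1⁻¹ * q.2) ⁻¹' U ∈ nhds ((1 : G), (1 : G)) :=
      hcont.continuousAt.preimage_mem_nhds (by simpa using hU.mem_nhds h1)
    rw [nhds_prod_eq, Filter.mem_prod_same_iff] at hn
    obtain ⟨t, ht, htU⟩ := hn
    obtain ⟨V, hVt, hVo, hV1⟩ := mem_nhds_iff.1 ht
    refine ⟨V, hVo, hV1, fun x hx y hy hxy ↦ ?_⟩
    have h2 : x⁻¹ * y ∈ U := htU (Set.mk_mem_prod (hVt hx) (hVt hy))
    have h3 : (⟨x⁻¹ * y, hxy⟩ : Γ) ∈ ({1} : Set Γ) := h ▸ h2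
    have h4 : x⁻¹ * y = 1 := by simpa using congrArg Subtype.val h3
    exact (inv_mul_eq_one.1 h4)
  obtain ⟨T, hTc, hT⟩ := TopologicalSpace.countable_cover_nhds
    (f := fun g : G ↦ (fun x ↦ g⁻¹ * x) ⁻¹' V) fun g ↦
      (continuous_const_mul g⁻¹).continuousAt.preimage_mem_nhds
        (by simpa using hVo.mem_nhds hV1)
  have hTne : T.Nonempty := by
    by_contra h
    rw [Set.not_nonempty_iff_eq_empty] at h
    subst h
    simp only [Set.mem_empty_iff_false, Set.iUnion_of_empty, Set.iUnion_empty] at hT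
    exact Set.empty_ne_univ hT
  obtain ⟨e, he⟩ := hTc.exists_eq_range hTne
  set W : ℕ → Set G := fun i ↦ S ∩ (fun x ↦ (e i)⁻¹ * x) ⁻¹' V with hW
  have hWm : ∀ i, MeasurableSet (W i) := fun i ↦
    hS.inter (hVo.preimage (continuous_const_mul _)).measurableSet
  have hWinj : ∀ i, ∀ x ∈ W i, ∀ y ∈ W i, x⁻¹ * y ∈ Γ → x = y := fun i x hx y hy hxy ↦ by
    refine mul_left_cancel (hV _ hx.2 _ hy.2 ?_)
    simpa [mul_assoc] using hxy
  have hWcov : ∀ g : G, ∃ i, ∃ γ : Γ, g * γ ∈ W i := fun g ↦ by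
    obtain ⟨γ, hγ, h⟩ := hcov g
    have h2 : g * γ ∈ ⋃ x ∈ T, (fun y ↦ x⁻¹ * y) ⁻¹' V := hT ▸ Set.mem_univ _
    simp only [Set.mem_iUnion] at h2
    obtain ⟨x, hx, h2⟩ := h2
    rw [he] at hx
    obtain ⟨i, rfl⟩ := hx
    exact ⟨i, ⟨γ, hγ⟩, h, h2⟩
  set F : Set G := ⋃ i, (W i \ ⋃ j, ⋃ (_ : j < i), ⋃ γ : Γ, (fun x ↦ x * (γ : G)) ⁻¹' W j) with hF
  have hFm : MeasurableSet F := by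
    refine MeasurableSet.iUnion fun i ↦ (hWm i).diff (MeasurableSet.iUnion fun j ↦
      MeasurableSet.iUnion fun _ ↦ MeasurableSet.iUnion fun γ ↦ ?_)
    exact (continuous_mul_const (γ : G)).measurable (hWm j)
  refine ⟨F, Set.iUnion_subset fun i ↦ Set.sdiff_subset.trans Set.inter_subset_left,
    IsFundamentalDomain.mk' hFm.nullMeasurableSet fun x ↦ ?_⟩
  obtain ⟨i, ⟨γ, hγ⟩, hmin⟩ : ∃ i, (∃ γ : Γ, x * γ ∈ W i) ∧ ∀ j < i, ∀ δ : Γ, x * δ ∉ W j := by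
    classical
    exact ⟨_, Nat.find_spec (hWcov x), fun j hj δ h ↦ Nat.find_min (hWcov x) hj ⟨δ, h⟩⟩
  refine ⟨⟨MulOpposite.op (γ : G), γ.2⟩, ?_, ?_⟩
  · change x * (γ : G) ∈ F
    refine Set.mem_iUnion.2 ⟨i, hγ, ?_⟩
    simp only [Set.mem_iUnion, not_exists]
    intro j hj δ h
    exact hmin j hj (γ * δ) (by simpa [mul_assoc] using h)
  · rintro ⟨δ, hδ⟩ h
    change x * δ.unop ∈ F at h
    obtain ⟨k, hk, hk'⟩ := Set.mem_iUnion.1 h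
    simp only [Set.mem_iUnion, not_exists] at hk'
    have hki : k = i := by
      refine le_antisymm (le_of_not_gt fun hlt ↦ ?_) (le_of_not_gt fun hlt ↦ ?_)
      · refine hk' i hlt (⟨δ.unop, hδ⟩⁻¹ * γ) ?_
        simpa [mul_assoc] using hγ
      · exact hmin k hlt ⟨δ.unop, hδ⟩ hk
    rw [hki] at hk
    have := hWinj i _ hk _ hγ (by
      have : (x * δ.unop)⁻¹ * (x * γ) = δ.unop⁻¹ * γ := by group
      rw [this]
      exact mul_mem (inv_mem hδ) γ.2)
    apply Subtype.ext
    apply MulOpposite.unop_injective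
    exact mul_left_cancel this

open MeasureTheory in
/-- A discrete subgroup of a unimodular group is a lattice if its translates of some set of finite
Haar measure cover the group: the measure of a fundamental domain inside the set descends to the
quotient. -/
theorem isLattice_of_cover {G : Type} [Group G] [TopologicalSpace G] [IsTopologicalGroup G]
    [PolishSpace G] [MeasurableSpace G] [BorelSpace G] (μ : Measure G) [μ.IsMulLeftInvariant]
    [μ.IsMulRightInvariant] (hμ : μ ≠ 0) (Γ : Subgroup G) [DiscreteTopology Γ] {S : Set G}
    (hS : MeasurableSet S) (hfin : μ S < ⊤) (hcov : ∀ g : G, ∃ γ ∈ Γ, g * γ ∈ S) :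
    IsLattice Γ := by
  refine ⟨inferInstance, ?_⟩
  have hc : Countable Γ := countable_of_Lindelof_of_discrete
  have hc' : Countable Γ.op := Γ.equivOp.symm.injective.countable
  have hcl : IsClosed (Γ : Set G) := Subgroup.isClosed_of_discrete
  obtain ⟨F, hFS, hF⟩ := exists_isFundamentalDomain_subset Γ μ hS hcov
  have ht : T2Space (G ⧸ Γ) := inferInstance
  have hsc : SecondCountableTopology (G ⧸ Γ) := inferInstance
  have hb : BorelSpace (G ⧸ Γ) := Quotient.borelSpace
  -- The quotient σ-algebra is equal to the Borel σ-algebra, but not by definition.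
  have hborel : ∀ (X : Type) (m : MeasurableSpace X) (b : MeasurableSpace X)
      (P : ∀ m : MeasurableSpace X, @Measure X m → Prop), m = b →
      (∃ ν : @Measure X m, P m ν) → ∃ ν : @Measure X b, P b ν := by
    rintro X m _ P rfl h
    exact h
  refine hborel (G ⧸ Γ) inferInstance _ (fun m ν ↦ ν ≠ 0 ∧ ν Set.univ < ⊤ ∧ ∀ (g : G)
    (s : Set (G ⧸ Γ)), @MeasurableSet _ m s → ν ((fun x ↦ g • x) ⁻¹' s) = ν s)
    hb.measurable_eq ?_
  have hq : QuotientMeasureEqMeasurePreimage μ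
      (Measure.map (QuotientGroup.mk : G → G ⧸ Γ) (μ.restrict F)) :=
    hF.quotientMeasureEqMeasurePreimage_quotientMeasure
  have hfd : HasFundamentalDomain Γ.op G μ := ⟨⟨F, hF⟩⟩
  have hinv := QuotientMeasureEqMeasurePreimage.smulInvariantMeasure_quotient (Γ := Γ) μ
    (μ := Measure.map (QuotientGroup.mk : G → G ⧸ Γ) (μ.restrict F))
  have hmeas : Measurable (QuotientGroup.mk : G → G ⧸ Γ) := continuous_quotient_mk'.measurable
  have huniv : Measure.map (QuotientGroup.mk : G → G ⧸ Γ) (μ.restrict F) Set.univ = μ F := by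
    rw [Measure.map_apply hmeas MeasurableSet.univ]
    simp
  refine ⟨Measure.map (QuotientGroup.mk : G → G ⧸ Γ) (μ.restrict F), fun h0 ↦ ?_, ?_,
    fun g s hs ↦ hinv.measure_preimage_smul g hs⟩
  · rw [h0] at huniv
    exact hF.measure_ne_zero hμ huniv.symm
  · rw [huniv]
    exact (measure_mono hFS).trans_lt hfin

open MeasureTheory in
/-- Lattices that contain the kernel of a quotient map of groups go to lattices. -/
theorem IsLattice.map {G G' : Type} [Group G] [TopologicalSpace G] [IsTopologicalGroup G]
    [Group G'] [TopologicalSpace G'] [IsTopologicalGroup G'] {Γ : Subgroup G} (h : IsLattice Γ)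
    (f : G →* G') (hf : Continuous f) (hfo : IsOpenMap f) (hfs : Function.Surjective f)
    (hker : f.ker ≤ Γ) : IsLattice (Γ.map f) := by
  obtain ⟨hd, μ, hμ0, hμfin, hμinv⟩ := h
  constructor
  · obtain ⟨U, hU, h⟩ := isOpen_induced_iff.1 (isOpen_discrete ({1} : Set Γ))
    refine discreteTopology_of_isOpen_singleton_one (isOpen_induced_iff.2 ⟨f '' U, hfo U hU, ?_⟩)
    ext ⟨y, hy⟩
    simp only [Set.mem_preimage, Set.mem_singleton_iff]
    constructor
    · rintro ⟨u, hu, rfl⟩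
      obtain ⟨γ, hγ, hγu⟩ := hy
      have hk : γ⁻¹ * u ∈ f.ker := by rw [MonoidHom.mem_ker, map_mul, map_inv, hγu]; simp
      have huΓ : u ∈ Γ := by simpa using mul_mem hγ (hker hk)
      have : (⟨u, huΓ⟩ : Γ) ∈ ({1} : Set Γ) := h ▸ hu
      have hu1 : u = 1 := by simpa using congrArg Subtype.val this
      apply Subtype.ext
      simp [hu1]
    · intro h1
      have h1' : y = 1 := congrArg Subtype.val h1
      have : (1 : Γ) ∈ Subtype.val ⁻¹' U := h ▸ rfl
      exact ⟨1, this, by simp [h1']⟩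
  · let F : G ⧸ Γ → G' ⧸ Γ.map f := Quotient.map' f fun x y hxy ↦ by
      rw [QuotientGroup.leftRel_apply] at hxy ⊢
      exact ⟨_, hxy, by simp⟩
    have hFc : Continuous F := hf.quotient_map' _
    let m1 : MeasurableSpace (G ⧸ Γ) := borel _
    let m2 : MeasurableSpace (G' ⧸ Γ.map f) := borel _
    have : BorelSpace (G ⧸ Γ) := ⟨rfl⟩
    have : BorelSpace (G' ⧸ Γ.map f) := ⟨rfl⟩
    have hFm := hFc.measurable
    have huniv : μ.map F Set.univ = μ Set.univ := by
      rw [Measure.map_apply hFm MeasurableSet.univ, Set.preimage_univ]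
    refine ⟨μ.map F, fun h0 ↦ hμ0 ?_, huniv.trans_lt hμfin, fun g s hs ↦ ?_⟩
    · rw [← Measure.measure_univ_eq_zero, ← huniv, h0]; rfl
    · obtain ⟨g, rfl⟩ := hfs g
      rw [Measure.map_apply hFm hs, Measure.map_apply hFm, ← hμinv g _ (hFm hs)]
      · congr 1
        ext x
        change f g • F x ∈ s ↔ F (g • x) ∈ s
        have : F (g • x) = f g • F x := by
          obtain ⟨x, rfl⟩ := QuotientGroup.mk_surjective x
          change (QuotientGroup.mk (f (g * x)) : G' ⧸ Γ.map f) = QuotientGroup.mk (f g * f x)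
          rw [map_mul]
        rw [this]
      · exact (continuous_const_smul (f g)).measurable hs

/-! ### Unimodularity -/

open MeasureTheory Measure in
theorem isMulRightInvariant_of_modularCharacterFun {G : Type*} [Group G] [TopologicalSpace G]
    [IsTopologicalGroup G] [LocallyCompactSpace G] [MeasurableSpace G] [BorelSpace G]
    (μ : Measure G) [IsHaarMeasure μ] [InnerRegular μ]
    (h : ∀ g : G, modularCharacterFun g = 1) : μ.IsMulRightInvariant :=
  ⟨fun g ↦ by rw [map_right_mul_eq_modularCharacterFun_smul, h g, one_smul]⟩

open MeasureTheory Measure in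
/-- Perfect groups are unimodular, because the modular character has values in a commutative
group. -/
theorem isMulRightInvariant_of_commutator_eq_top {G : Type*} [Group G] [TopologicalSpace G]
    [IsTopologicalGroup G] [LocallyCompactSpace G] [MeasurableSpace G] [BorelSpace G]
    (μ : Measure G) [IsHaarMeasure μ] [InnerRegular μ] (h : commutator G = ⊤) :
    μ.IsMulRightInvariant := by
  refine isMulRightInvariant_of_modularCharacterFun μ fun g ↦ ?_
  have hk : commutator G ≤ (modularCharacter (G := G)).ker := by
    refine Subgroup.commutator_le.2 fun x _ y _ ↦ ?_
    rw [MonoidHom.mem_ker, commutatorElement_def, map_mul, map_mul, map_mul,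
      mul_right_comm (modularCharacter x), ← map_mul, mul_inv_cancel, map_one, one_mul, ← map_mul,
      mul_inv_cancel, map_one]
  exact hk (h ▸ Subgroup.mem_top g)

open MeasureTheory Measure in
/-- Compact groups are unimodular, because right translation preserves their finite volume. -/
theorem isMulRightInvariant_of_compactSpace {G : Type*} [Group G] [TopologicalSpace G]
    [IsTopologicalGroup G] [CompactSpace G] [MeasurableSpace G] [BorelSpace G]
    (μ : Measure G) [IsHaarMeasure μ] [InnerRegular μ] : μ.IsMulRightInvariant := by
  refine isMulRightInvariant_of_modularCharacterFun μ fun g ↦ ?_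
  have h := congrArg (fun ν : Measure G ↦ ν Set.univ)
    (map_right_mul_eq_modularCharacterFun_smul μ g)
  have h1 : map (· * g) μ Set.univ = μ Set.univ := by
    rw [map_apply (continuous_mul_const g).measurable MeasurableSet.univ, Set.preimage_univ]
  simp only [h1] at h
  rw [Measure.smul_apply] at h
  have h0 : μ Set.univ ≠ 0 := by simp [NeZero.ne μ]
  have hf : μ Set.univ ≠ ⊤ := measure_ne_top μ _
  have h2 : (modularCharacterFun g : ENNReal) * μ Set.univ = 1 * μ Set.univ := by
    rw [one_mul]; exact h.symm
  exact_mod_cast (ENNReal.mul_left_inj h0 hf).1 h2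

/-! ### Finite volume of a Siegel set -/

namespace SL2Tilde

instance : T2Space SL2Tilde := homeoProd.isEmbedding.t2Space

instance : SecondCountableTopology SL2Tilde := homeoProd.secondCountableTopology

instance : LocallyCompactSpace SL2Tilde := homeoProd.isClosedEmbedding.locallyCompactSpace

instance : PolishSpace SL2Tilde := homeoProd.isClosedEmbedding.polishSpace

instance : ConnectedSpace SL2Tilde :=
  homeoProd.symm.surjective.connectedSpace homeoProd.symm.continuous

instance : MeasurableSpace SL2Tilde := borel SL2Tilde

instance : BorelSpace SL2Tilde := ⟨rfl⟩

end SL2Tilde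

/-- The squared norm of the first column. It is the inverse of the height `Im (g⁻¹ • i)`. -/
def slColSq (g : SL(2, ℝ)) : ℝ := g 0 0 ^ 2 + g 1 0 ^ 2

/-- The coordinate in the unipotent factor of the Iwasawa decomposition, equal to
`-Re (g⁻¹ • i)`. -/
def slShift (g : SL(2, ℝ)) : ℝ := (g 0 0 * g 0 1 + g 1 0 * g 1 1) / slColSq g

theorem slColSq_pos (g : SL(2, ℝ)) : 0 < slColSq g := by
  have h := g.det_coe
  rw [Matrix.det_fin_two] at h
  unfold slColSq
  by_contra hn
  have h0 : g 0 0 = 0 := by nlinarith [sq_nonneg (g 0 0), sq_nonneg (g 1 0)]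
  have h1 : g 1 0 = 0 := by nlinarith [sq_nonneg (g 0 0), sq_nonneg (g 1 0)]
  rw [h0, h1] at h
  simp at h

theorem continuous_slColSq : Continuous slColSq := by
  unfold slColSq
  fun_prop

theorem continuous_slShift : Continuous slShift := by
  unfold slShift
  exact Continuous.div (by fun_prop) continuous_slColSq fun g ↦ (slColSq_pos g).ne'

theorem slColSq_mul_slUpper (g : SL(2, ℝ)) (l u : ℝ) :
    slColSq (g * slUpper l u) = Real.exp (2 * l) * slColSq g := by
  have h : Real.exp (2 * l) = Real.exp l * Real.exp l := by rw [← Real.exp_add]; congr 1; ring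
  simp only [slColSq, Matrix.SpecialLinearGroup.coe_mul, slUpper_coe, Matrix.mul_apply,
    Fin.sum_univ_two, h]
  simp
  ring

theorem slShift_mul_slUpper (g : SL(2, ℝ)) (l u : ℝ) :
    slShift (g * slUpper l u) = u + Real.exp (-(2 * l)) * slShift g := by
  have hs := (slColSq_pos g).ne'
  have h : Real.exp (2 * l) = Real.exp l * Real.exp l := by rw [← Real.exp_add]; congr 1; ring
  have h1 : Real.exp l * Real.exp (-l) = 1 := by rw [← Real.exp_add]; simp
  have he := (Real.exp_pos l).ne'
  rw [slShift, slColSq_mul_slUpper, div_eq_iff (mul_ne_zero (Real.exp_pos _).ne' hs), Real.exp_neg,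
    add_mul]
  have e : (Real.exp (2 * l))⁻¹ * slShift g * (Real.exp (2 * l) * slColSq g) =
      slShift g * slColSq g := by
    field_simp
  rw [e, slShift, div_mul_cancel₀ _ hs]
  simp only [slColSq, Matrix.SpecialLinearGroup.coe_mul, slUpper_coe, Matrix.mul_apply,
    Fin.sum_univ_two, h]
  simp
  linear_combination (g 0 0 * g 0 1 + g 1 0 * g 1 1) * h1

/-- The Iwasawa coordinates control the coordinate `β`: `2 |β|²` is at most the sum of the squares
of the matrix entries. -/
theorem normSq_slBeta_le (g : SL(2, ℝ)) :
    Complex.normSq (slBeta g) ≤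
      (slColSq g + (1 + (slShift g * slColSq g) ^ 2) / slColSq g) / 2 := by
  have hs := slColSq_pos g
  have h : g 0 0 * g 1 1 - g 0 1 * g 1 0 = 1 := by rw [← Matrix.det_fin_two, g.det_coe]
  have e : (1 + (slShift g * slColSq g) ^ 2) / slColSq g = g 0 1 ^ 2 + g 1 1 ^ 2 := by
    rw [slShift, div_mul_cancel₀ _ hs.ne', div_eq_iff hs.ne', slColSq]
    linear_combination (-(g 0 0 * g 1 1 - g 0 1 * g 1 0) - 1) * h
  rw [e, slColSq, Complex.normSq_apply]
  simp only [slBeta]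
  nlinarith [sq_nonneg (g 0 0 + g 1 1), sq_nonneg (g 1 0 - g 0 1)]

namespace SL2Tilde

open MeasureTheory Measure

instance : IsMulRightInvariant (haar : Measure SL2Tilde) :=
  isMulRightInvariant_of_commutator_eq_top _ commutator_eq_top

/-- A slab of the Siegel set in Iwasawa coordinates. -/
def slab (t A B : ℝ) : Set SL2Tilde :=
  {p | |p.arg| ≤ t ∧ slColSq p.mat ∈ Set.Icc (1 / 2) 2 ∧ slShift p.mat ∈ Set.Ico A B}

theorem continuous_colSq : Continuous fun p : SL2Tilde ↦ slColSq p.mat :=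
  continuous_slColSq.comp continuous_mat

theorem continuous_shift : Continuous fun p : SL2Tilde ↦ slShift p.mat :=
  continuous_slShift.comp continuous_mat

theorem measurableSet_slab (t A B : ℝ) : MeasurableSet (slab t A B) :=
  (isClosed_le continuous_arg.abs continuous_const).measurableSet.inter
    ((continuous_colSq.measurable measurableSet_Icc).inter
      (continuous_shift.measurable measurableSet_Ico))

theorem haar_slab_lt_top (t A B : ℝ) : haar (slab t A B) < ⊤ := by
  set M := max |A| |B|
  set R := 1 + (2 + (1 + (M * 2) ^ 2) * 2) / 2 with hR
  have hK : IsCompact (homeoProd.symm '' (Metric.closedBall (0 : ℂ) R ×ˢ Set.Icc (-t) t)) :=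
    ((isCompact_closedBall _ _).prod isCompact_Icc).image homeoProd.symm.continuous
  -- a slab lies in a compact set of the global coordinates `(β, θ)`
  refine (measure_mono fun p hp ↦ ?_).trans_lt hK.measure_lt_top
  obtain ⟨h1, ⟨h2, h2'⟩, h3, h3'⟩ := hp
  refine ⟨homeoProd p, ⟨?_, abs_le.1 h1⟩, homeoProd.symm_apply_apply p⟩
  change slBeta p.mat ∈ _
  rw [mem_closedBall_zero_iff]
  have hb := normSq_slBeta_le p.mat
  rw [Complex.normSq_eq_norm_sq] at hb
  set s := slColSq p.mat
  set v := slShift p.mat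
  have hv : |v| ≤ M := abs_le_max_abs_abs h3 h3'.le
  have hvs : (v * s) ^ 2 ≤ (M * 2) ^ 2 := by
    rw [sq_le_sq, abs_mul, abs_mul]
    have h0 : |s| ≤ |(2 : ℝ)| := by rw [abs_of_nonneg (by linarith), abs_two]; exact h2'
    have h0' : |v| ≤ |M| := hv.trans (le_abs_self M)
    gcongr
  have hd : (1 + (v * s) ^ 2) / s ≤ (1 + (M * 2) ^ 2) * 2 := by
    rw [div_le_iff₀ (by linarith)]
    nlinarith
  have hfin : ‖slBeta p.mat‖ ^ 2 ≤ R - 1 := by rw [hR]; linarith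
  nlinarith [norm_nonneg (slBeta p.mat), sq_nonneg (‖slBeta p.mat‖ - 1)]

/-- Narrow slabs have small volume, as many disjoint right translates of a narrow slab by unipotent
elements fit into a wide one. -/
theorem pow_mul_haar_slab_le (j : ℕ) :
    (4 : ENNReal) ^ j * haar (slab (2 * Real.pi) (-(1 / 4) ^ j) ((1 / 4) ^ j)) ≤
      haar (slab (3 * Real.pi) (-1) 2) := by
  set q : ℝ := (1 / 4) ^ j with hq
  have hq0 : 0 < q := by positivity
  have hq1 : q ≤ 1 := pow_le_one₀ (by norm_num) (by norm_num)
  have h4 : (4 : ℝ) ^ j * q = 1 := by rw [hq, ← mul_pow]; norm_num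
  set X := slab (2 * Real.pi) (-q) q
  set Y : ℕ → Set SL2Tilde := fun i ↦ (fun p ↦ p * upper 0 (-(2 * i * q))) ⁻¹' X with hY
  have hYv : ∀ i, ∀ p ∈ Y i, slShift p.mat - 2 * i * q ∈ Set.Ico (-q) q := fun i p hp ↦ by
    have := hp.2.2
    rw [mul_mat, upper_mat, slShift_mul_slUpper] at this
    simpa [sub_eq_neg_add] using this
  have hYm : ∀ i, haar (Y i) = haar X := fun i ↦ measure_preimage_mul_right haar _ X
  have hsum : ∑ i ∈ Finset.range (4 ^ j), haar (Y i) = (4 : ENNReal) ^ j * haar X := by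
    simp [hYm]
  rw [← hsum, ← measure_biUnion_finset]
  · refine measure_mono (Set.iUnion₂_subset fun i hi p hp ↦ ?_)
    have hv := hYv i p hp
    obtain ⟨h1, h2, -⟩ := hp
    refine ⟨?_, ?_, ?_⟩
    · have ha := abs_lt.1 (abs_mul_arg_sub_lt p (upper 0 (-(2 * i * q))))
      have hb := abs_lt.1 (abs_upper_arg 0 (-(2 * i * q)))
      have hc := abs_le.1 h1
      rw [abs_le]
      constructor <;> linarith [ha.1, ha.2, hb.1, hb.2, hc.1, hc.2]
    · rw [mul_mat, upper_mat, slColSq_mul_slUpper] at h2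
      simpa using h2
    · have hi' : (i : ℝ) + 1 ≤ 4 ^ j := by
        have := Finset.mem_range.1 hi
        exact_mod_cast this
      have h5 : (i + 1) * q ≤ 1 := h4.le.trans' (mul_le_mul_of_nonneg_right hi' hq0.le)
      have h6 : 0 ≤ i * q := by positivity
      constructor <;> linarith [hv.1, hv.2]
  · intro i _ k _ hik
    refine Set.disjoint_left.2 fun p hp hp' ↦ hik ?_
    have h1 := hYv i p hp
    have h2 := hYv k p hp'
    have h3 : |((i : ℤ) - (k : ℤ) : ℝ)| < 1 := by
      rw [abs_lt]
      push_cast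
      constructor <;> nlinarith [h1.1, h1.2, h2.1, h2.2]
    have h4 : (i : ℤ) - k = 0 := Int.abs_lt_one_iff.1 (by exact_mod_cast h3)
    omega
  · intro i _
    exact (continuous_mul_const _).measurable (measurableSet_slab _ _ _)

/-- A Siegel set for the preimage of `SL(2, ℤ)`. -/
def siegel : Set SL2Tilde :=
  {p | p.arg ∈ Set.Ico 0 Real.pi ∧ slColSq p.mat ≤ 2 ∧ slShift p.mat ∈ Set.Ico (-1) 1}

theorem measurableSet_siegel : MeasurableSet siegel :=
  (continuous_arg.measurable measurableSet_Ico).inter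
    ((continuous_colSq.measurable measurableSet_Iic).inter
      (continuous_shift.measurable measurableSet_Ico))

/-- The cusp is cut into pieces by the size of the first column. Right translation by a diagonal
element, which preserves volume, carries the `j`-th piece into a slab of width proportional to
`4⁻ʲ`; so the volumes of the pieces are summable. -/
theorem haar_siegel_lt_top : haar siegel < ⊤ := by
  set E : ℕ → Set SL2Tilde := fun j ↦ siegel ∩
    {p | 2 * (1 / 4) ^ (j + 1) < slColSq p.mat ∧ slColSq p.mat ≤ 2 * (1 / 4) ^ j} with hE
  have hcov : siegel ⊆ ⋃ j, E j := fun p hp ↦ by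
    have h0 := slColSq_pos p.mat
    obtain ⟨n, h1, h2⟩ := exists_nat_pow_near_of_lt_one (x := slColSq p.mat / 2) (y := (1 / 4 : ℝ))
      (by positivity) (by linarith [hp.2.1]) (by norm_num) (by norm_num)
    exact Set.mem_iUnion.2 ⟨n, hp, by linarith, by linarith⟩
  have hE' : ∀ j, haar (E j) ≤ haar (slab (3 * Real.pi) (-1) 2) * (1 / 4) ^ j := fun j ↦ by
    set q : ℝ := (1 / 4) ^ j with hq
    have hq0 : 0 < q := by positivity
    have hle : haar (E j) ≤ haar (slab (2 * Real.pi) (-q) q) := by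
      rw [← measure_preimage_mul_right haar (upper (-(Real.log q / 2)) 0)
        (slab (2 * Real.pi) (-q) q)]
      refine measure_mono fun p hp ↦ ?_
      obtain ⟨⟨⟨ha, ha'⟩, -, hv⟩, hs, hs'⟩ := hp
      have e1 : Real.exp (2 * -(Real.log q / 2)) = q⁻¹ := by
        rw [← Real.exp_log (inv_pos.2 hq0), Real.log_inv]; congr 1; ring
      have e2 : Real.exp (-(2 * -(Real.log q / 2))) = q := by
        rw [Real.exp_neg, e1, inv_inv]
      refine ⟨?_, ?_, ?_⟩
      · have hb := abs_lt.1 (abs_mul_arg_sub_lt p (upper (-(Real.log q / 2)) 0))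
        rw [upper_arg_of_diag] at hb
        rw [abs_le]
        constructor <;> linarith [hb.1, hb.2, Real.pi_pos]
      · rw [mul_mat, upper_mat, slColSq_mul_slUpper, e1]
        rw [pow_succ] at hs
        constructor
        · rw [inv_mul_eq_div, le_div_iff₀ hq0]; linarith
        · rw [inv_mul_eq_div, div_le_iff₀ hq0]; linarith
      · rw [mul_mat, upper_mat, slShift_mul_slUpper, e2, zero_add]
        constructor <;> nlinarith [hv.1, hv.2]
    have h2 := pow_mul_haar_slab_le j
    rw [one_div, ← ENNReal.inv_pow, ← div_eq_mul_inv,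
      ENNReal.le_div_iff_mul_le (Or.inl (by simp)) (Or.inl (by simp)), mul_comm]
    exact (mul_le_mul_right hle _).trans h2
  refine (measure_mono hcov).trans_lt ((measure_iUnion_le E).trans_lt
    ((ENNReal.tsum_le_tsum hE').trans_lt ?_))
  rw [ENNReal.tsum_mul_left, ENNReal.tsum_geometric]
  refine ENNReal.mul_lt_top (haar_slab_lt_top _ _ _) ?_
  rw [ENNReal.inv_lt_top, tsub_pos_iff_lt]
  simp

end SL2Tilde

open Matrix SpecialLinearGroup in
/-- Reduction theory for `SL(2, ℤ)`, in terms of the Iwasawa coordinates. -/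
theorem exists_int_mul_mem_siegel (g : SL(2, ℝ)) : ∃ γ : SL(2, ℤ),
    slColSq (g * map (Int.castRingHom ℝ) γ) ≤ 2 ∧
      slShift (g * map (Int.castRingHom ℝ) γ) ∈ Set.Ico (-1) 1 := by
  obtain ⟨γ, hγ⟩ := ModularGroup.exists_smul_mem_fd (g⁻¹ • UpperHalfPlane.I)
  refine ⟨γ⁻¹, ?_⟩
  set h := g * map (Int.castRingHom ℝ) γ⁻¹ with hh
  have e : γ • (g⁻¹ • UpperHalfPlane.I) = h⁻¹ • UpperHalfPlane.I := by
    rw [hh, _root_.mul_inv_rev, map_inv, inv_inv, mul_smul]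
    rfl
  rw [e] at hγ
  have hs := slColSq_pos h
  have hdet : h 0 0 * h 1 1 - h 0 1 * h 1 0 = 1 := by rw [← Matrix.det_fin_two, h.det_coe]
  have hz : ((h⁻¹ • UpperHalfPlane.I : UpperHalfPlane) : ℂ) =
      ⟨-slShift h, 1 / slColSq h⟩ := by
    rw [UpperHalfPlane.specialLinearGroup_apply, SL2_inv_expl]
    have hne : (-((h 1 0 : ℂ) * Complex.I) + h 0 0) ≠ 0 := fun h0 ↦ by
      have h1 := congrArg Complex.re h0
      have h2 := congrArg Complex.im h0
      simp at h1 h2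
      rw [slColSq, h1, h2] at hs
      simp at hs
    have hs' : h 0 0 ^ 2 + h 1 0 ^ 2 ≠ 0 := hs.ne'
    simp only [UpperHalfPlane.coe_I]
    simp
    rw [div_eq_iff hne, slShift, slColSq]
    apply Complex.ext
    · simp
      field_simp
      linear_combination h 1 0 * hdet
    · simp
      field_simp
      linear_combination h 0 0 * hdet
  have him : (h⁻¹ • UpperHalfPlane.I : UpperHalfPlane).im = 1 / slColSq h := congrArg Complex.im hz
  have hre : (h⁻¹ • UpperHalfPlane.I : UpperHalfPlane).re = -slShift h := congrArg Complex.re hz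
  have h3 := ModularGroup.three_le_four_mul_im_sq_of_mem_fd hγ
  have h4 := hγ.2
  rw [him] at h3
  rw [hre, abs_neg, abs_le] at h4
  refine ⟨?_, by linarith [h4.1], by linarith [h4.2]⟩
  rw [one_div, inv_pow, ← div_eq_mul_inv, le_div_iff₀ (by positivity)] at h3
  nlinarith

/-! ### A free lattice: the congruence subgroup of level two -/

namespace SL2Tilde

/-- The lifts of `[1, 2; 0, 1]` and `[1, 0; 2, 1]`. -/
def levelTwoGen : Fin 2 → SL2Tilde :=
  ![upper 0 2, rot (.ofAdd (1 / 2)) * upper 0 (-2) * (rot (.ofAdd (1 / 2)))⁻¹]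

theorem levelTwoGen_zero_mat :
    ((levelTwoGen 0).mat : Matrix (Fin 2) (Fin 2) ℝ) = !![1, 2; 0, 1] := by
  change (slUpper 0 2 : Matrix (Fin 2) (Fin 2) ℝ) = _
  rw [slUpper_coe]; simp

theorem levelTwoGen_one_mat : ((levelTwoGen 1).mat : Matrix (Fin 2) (Fin 2) ℝ) = !![1, 0; 2, 1] :=
  rot_half_conj_unipotent_mat 2

/-- The rotations by multiples of `π`. -/
def rotInt : Multiplicative ℤ →* SL2Tilde :=
  rot.comp (AddMonoidHom.toMultiplicative (Int.castAddHom ℝ))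

/-- The product of the free group on the two generators and the group of rotations by multiples
of `π`, mapped to `SL2Tilde`. -/
def levelTwoHom : FreeGroup (Fin 2) × Multiplicative ℤ →* SL2Tilde :=
  (FreeGroup.lift levelTwoGen).noncommCoprod rotInt fun _ n ↦ (rot_int_mul n.toAdd _).symm

theorem levelTwoHom_apply (w : FreeGroup (Fin 2)) (n : ℤ) :
    levelTwoHom (w, .ofAdd n) = FreeGroup.lift levelTwoGen w * rot (.ofAdd (n : ℝ)) := rfl

/-- The preimage in `SL2Tilde` of the image of `Γ(2)` in `PSL(2, ℝ)`. -/
def levelTwo : Subgroup SL2Tilde := levelTwoHom.range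

theorem rot_int_mem_levelTwo (n : ℤ) : rot (.ofAdd (n : ℝ)) ∈ levelTwo :=
  ⟨(1, .ofAdd n), by rw [levelTwoHom_apply, map_one, one_mul]⟩

theorem levelTwoGen_mem (i : Fin 2) : levelTwoGen i ∈ levelTwo :=
  ⟨(FreeGroup.of i, 1), by
    rw [← ofAdd_zero, levelTwoHom_apply, Int.cast_zero, rot_zero, mul_one, FreeGroup.lift_apply_of]⟩

/-- The homomorphism to the isometries of the upper half plane. -/
def toPerm : SL2Tilde →* Equiv.Perm UpperHalfPlane :=
  (MulAction.toPermHom SL(2, ℝ) UpperHalfPlane).comp toSL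

theorem coe_toPerm (p : SL2Tilde) (z : UpperHalfPlane) : (toPerm p z : ℂ) =
    (p.mat 0 0 * z + p.mat 0 1) / (p.mat 1 0 * z + p.mat 1 1) :=
  UpperHalfPlane.coe_specialLinearGroup_apply p.mat z

theorem toPerm_rot_int (n : ℤ) : toPerm (rot (.ofAdd (n : ℝ))) = 1 := by
  ext z
  have hs : Real.sin (Real.pi * n) = 0 := sin_pi_mul_int n
  have hc : (Real.cos (Real.pi * n) : ℂ) ≠ 0 := by
    intro h
    have h2 := Real.sin_sq_add_cos_sq (Real.pi * n)
    rw [Complex.ofReal_eq_zero] at h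
    rw [h, hs] at h2
    simp at h2
  rw [coe_toPerm, rot_mat, hs]
  simp only [Matrix.of_apply, Matrix.cons_val', Matrix.cons_val_zero, Matrix.cons_val_one,
    Matrix.cons_val_fin_one, neg_zero, Complex.ofReal_zero, add_zero, zero_mul, zero_add]
  rw [mul_div_cancel_left₀ _ hc]
  rfl

theorem toPerm_levelTwoGen_zero (z : UpperHalfPlane) : (toPerm (levelTwoGen 0) z : ℂ) = z + 2 := by
  rw [coe_toPerm, levelTwoGen_zero_mat]; simp

theorem inv_toPerm_levelTwoGen_one (z : UpperHalfPlane) :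
    (toPerm (levelTwoGen 1) z : ℂ)⁻¹ = (z : ℂ)⁻¹ + 2 := by
  rw [coe_toPerm, levelTwoGen_one_mat]
  have := z.ne_zero
  simp
  field_simp
  ring

/-- The ping-pong lemma, with half planes bounded by the vertical lines through `±1` and with
their images under `z ↦ 1 / z`. -/
theorem injective_toPerm_comp_lift :
    Function.Injective (toPerm.comp (FreeGroup.lift levelTwoGen)) := by
  have e : toPerm.comp (FreeGroup.lift levelTwoGen) =
      FreeGroup.lift fun i ↦ toPerm (levelTwoGen i) := by
    ext i; simp
  rw [e]
  set X : Fin 2 → Set UpperHalfPlane := ![{z | 1 ≤ (z : ℂ).re}, {z | 1 ≤ ((z : ℂ)⁻¹).re}] with hX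
  set Y : Fin 2 → Set UpperHalfPlane := ![{z | (z : ℂ).re < -1}, {z | ((z : ℂ)⁻¹).re < -1}] with hY
  have key : ∀ z : UpperHalfPlane, |(z : ℂ).re * ((z : ℂ)⁻¹).re| < 1 := fun z ↦ by
    have h1 : 0 < z.im := z.im_pos
    have h2 : (z : ℂ).im = z.im := rfl
    have h3 : 0 < (z : ℂ).re * (z : ℂ).re + (z : ℂ).im * (z : ℂ).im := by
      rw [h2]; nlinarith [mul_self_nonneg (z : ℂ).re]
    rw [Complex.inv_re, Complex.normSq_apply, ← mul_div_assoc, abs_div, abs_of_pos h3,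
      div_lt_one h3, abs_mul_self, h2]
    nlinarith
  have hX0 : ∀ z, z ∈ X 0 ↔ 1 ≤ (z : ℂ).re := fun _ ↦ Iff.rfl
  have hX1 : ∀ z, z ∈ X 1 ↔ 1 ≤ ((z : ℂ)⁻¹).re := fun _ ↦ Iff.rfl
  have hY0 : ∀ z, z ∈ Y 0 ↔ (z : ℂ).re < -1 := fun _ ↦ Iff.rfl
  have hY1 : ∀ z, z ∈ Y 1 ↔ ((z : ℂ)⁻¹).re < -1 := fun _ ↦ Iff.rfl
  have hXX : ∀ z, ¬ (z ∈ X 0 ∧ z ∈ X 1) := fun z ⟨h, h'⟩ ↦ by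
    have := abs_lt.1 (key z)
    rw [hX0] at h
    rw [hX1] at h'
    nlinarith
  have hYY : ∀ z, ¬ (z ∈ Y 0 ∧ z ∈ Y 1) := fun z ⟨h, h'⟩ ↦ by
    have := abs_lt.1 (key z)
    rw [hY0] at h
    rw [hY1] at h'
    nlinarith
  have hXY : ∀ i j z, ¬ (z ∈ X i ∧ z ∈ Y j) := fun i j z ⟨h, h'⟩ ↦ by
    have := abs_lt.1 (key z)
    have hi : z ∈ X 0 ∨ z ∈ X 1 := by fin_cases i <;> tauto
    have hj : z ∈ Y 0 ∨ z ∈ Y 1 := by fin_cases j <;> tauto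
    rw [hX0, hX1] at hi
    rw [hY0, hY1] at hj
    rcases hi with hi | hi <;> rcases hj with hj | hj <;> nlinarith
  refine FreeGroup.injective_lift_of_ping_pong _ X Y ?_ ?_ ?_ ?_ ?_ ?_
  · intro i
    fin_cases i
    · exact ⟨⟨⟨1, 1⟩, one_pos⟩, le_refl (1 : ℝ)⟩
    · refine ⟨⟨⟨1 / 2, 1 / 2⟩, by norm_num⟩, ?_⟩
      change 1 ≤ ((⟨1 / 2, 1 / 2⟩ : ℂ)⁻¹).re
      rw [Complex.inv_re, Complex.normSq_apply]
      norm_num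
  · intro i j hij
    refine Set.disjoint_left.2 fun z h h' ↦ ?_
    fin_cases i <;> fin_cases j
    · exact hij rfl
    · exact hXX z ⟨h, h'⟩
    · exact hXX z ⟨h', h⟩
    · exact hij rfl
  · intro i j hij
    refine Set.disjoint_left.2 fun z h h' ↦ ?_
    fin_cases i <;> fin_cases j
    · exact hij rfl
    · exact hYY z ⟨h, h'⟩
    · exact hYY z ⟨h', h⟩
    · exact hij rfl
  · exact fun i j ↦ Set.disjoint_left.2 fun z h h' ↦ hXY i j z ⟨h, h'⟩
  · rintro i _ ⟨z, hz, rfl⟩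
    fin_cases i
    · change ¬ (z : ℂ).re < -1 at hz
      change 1 ≤ (toPerm (levelTwoGen 0) z : ℂ).re
      rw [toPerm_levelTwoGen_zero]
      simp at hz ⊢
      linarith
    · change ¬ ((z : ℂ)⁻¹).re < -1 at hz
      change 1 ≤ ((toPerm (levelTwoGen 1) z : ℂ)⁻¹).re
      rw [inv_toPerm_levelTwoGen_one, Complex.add_re]
      have : (2 : ℂ).re = 2 := rfl
      linarith
  · rintro i _ ⟨z, hz, rfl⟩
    fin_cases i
    · change ¬ 1 ≤ (z : ℂ).re at hz
      change (((toPerm (levelTwoGen 0))⁻¹ z : UpperHalfPlane) : ℂ).re < -1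
      have h := toPerm_levelTwoGen_zero ((toPerm (levelTwoGen 0))⁻¹ z)
      rw [← Equiv.Perm.mul_apply, mul_inv_cancel, Equiv.Perm.one_apply] at h
      rw [h, Complex.add_re] at hz
      have : (2 : ℂ).re = 2 := rfl
      linarith
    · change ¬ 1 ≤ ((z : ℂ)⁻¹).re at hz
      change ((((toPerm (levelTwoGen 1))⁻¹ z : UpperHalfPlane) : ℂ)⁻¹).re < -1
      have h := inv_toPerm_levelTwoGen_one ((toPerm (levelTwoGen 1))⁻¹ z)
      rw [← Equiv.Perm.mul_apply, mul_inv_cancel, Equiv.Perm.one_apply] at h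
      rw [h, Complex.add_re] at hz
      have : (2 : ℂ).re = 2 := rfl
      linarith

/-- Modulo the rotations by multiples of `π`, which act trivially on the upper half plane, this is
the ping-pong lemma. -/
theorem levelTwoHom_injective : Function.Injective levelTwoHom := by
  rw [injective_iff_map_eq_one]
  rintro ⟨w, n⟩ h
  change FreeGroup.lift levelTwoGen w * rot (.ofAdd ((n.toAdd : ℤ) : ℝ)) = 1 at h
  have hw : w = 1 := by
    refine (injective_iff_map_eq_one _).1 injective_toPerm_comp_lift w ?_
    have := congrArg toPerm h
    rwa [map_mul, toPerm_rot_int, mul_one, map_one] at this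
  rw [hw, map_one, one_mul, ← rot_zero] at h
  have hn := rot_injective h
  refine Prod.ext hw (Multiplicative.toAdd.injective ?_)
  exact_mod_cast hn

/-- The homomorphism from the preimage of `Γ(2)` to the integers that is trivial on the free factor
and takes the rotation by `π` to `1`. -/
def levelTwoWinding : levelTwo →* Multiplicative ℤ :=
  (MonoidHom.snd _ _).comp (MonoidHom.ofInjective levelTwoHom_injective).symm.toMonoidHom

theorem levelTwoWinding_rot (n : ℤ) :
    levelTwoWinding ⟨rot (.ofAdd (n : ℝ)), rot_int_mem_levelTwo n⟩ = .ofAdd n := by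
  have : (MonoidHom.ofInjective levelTwoHom_injective) (1, .ofAdd n) =
      ⟨rot (.ofAdd (n : ℝ)), rot_int_mem_levelTwo n⟩ := by
    apply Subtype.ext
    rw [MonoidHom.ofInjective_apply, levelTwoHom_apply, map_one, one_mul]
  change ((MonoidHom.ofInjective levelTwoHom_injective).symm _).2 = _
  erw [← this, MulEquiv.symm_apply_apply]

/-- `g` is an integral matrix, congruent to the identity modulo `2`. -/
def IsLevelTwo (g : SL(2, ℝ)) : Prop :=
  ∃ a b c d : ℤ, (g : Matrix (Fin 2) (Fin 2) ℝ) = !![(a : ℝ), b; c, d] ∧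
    Odd a ∧ Even b ∧ Even c ∧ Odd d

theorem IsLevelTwo.mul {g h : SL(2, ℝ)} (hg : IsLevelTwo g) (hh : IsLevelTwo h) :
    IsLevelTwo (g * h) := by
  obtain ⟨a, b, c, d, e, ha, hb, hc, hd⟩ := hg
  obtain ⟨a', b', c', d', e', ha', hb', hc', hd'⟩ := hh
  refine ⟨a * a' + b * c', a * b' + b * d', c * a' + d * c', c * b' + d * d', ?_,
    (ha.mul ha').add_even (hb.mul_right _), (hb'.mul_left _).add (hb.mul_right _),
    (hc.mul_right _).add (hc'.mul_left _), ((hc.mul_right _).add_odd (hd.mul hd'))⟩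
  rw [Matrix.SpecialLinearGroup.coe_mul, e, e']
  ext i j
  fin_cases i <;> fin_cases j <;> simp [Matrix.mul_apply, Fin.sum_univ_two]

theorem IsLevelTwo.inv {g : SL(2, ℝ)} (hg : IsLevelTwo g) : IsLevelTwo g⁻¹ := by
  obtain ⟨a, b, c, d, e, ha, hb, hc, hd⟩ := hg
  refine ⟨d, -b, -c, a, ?_, hd, hb.neg, hc.neg, ha⟩
  rw [Matrix.SpecialLinearGroup.coe_inv, e, Matrix.adjugate_fin_two_of]
  simp

theorem rot_int_mat (n : ℤ) : ∃ ε : ℤ, (ε = 1 ∨ ε = -1) ∧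
    ((rot (.ofAdd (n : ℝ))).mat : Matrix (Fin 2) (Fin 2) ℝ) = !![(ε : ℝ), 0; 0, (ε : ℝ)] := by
  rw [rot_mat, sin_pi_mul_int, mul_comm Real.pi, Real.cos_int_mul_pi]
  rcases Int.even_or_odd n with h | h
  · exact ⟨1, Or.inl rfl, by rw [h.neg_one_zpow]; simp⟩
  · exact ⟨-1, Or.inr rfl, by rw [h.neg_one_zpow]; simp⟩

theorem isLevelTwo_rot_int (n : ℤ) : IsLevelTwo (rot (.ofAdd (n : ℝ))).mat := by
  obtain ⟨ε, hε, e⟩ := rot_int_mat n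
  have ho : Odd ε := by rcases hε with rfl | rfl <;> decide
  exact ⟨ε, 0, 0, ε, by rw [e]; simp, ho, by simp, by simp, ho⟩

/-- The preimage of `Γ(2)` in `SL2Tilde`. -/
def levelTwoPreimage : Subgroup SL2Tilde where
  carrier := {p | IsLevelTwo p.mat}
  mul_mem' := IsLevelTwo.mul
  one_mem' := by simpa [rot_zero] using isLevelTwo_rot_int 0
  inv_mem' := IsLevelTwo.inv

theorem levelTwo_le_preimage : levelTwo ≤ levelTwoPreimage := by
  rintro _ ⟨⟨w, n⟩, rfl⟩
  refine mul_mem ?_ (isLevelTwo_rot_int n.toAdd)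
  have : (FreeGroup.lift levelTwoGen).range ≤ levelTwoPreimage := by
    rw [FreeGroup.range_lift_eq_closure, Subgroup.closure_le]
    rintro _ ⟨i, rfl⟩
    have h0 : levelTwoGen 0 ∈ levelTwoPreimage := ⟨1, 2, 0, 1, by rw [levelTwoGen_zero_mat]; simp,
      by decide, by decide, by decide, by decide⟩
    have h1 : levelTwoGen 1 ∈ levelTwoPreimage := ⟨1, 0, 2, 1, by rw [levelTwoGen_one_mat]; simp,
      by decide, by decide, by decide, by decide⟩
    fin_cases i
    · exact h0
    · exact h1
  exact this ⟨w, rfl⟩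

theorem levelTwoGen_zero_zpow_mat (k : ℤ) :
    ((levelTwoGen 0 ^ k).mat : Matrix (Fin 2) (Fin 2) ℝ) = !![1, 2 * (k : ℝ); 0, 1] := by
  have h : ∀ k : ℤ, levelTwoGen 0 ^ k = upper 0 (2 * k) := fun k ↦ by
    induction k with
    | zero => simp [upper_zero]
    | succ n ih =>
      rw [zpow_add_one, ih]
      change _ * upper 0 2 = _
      rw [upper_mul]
      congr 1 <;> (simp; try ring)
    | pred n ih =>
      rw [zpow_sub_one, ih]
      change _ * (upper 0 2)⁻¹ = _
      rw [upper_inv, upper_mul]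
      congr 1 <;> (simp; try ring)
  rw [h, upper_mat, slUpper_coe]
  simp

/-- The Euclidean algorithm with even quotients: the first column of an element of `Γ(2)` can be
shortened by the generators as long as both of its entries are nonzero. -/
theorem mem_levelTwo_of_entries (N : ℕ) : ∀ (p : SL2Tilde) (a b c d : ℤ),
    (p.mat : Matrix (Fin 2) (Fin 2) ℝ) = !![(a : ℝ), b; c, d] → Odd a → Even b → Even c → Odd d →
    a.natAbs + c.natAbs ≤ N → p ∈ levelTwo := by
  induction N using Nat.strong_induction_on with | _ N ih
  intro p a b c d e ha hb hc hd hN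
  have hdet : a * d - b * c = 1 := by
    have h := p.mat.det_coe
    rw [e, Matrix.det_fin_two_of] at h
    exact_mod_cast h
  have step0 : ∀ k : ℤ, (a + 2 * k * c).natAbs + c.natAbs < N → p ∈ levelTwo := fun k hk ↦ by
    have hmem : levelTwoGen 0 ^ k * p ∈ levelTwo := by
      refine ih _ hk _ (a + 2 * k * c) (b + 2 * k * d) c d ?_
        (ha.add_even ⟨k * c, by ring⟩) (hb.add ⟨k * d, by ring⟩) hc hd le_rfl
      rw [mul_mat, Matrix.SpecialLinearGroup.coe_mul, levelTwoGen_zero_zpow_mat, e]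
      ext i j
      fin_cases i <;> fin_cases j <;> simp [Matrix.mul_apply, Fin.sum_univ_two]
    simpa using mul_mem (inv_mem (zpow_mem (levelTwoGen_mem 0) k)) hmem
  have step1 : ∀ ε : ℤ, ε = 1 ∨ ε = -1 → a.natAbs + (c + 2 * ε * a).natAbs < N →
      p ∈ levelTwo := fun ε hε hk ↦ by
    have hm : ((levelTwoGen 1 ^ ε).mat : Matrix (Fin 2) (Fin 2) ℝ) = !![1, 0; 2 * (ε : ℝ), 1] := by
      rcases hε with rfl | rfl
      · rw [zpow_one, levelTwoGen_one_mat]; simp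
      · rw [zpow_neg_one, inv_mat, Matrix.SpecialLinearGroup.coe_inv, levelTwoGen_one_mat,
          Matrix.adjugate_fin_two_of]
        simp
    have hmem : levelTwoGen 1 ^ ε * p ∈ levelTwo := by
      refine ih _ hk _ a b (c + 2 * ε * a) (d + 2 * ε * b) ?_
        ha hb (hc.add ⟨ε * a, by ring⟩) (hd.add_even ⟨ε * b, by ring⟩) le_rfl
      rw [mul_mat, Matrix.SpecialLinearGroup.coe_mul, hm, e]
      ext i j
      fin_cases i <;> fin_cases j <;> simp [Matrix.mul_apply, Fin.sum_univ_two, add_comm]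
    simpa using mul_mem (inv_mem (zpow_mem (levelTwoGen_mem 1) ε)) hmem
  obtain ⟨k, hk⟩ := hb
  obtain ⟨c', hc'⟩ := hc
  obtain ⟨a', ha'⟩ := ha
  rcases eq_or_ne c 0 with h0 | h0
  · have had : a * d = 1 := by rw [h0] at hdet; linarith
    have had' : a = d := Int.eq_of_mul_eq_one had
    have haa : (a : ℝ) * a = 1 := by rw [← had'] at had; exact_mod_cast had
    have hmem : levelTwoGen 0 ^ (-(a * k)) * p ∈ levelTwo := by
      have em : ((levelTwoGen 0 ^ (-(a * k)) * p).mat : Matrix (Fin 2) (Fin 2) ℝ) =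
          !![(a : ℝ), 0; 0, (a : ℝ)] := by
        rw [mul_mat, Matrix.SpecialLinearGroup.coe_mul, levelTwoGen_zero_zpow_mat, e,
          ← had', h0, hk]
        ext i j
        fin_cases i <;> fin_cases j <;> simp [Matrix.mul_apply, Fin.sum_univ_two]
        linear_combination (-2 * k : ℝ) * haa
      obtain ⟨n, hn⟩ := eq_rot_int_of_mat (by rw [em]; simp) (by rw [em]; simp)
        (p := levelTwoGen 0 ^ (-(a * k)) * p) (by rw [em]; simp)
      rw [hn]
      exact rot_int_mem_levelTwo n
    simpa using mul_mem (inv_mem (zpow_mem (levelTwoGen_mem 0) (-(a * k)))) hmem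
  · have hac : a.natAbs ≠ c.natAbs := by omega
    rcases lt_or_gt_of_ne hac with hlt | hlt
    · rcases le_or_gt 0 (a * c) with hs | hs
      · refine step1 (-1) (Or.inr rfl) ?_
        have : (0 ≤ a ∧ 0 ≤ c) ∨ (a ≤ 0 ∧ c ≤ 0) := by
          rcases mul_nonneg_iff.1 hs with h | h <;> tauto
        omega
      · refine step1 1 (Or.inl rfl) ?_
        have : (0 ≤ a ∧ c ≤ 0) ∨ (a ≤ 0 ∧ 0 ≤ c) := by
          rcases mul_neg_iff.1 hs with h | h <;> omega
        omega
    · rcases le_or_gt 0 (a * c) with hs | hs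
      · refine step0 (-1) ?_
        have : (0 ≤ a ∧ 0 ≤ c) ∨ (a ≤ 0 ∧ c ≤ 0) := by
          rcases mul_nonneg_iff.1 hs with h | h <;> tauto
        omega
      · refine step0 1 ?_
        have : (0 ≤ a ∧ c ≤ 0) ∨ (a ≤ 0 ∧ 0 ≤ c) := by
          rcases mul_neg_iff.1 hs with h | h <;> omega
        omega

/-- The free group on the two generators and the rotations by multiples of `π` exhaust the preimage
of `Γ(2)`. -/
theorem mem_levelTwo_iff {p : SL2Tilde} : p ∈ levelTwo ↔ IsLevelTwo p.mat :=
  ⟨fun h ↦ levelTwo_le_preimage h, fun ⟨a, b, c, d, e, ha, hb, hc, hd⟩ ↦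
    mem_levelTwo_of_entries _ p a b c d e ha hb hc hd le_rfl⟩

instance : DiscreteTopology levelTwo := by
  have hc : ∀ i j, Continuous fun p : SL2Tilde ↦ p.mat i j := fun i j ↦
    (by fun_prop : Continuous fun g : SL(2, ℝ) ↦ g i j).comp continuous_mat
  have hU : IsOpen {p : SL2Tilde | |p.arg| < 2 * Real.pi ∧ |p.mat 0 0 - 1| < 1 ∧ |p.mat 0 1| < 1 ∧
      |p.mat 1 0| < 1 ∧ |p.mat 1 1 - 1| < 1} := by
    refine (isOpen_lt continuous_arg.abs continuous_const).inter ((isOpen_lt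
      ((hc 0 0).sub continuous_const).abs continuous_const).inter ((isOpen_lt (hc 0 1).abs
      continuous_const).inter ((isOpen_lt (hc 1 0).abs continuous_const).inter
      (isOpen_lt ((hc 1 1).sub continuous_const).abs continuous_const))))
  refine discreteTopology_of_isOpen_singleton_one (isOpen_induced_iff.2 ⟨_, hU, ?_⟩)
  ext ⟨p, hp⟩
  simp only [Set.mem_preimage, Set.mem_singleton_iff]
  constructor
  · rintro ⟨h0, h1, h2, h3, h4⟩
    obtain ⟨a, b, c, d, e, -⟩ := mem_levelTwo_iff.1 hp
    rw [e] at h1 h2 h3 h4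
    simp at h1 h2 h3 h4
    have h1' : a - 1 = 0 := Int.abs_lt_one_iff.1 (by exact_mod_cast h1)
    have h2' : b = 0 := Int.abs_lt_one_iff.1 (by exact_mod_cast h2)
    have h3' : c = 0 := Int.abs_lt_one_iff.1 (by exact_mod_cast h3)
    have h4' : d - 1 = 0 := Int.abs_lt_one_iff.1 (by exact_mod_cast h4)
    refine Subtype.ext (ext' (Subtype.ext ?_) (by simpa [one_arg] using h0))
    have ha : a = 1 := by omega
    have hd : d = 1 := by omega
    change (p.mat : Matrix (Fin 2) (Fin 2) ℝ) = ((1 : SL(2, ℝ)) : Matrix (Fin 2) (Fin 2) ℝ)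
    rw [e, ha, h2', h3', hd, Matrix.SpecialLinearGroup.coe_one, Matrix.one_fin_two]
    simp
  · intro h
    have : p = 1 := congrArg Subtype.val h
    rw [this]
    simp [one_arg, one_mat, Real.pi_pos]

/-- The traces of the elements of `Γ(2)` are `2` modulo `4`, so that none of them is elliptic. -/
theorem exists_int_of_conj_rot_mem_levelTwo {q : SL2Tilde} {x : ℝ}
    (h : q * rot (.ofAdd x) * q⁻¹ ∈ levelTwo) : ∃ n : ℤ, x = n := by
  obtain ⟨a, b, c, d, e, ⟨a', ha⟩, ⟨b', hb⟩, ⟨c', hc⟩, ⟨d', hd⟩⟩ := mem_levelTwo_iff.1 h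
  have htr : Matrix.trace ((q * rot (.ofAdd x) * q⁻¹).mat : Matrix (Fin 2) (Fin 2) ℝ) =
      2 * Real.cos (Real.pi * x) := by
    rw [mul_mat, mul_mat, inv_mat, Matrix.SpecialLinearGroup.coe_mul, Matrix.trace_mul_comm,
      ← Matrix.SpecialLinearGroup.coe_mul, inv_mul_cancel_left, rot_mat, Matrix.trace_fin_two_of]
    ring
  have hdet : a * d - b * c = 1 := by
    have h := (q * rot (.ofAdd x) * q⁻¹).mat.det_coe
    rw [e, Matrix.det_fin_two_of] at h
    exact_mod_cast h
  rw [e, Matrix.trace_fin_two_of] at htr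
  -- the determinant of `[1 + 2 a', 2 b'; 2 c', 1 + 2 d']` is `1`
  have hs : a' + d' + 2 * (a' * d' - b' * c') = 0 := by
    rw [ha, hb, hc, hd] at hdet
    linarith
  have hcos : Real.cos (Real.pi * x) = 1 - 2 * ((a' * d' - b' * c' : ℤ) : ℝ) := by
    have h1 : (a' : ℝ) + d' = -2 * ((a' * d' - b' * c' : ℤ) : ℝ) := by
      have : (a' : ℤ) + d' = -2 * (a' * d' - b' * c') := by linarith
      exact_mod_cast this
    rw [ha, hd] at htr
    push_cast at htr h1 ⊢
    linarith
  generalize a' * d' - b' * c' = m at hcos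
  have h1 := Real.cos_le_one (Real.pi * x)
  have h2 := Real.neg_one_le_cos (Real.pi * x)
  rw [hcos] at h1 h2
  -- the cosine is an odd integer, hence `±1`
  have hm0 : 0 ≤ m := by
    have : (0 : ℝ) ≤ m := by linarith
    exact_mod_cast this
  have hm1 : m ≤ 1 := by
    have : (m : ℝ) ≤ 1 := by linarith
    exact_mod_cast this
  have hsq : Real.cos (Real.pi * x) ^ 2 = 1 := by
    have : m = 0 ∨ m = 1 := by omega
    rcases this with rfl | rfl <;> rw [hcos] <;> norm_num
  apply exists_int_of_sin_eq_zero
  have := Real.sin_sq_add_cos_sq (Real.pi * x)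
  rw [hsq] at this
  nlinarith

end SL2Tilde

/-! ### Finite covolume -/

namespace SL2Tilde

open MeasureTheory Measure Matrix.SpecialLinearGroup

theorem slColSq_mul_rot_int (g : SL(2, ℝ)) (n : ℤ) :
    slColSq (g * (rot (.ofAdd (n : ℝ))).mat) = slColSq g ∧
      slShift (g * (rot (.ofAdd (n : ℝ))).mat) = slShift g := by
  obtain ⟨ε, hε, e⟩ := rot_int_mat n
  have hε2 : (ε : ℝ) ^ 2 = 1 := by rcases hε with rfl | rfl <;> norm_num
  have h1 : slColSq (g * (rot (.ofAdd (n : ℝ))).mat) = slColSq g := by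
    simp only [slColSq, coe_mul, e, Matrix.mul_apply, Fin.sum_univ_two]
    simp
    linear_combination (g 0 0 ^ 2 + g 1 0 ^ 2) * hε2
  refine ⟨h1, ?_⟩
  rw [slShift, slShift, h1]
  congr 1
  simp only [coe_mul, e, Matrix.mul_apply, Fin.sum_univ_two]
  simp
  linear_combination (g 0 0 * g 0 1 + g 1 0 * g 1 1) * hε2

theorem isLevelTwo_map {γ : SL(2, ℤ)} (h : γ ∈ CongruenceSubgroup.Gamma 2) :
    IsLevelTwo (map (Int.castRingHom ℝ) γ) := by
  rw [CongruenceSubgroup.Gamma_mem] at h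
  refine ⟨γ 0 0, γ 0 1, γ 1 0, γ 1 1, ?_, ZMod.intCast_eq_one_iff_odd.1 h.1,
    ZMod.intCast_eq_zero_iff_even.1 h.2.1, ZMod.intCast_eq_zero_iff_even.1 h.2.2.1,
    ZMod.intCast_eq_one_iff_odd.1 h.2.2.2⟩
  ext i j
  fin_cases i <;> fin_cases j <;> simp

/-- The union of translates of the Siegel set by representatives of the cosets of `Γ(2)` in
`SL(2, ℤ)` covers the quotient by `Γ(2)`. -/
theorem exists_cover_levelTwo : ∃ S : Set SL2Tilde, MeasurableSet S ∧ haar S < ⊤ ∧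
    ∀ p : SL2Tilde, ∃ γ ∈ levelTwo, p * γ ∈ S := by
  set ρ : SL(2, ℤ) ⧸ CongruenceSubgroup.Gamma 2 → SL2Tilde := fun q ↦
    principal (map (Int.castRingHom ℝ) (Quotient.out q)⁻¹)
  have hfin : Finite (SL(2, ℤ) ⧸ CongruenceSubgroup.Gamma 2) := inferInstance
  refine ⟨⋃ q, (fun p ↦ p * ρ q) ⁻¹' siegel, MeasurableSet.iUnion fun q ↦
    (continuous_mul_const _).measurable measurableSet_siegel, ?_, fun p ↦ ?_⟩
  · have := Fintype.ofFinite (SL(2, ℤ) ⧸ CongruenceSubgroup.Gamma 2)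
    refine (measure_iUnion_fintype_le _ _).trans_lt (ENNReal.sum_lt_top.2 fun q _ ↦ ?_)
    rw [measure_preimage_mul_right]
    exact haar_siegel_lt_top
  · obtain ⟨γ, h1, h2⟩ := exists_int_mul_mem_siegel p.mat
    set q : SL(2, ℤ) ⧸ CongruenceSubgroup.Gamma 2 := QuotientGroup.mk γ⁻¹
    set δ := γ * Quotient.out q with hδ
    have hδm : δ ∈ CongruenceSubgroup.Gamma 2 := by
      have : (QuotientGroup.mk γ⁻¹ : SL(2, ℤ) ⧸ CongruenceSubgroup.Gamma 2) =
        QuotientGroup.mk (Quotient.out q) := (Quotient.out_eq q).symm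
      rwa [QuotientGroup.eq, inv_inv] at this
    set δ' := principal (map (Int.castRingHom ℝ) δ)
    have hδ' : δ' ∈ levelTwo := mem_levelTwo_iff.2 (isLevelTwo_map hδm)
    set r := p * δ' * ρ q with hr
    have hrm : r.mat = p.mat * map (Int.castRingHom ℝ) γ := by
      change p.mat * map (Int.castRingHom ℝ) δ * map (Int.castRingHom ℝ) (Quotient.out q)⁻¹ = _
      rw [mul_assoc, ← map_mul, hδ, mul_inv_cancel_right]
    -- a central rotation brings the argument into `[0, π)`
    set n : ℤ := -⌊r.arg / Real.pi⌋
    refine ⟨δ' * rot (.ofAdd (n : ℝ)), mul_mem hδ' (rot_int_mem_levelTwo n),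
      Set.mem_iUnion.2 ⟨q, ?_⟩⟩
    have e : p * (δ' * rot (.ofAdd (n : ℝ))) * ρ q = r * rot (.ofAdd (n : ℝ)) := by
      rw [hr, mul_assoc p δ', mul_assoc p, mul_assoc p, mul_assoc δ', mul_assoc δ', rot_int_mul]
    change p * (δ' * rot (.ofAdd (n : ℝ))) * ρ q ∈ siegel
    rw [e]
    have h3 := slColSq_mul_rot_int r.mat n
    refine ⟨?_, ?_, ?_⟩
    · rw [arg_mul_rot]
      have h4 := Int.floor_le (r.arg / Real.pi)
      have h5 := Int.lt_floor_add_one (r.arg / Real.pi)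
      rw [le_div_iff₀ Real.pi_pos] at h4
      rw [div_lt_iff₀ Real.pi_pos] at h5
      have hn : (n : ℝ) = -⌊r.arg / Real.pi⌋ := by simp [n]
      rw [hn]
      constructor <;> linarith
    · rw [mul_mat, h3.1, hrm]; exact h1
    · rw [mul_mat, h3.2, hrm]; exact h2

theorem isLattice_levelTwo : IsLattice levelTwo := by
  obtain ⟨S, hS, hfin, hcov⟩ := exists_cover_levelTwo
  exact isLattice_of_cover haar (NeZero.ne _) levelTwo hS hfin hcov

end SL2Tilde

/-! ### Twisted products of lattices -/

section Twisted

variable {G K : Type} [Group G] [Group K]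

/-- The parametrization of the subgroup of `G × K × ℝ` of the triples whose last component is,
up to multiples of `s`, the sum of the images under `φ` and `ψ` of the first two. -/
def twistedHom {Λ : Subgroup G} {M : Subgroup K} (φ : Λ →* Multiplicative ℝ)
    (ψ : M →* Multiplicative ℝ) (s : ℝ) :
    Λ × M × Multiplicative ℤ →* G × K × Multiplicative ℝ where
  toFun q := (q.1, q.2.1, φ q.1 * ψ q.2.1 * .ofAdd ((q.2.2.toAdd : ℝ) * s))
  map_one' := by simp
  map_mul' p q := by
    refine Prod.ext rfl (Prod.ext rfl ?_)
    simp only [Prod.fst_mul, Prod.snd_mul, map_mul, toAdd_mul, Int.cast_add, add_mul, ofAdd_add]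
    simp only [mul_assoc, mul_left_comm, mul_comm]

/-- A lattice in `G × K × ℝ` that projects onto lattices in `G` and `K`. -/
def twistedLattice {Λ : Subgroup G} {M : Subgroup K} (φ : Λ →* Multiplicative ℝ)
    (ψ : M →* Multiplicative ℝ) (s : ℝ) : Subgroup (G × K × Multiplicative ℝ) :=
  (twistedHom φ ψ s).range

theorem mem_twistedLattice {Λ : Subgroup G} {M : Subgroup K} {φ : Λ →* Multiplicative ℝ}
    {ψ : M →* Multiplicative ℝ} {s : ℝ} {g : G × K × Multiplicative ℝ} :
    g ∈ twistedLattice φ ψ s ↔ ∃ (h₁ : g.1 ∈ Λ) (h₂ : g.2.1 ∈ M) (k : ℤ),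
      g.2.2.toAdd = (φ ⟨g.1, h₁⟩).toAdd + (ψ ⟨g.2.1, h₂⟩).toAdd + k * s := by
  constructor
  · rintro ⟨⟨l, m, k⟩, rfl⟩
    exact ⟨l.2, m.2, k.toAdd, rfl⟩
  · rintro ⟨h₁, h₂, k, h⟩
    exact ⟨(⟨_, h₁⟩, ⟨_, h₂⟩, .ofAdd k),
      Prod.ext rfl (Prod.ext rfl (Multiplicative.toAdd.injective h.symm))⟩

variable [TopologicalSpace G] [IsTopologicalGroup G] [TopologicalSpace K] [IsTopologicalGroup K]

theorem discreteTopology_twistedLattice {Λ : Subgroup G} {M : Subgroup K}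
    [DiscreteTopology Λ] [DiscreteTopology M] (φ : Λ →* Multiplicative ℝ)
    (ψ : M →* Multiplicative ℝ) {s : ℝ} (hs : 0 < s) :
    DiscreteTopology (twistedLattice φ ψ s) := by
  obtain ⟨U, hU, hU1⟩ := isOpen_induced_iff.1 (isOpen_discrete ({1} : Set Λ))
  obtain ⟨V, hV, hV1⟩ := isOpen_induced_iff.1 (isOpen_discrete ({1} : Set M))
  have hW : IsOpen {t : Multiplicative ℝ | |t.toAdd| < s} :=
    isOpen_lt (continuous_toAdd.abs) continuous_const
  refine discreteTopology_of_isOpen_singleton_one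
    (isOpen_induced_iff.2 ⟨_, hU.prod (hV.prod hW), ?_⟩)
  ext ⟨⟨g, u, t⟩, hg⟩
  simp only [Set.mem_preimage, Set.mem_singleton_iff]
  constructor
  · rintro ⟨h1, h2, h3⟩
    obtain ⟨hg1, hg2, k, hk⟩ := mem_twistedLattice.1 hg
    have e1 : (⟨g, hg1⟩ : Λ) = 1 := by
      have : (⟨g, hg1⟩ : Λ) ∈ Subtype.val ⁻¹' U := h1
      rwa [hU1] at this
    have e2 : (⟨u, hg2⟩ : M) = 1 := by
      have : (⟨u, hg2⟩ : M) ∈ Subtype.val ⁻¹' V := h2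
      rwa [hV1] at this
    change |t.toAdd| < s at h3
    change t.toAdd = (φ ⟨g, hg1⟩).toAdd + (ψ ⟨u, hg2⟩).toAdd + k * s at hk
    rw [e1, e2, map_one φ, map_one ψ, toAdd_one, zero_add, zero_add] at hk
    rw [hk, abs_mul, abs_of_pos hs] at h3
    have hk0 : k = 0 := by
      rw [← Int.abs_lt_one_iff]
      have : |(k : ℝ)| < 1 := by nlinarith
      exact_mod_cast this
    rw [hk0, Int.cast_zero, zero_mul] at hk
    exact Subtype.ext (Prod.ext (congrArg Subtype.val e1) (Prod.ext (congrArg Subtype.val e2)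
      (Multiplicative.toAdd.injective hk)))
  · intro h
    have h' : ((g, u, t) : G × K × Multiplicative ℝ) = 1 := congrArg Subtype.val h
    rw [h']
    have h1 : (1 : Λ) ∈ Subtype.val ⁻¹' U := hU1 ▸ rfl
    have h2 : (1 : M) ∈ Subtype.val ⁻¹' V := hV1 ▸ rfl
    refine ⟨h1, h2, ?_⟩
    change |(0 : ℝ)| < s
    simpa using hs

open MeasureTheory Measure in
theorem isLattice_twistedLattice [PolishSpace G] [MeasurableSpace G] [BorelSpace G]
    [PolishSpace K] [MeasurableSpace K] [BorelSpace K]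
    (μ : Measure G) [IsHaarMeasure μ] [μ.IsMulRightInvariant] [SigmaFinite μ]
    (ν : Measure K) [IsHaarMeasure ν] [ν.IsMulRightInvariant] [SigmaFinite ν]
    {Λ : Subgroup G} {M : Subgroup K} [DiscreteTopology Λ] [DiscreteTopology M]
    (φ : Λ →* Multiplicative ℝ) (ψ : M →* Multiplicative ℝ) {s : ℝ} (hs : 0 < s)
    {S : Set G} (hS : MeasurableSet S) (hSfin : μ S < ⊤) (hScov : ∀ g, ∃ γ ∈ Λ, g * γ ∈ S)
    {T : Set K} (hT : MeasurableSet T) (hTfin : ν T < ⊤) (hTcov : ∀ g, ∃ γ ∈ M, g * γ ∈ T) :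
    IsLattice (twistedLattice φ ψ s) := by
  borelize (Multiplicative ℝ)
  have := discreteTopology_twistedLattice φ ψ hs
  set I : Set (Multiplicative ℝ) := Multiplicative.ofAdd '' Set.Icc 0 s
  have hI : IsCompact I := isCompact_Icc.image continuous_ofAdd
  refine isLattice_of_cover (μ.prod (ν.prod (haar : Measure (Multiplicative ℝ)))) (NeZero.ne _)
    (twistedLattice φ ψ s) (hS.prod (hT.prod hI.measurableSet)) ?_ ?_
  · rw [Measure.prod_prod, Measure.prod_prod]
    exact ENNReal.mul_lt_top hSfin (ENNReal.mul_lt_top hTfin hI.measure_lt_top)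
  · rintro ⟨g, u, t⟩
    obtain ⟨γ, hγ, h1⟩ := hScov g
    obtain ⟨δ, hδ, h2⟩ := hTcov u
    set r := t.toAdd + (φ ⟨γ, hγ⟩).toAdd + (ψ ⟨δ, hδ⟩).toAdd with hr
    refine ⟨twistedHom φ ψ s (⟨γ, hγ⟩, ⟨δ, hδ⟩, .ofAdd (-⌊r / s⌋)), ⟨_, rfl⟩, h1, h2, _, ?_, rfl⟩
    change t.toAdd + ((φ ⟨γ, hγ⟩).toAdd + (ψ ⟨δ, hδ⟩).toAdd + ((-⌊r / s⌋ : ℤ) : ℝ) * s) ∈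
      Set.Icc 0 s
    have h4 := Int.floor_le (r / s)
    have h5 := Int.lt_floor_add_one (r / s)
    rw [le_div_iff₀ hs] at h4
    rw [div_lt_iff₀ hs] at h5
    push_cast
    constructor <;> linarith

end Twisted

/-! ### The punctured-surface group -/

namespace SL2Tilde

/-- The projection to `PSL(2, ℝ)`. -/
def toPSL : SL2Tilde →* PSL(2, ℝ) := (QuotientGroup.mk' (Subgroup.center SL(2, ℝ))).comp toSL

theorem continuous_toPSL : Continuous toPSL := QuotientGroup.continuous_mk.comp continuous_mat

theorem isOpenMap_toPSL : IsOpenMap toPSL := QuotientGroup.isOpenMap_coe.comp toSL_isOpenMap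

theorem toPSL_surjective : Function.Surjective toPSL :=
  (QuotientGroup.mk'_surjective _).comp toSL_surjective

theorem exists_rot_int_of_mem_ker {p : SL2Tilde} (hp : p ∈ toPSL.ker) :
    ∃ n : ℤ, p = rot (.ofAdd (n : ℝ)) := by
  have h : p.mat ∈ Subgroup.center SL(2, ℝ) := (QuotientGroup.eq_one_iff _).1 hp
  rw [Matrix.SpecialLinearGroup.mem_center_iff] at h
  obtain ⟨r, -, hr⟩ := h
  apply eq_rot_int_of_mat <;> rw [← hr] <;> simp

theorem ker_toPSL_le : toPSL.ker ≤ levelTwo := fun p hp ↦ by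
  obtain ⟨n, rfl⟩ := exists_rot_int_of_mem_ker hp
  exact rot_int_mem_levelTwo n

theorem toPSL_rot_int (n : ℤ) : toPSL (rot (.ofAdd (n : ℝ))) = 1 := by
  refine (QuotientGroup.eq_one_iff _).2 ?_
  rw [Matrix.SpecialLinearGroup.mem_center_iff]
  obtain ⟨ε, hε, e⟩ := rot_int_mat n
  refine ⟨ε, by rcases hε with rfl | rfl <;> norm_num, ?_⟩
  change Matrix.diagonal (fun _ ↦ (ε : ℝ)) = ((rot (.ofAdd (n : ℝ))).mat : Matrix (Fin 2) (Fin 2) ℝ)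
  rw [e]
  ext i j
  fin_cases i <;> fin_cases j <;> simp

/-- The fundamental group of the thrice-punctured sphere. -/
def puncturedSphereGroup : Subgroup PSL(2, ℝ) := levelTwo.map toPSL

theorem comap_toPSL_puncturedSphereGroup : puncturedSphereGroup.comap toPSL = levelTwo := by
  rw [puncturedSphereGroup, Subgroup.comap_map_eq, sup_eq_left]
  exact ker_toPSL_le

/-- Points high in the cusp leave every compact subset of the quotient: a representative with
bounded entries would give an integral matrix whose first column is shorter than `1`. -/
theorem not_compactSpace_quotient : ¬ CompactSpace (PSL(2, ℝ) ⧸ puncturedSphereGroup) := by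
  intro hcomp
  set f : SL2Tilde → PSL(2, ℝ) ⧸ puncturedSphereGroup := fun p ↦ QuotientGroup.mk (toPSL p)
  have hfo : IsOpenMap f := QuotientGroup.isOpenMap_coe.comp isOpenMap_toPSL
  have hfs : Function.Surjective f := QuotientGroup.mk_surjective.comp toPSL_surjective
  have hc : Continuous fun p : SL2Tilde ↦ p.mat 1 1 :=
    (by fun_prop : Continuous fun g : SL(2, ℝ) ↦ g 1 1).comp continuous_mat
  obtain ⟨n, hn⟩ := isCompact_univ.elim_directed_cover
    (fun n : ℕ ↦ f '' {p | |p.mat 1 1| < n})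
    (fun n ↦ hfo _ (isOpen_lt hc.abs continuous_const))
    (fun x _ ↦ by
      obtain ⟨p, rfl⟩ := hfs x
      obtain ⟨n, hn⟩ := exists_nat_gt |p.mat 1 1|
      exact Set.mem_iUnion.2 ⟨n, p, hn, rfl⟩)
    (Monotone.directed_le fun m n hmn ↦ Set.image_mono fun p hp ↦
      lt_of_lt_of_le (show |p.mat 1 1| < m from hp) (by exact_mod_cast hmn))
  have hpos : (0 : ℝ) < n + 1 := by positivity
  obtain ⟨u, hu, hup⟩ := hn (Set.mem_univ (f (upper (-Real.log (n + 1)) 0)))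
  have h1 : u⁻¹ * upper (-Real.log (n + 1)) 0 ∈ levelTwo := by
    rw [← comap_toPSL_puncturedSphereGroup, Subgroup.mem_comap, map_mul, map_inv]
    exact QuotientGroup.eq.1 hup
  obtain ⟨a, b, c, d, e, ha, -⟩ := mem_levelTwo_iff.1 h1
  have h2 : (upper (-Real.log (n + 1)) 0).mat =
      u.mat * (u⁻¹ * upper (-Real.log (n + 1)) 0).mat := by
    rw [← mul_mat, mul_inv_cancel_left]
  have h3 := congrArg (fun g : SL(2, ℝ) ↦ (g : Matrix (Fin 2) (Fin 2) ℝ)) h2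
  simp only [Matrix.SpecialLinearGroup.coe_mul, e, upper_mat, slUpper_coe, Real.exp_neg,
    Real.exp_log hpos] at h3
  have h00 := congrFun (congrFun h3 0) 0
  have h10 := congrFun (congrFun h3 1) 0
  simp [Matrix.mul_apply, Fin.sum_univ_two] at h00 h10
  have hdet := u.mat.det_coe
  rw [Matrix.det_fin_two] at hdet
  have ha1 : (a : ℝ) = u.mat 1 1 * ((n : ℝ) + 1)⁻¹ := by
    rw [h00]
    linear_combination (-(a : ℝ)) * hdet + u.mat 0 1 * h10
  have ha2 : |(a : ℝ)| < 1 := by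
    rw [ha1, abs_mul, abs_inv, abs_of_pos hpos, ← div_eq_mul_inv, div_lt_one hpos]
    exact lt_trans hu (by linarith)
  have ha3 : a = 0 := Int.abs_lt_one_iff.1 (by exact_mod_cast ha2)
  rw [ha3] at ha
  exact absurd ha (by decide)

/-- The group is torsion-free because its preimage is the product of a free group and the kernel of
the projection. -/
theorem isPuncturedSurfaceGroup : IsPuncturedSurfaceGroup puncturedSphereGroup := by
  refine ⟨isLattice_levelTwo.map toPSL continuous_toPSL isOpenMap_toPSL toPSL_surjective
    ker_toPSL_le, ?_, not_compactSpace_quotient⟩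
  rintro _ ⟨_, ⟨⟨w, m⟩, rfl⟩, rfl⟩ n hn h
  have e : levelTwoHom (w, m) =
      FreeGroup.lift levelTwoGen w * rot (.ofAdd ((m.toAdd : ℤ) : ℝ)) := rfl
  rw [e, map_mul, toPSL_rot_int, mul_one] at h ⊢
  rw [← map_pow, ← map_pow] at h
  obtain ⟨k, hk⟩ := exists_rot_int_of_mem_ker h
  have h1 : levelTwoHom (w ^ n, .ofAdd (-k)) = 1 := by
    rw [levelTwoHom_apply, hk, ← rot_add]
    simp
  have h2 := (injective_iff_map_eq_one _).1 levelTwoHom_injective _ h1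
  have h3 : w ^ n = 1 := congrArg Prod.fst h2
  have h4 : w = 1 := (pow_eq_one_iff_left hn.ne').1 h3
  rw [h4, map_one, map_one]

end SL2Tilde

/-! ### The kernel of the action -/

/-- The properties of the one-parameter group `c` that the kernel of the action depends on: exactly
at the integers, `c` takes central values, and the other values have a conjugate that is not on the
one-parameter group. -/
structure IsCircleLike {K : Type} [Group K] [TopologicalSpace K] (c : Multiplicative ℝ →* K) :
    Prop where
  continuous : Continuous fun y : ℝ ↦ c (.ofAdd y)
  int_mul : ∀ (n : ℤ) (u : K), c (.ofAdd (n : ℝ)) * u = u * c (.ofAdd (n : ℝ))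
  exists_int : ∀ y : ℝ, (∀ u, u * c (.ofAdd y) * u⁻¹ ∈ c.range) → ∃ n : ℤ, y = n

theorem SL2Tilde.isCircleLike_rot : IsCircleLike SL2Tilde.rot where
  continuous := continuous_rot
  int_mul := rot_int_mul
  exists_int y h := by
    -- conjugation by a diagonal matrix turns the rotations about `i` into rotations about
    -- another point
    obtain ⟨x, hx⟩ := h (upper (Real.log 2) 0)
    have h2 : (rot x * upper (Real.log 2) 0).mat = (upper (Real.log 2) 0 * rot (.ofAdd y)).mat := by
      rw [hx, inv_mul_cancel_right]
    have h3 := congrArg (fun g : SL(2, ℝ) ↦ (g : Matrix (Fin 2) (Fin 2) ℝ)) h2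
    rw [← ofAdd_toAdd x] at h3
    simp only [mul_mat, Matrix.SpecialLinearGroup.coe_mul, rot_mat, upper_mat, slUpper_coe,
      Real.exp_neg, Real.exp_log two_pos] at h3
    have h01 := congrFun (congrFun h3 0) 1
    have h10 := congrFun (congrFun h3 1) 0
    simp [Matrix.mul_apply, Fin.sum_univ_two] at h01 h10
    exact exists_int_of_sin_eq_zero (by linarith)

namespace S3

theorem mem_sphere_iff (q : ℍ[ℝ]) :
    q ∈ Metric.sphere (0 : ℍ[ℝ]) 1 ↔ q.re ^ 2 + q.imI ^ 2 + q.imJ ^ 2 + q.imK ^ 2 = 1 := by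
  rw [mem_sphere_zero_iff_norm, ← sq_eq_sq₀ (norm_nonneg _) zero_le_one, sq,
    ← Quaternion.normSq_eq_norm_mul_self, Quaternion.normSq_def', one_pow]

theorem rot_coe (y : ℝ) : ((rot (.ofAdd y) : S3) : ℍ[ℝ]) =
    (⟨Real.cos (Real.pi * y), Real.sin (Real.pi * y), 0, 0⟩ : ℍ[ℝ]) := by
  change ((Complex.exp ((Real.pi * y : ℝ) * Complex.I) : ℂ) : ℍ[ℝ]) = _
  ext
  · rw [Quaternion.re_coeComplex, Complex.exp_ofReal_mul_I_re]
  · rw [Quaternion.imI_coeComplex, Complex.exp_ofReal_mul_I_im]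
  · simp
  · simp

theorem rot_re (y : ℝ) : (rot (.ofAdd y) : ℍ[ℝ]).re = Real.cos (Real.pi * y) := by rw [rot_coe]

theorem rot_imI (y : ℝ) : (rot (.ofAdd y) : ℍ[ℝ]).imI = Real.sin (Real.pi * y) := by rw [rot_coe]

theorem rot_imJ (y : ℝ) : (rot (.ofAdd y) : ℍ[ℝ]).imJ = 0 := by rw [rot_coe]

theorem rot_imK (y : ℝ) : (rot (.ofAdd y) : ℍ[ℝ]).imK = 0 := by rw [rot_coe]

/-- The quaternion `i`. -/
def quatI : ℍ[ℝ] := ⟨0, 1, 0, 0⟩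

theorem quatI_re : quatI.re = 0 := rfl

theorem quatI_imI : quatI.imI = 1 := rfl

theorem quatI_imJ : quatI.imJ = 0 := rfl

theorem quatI_imK : quatI.imK = 0 := rfl

theorem continuous_rot : Continuous fun y : ℝ ↦ rot (.ofAdd y) := by
  refine Continuous.subtype_mk ?_ _
  have h : ∀ y : ℝ, ((Complex.exp ((Real.pi * y : ℝ) * Complex.I) : ℂ) : ℍ[ℝ]) =
      ((Real.cos (Real.pi * y) : ℝ) : ℍ[ℝ]) + Real.sin (Real.pi * y) • quatI := by
    intro y
    have := rot_coe y
    change ((Complex.exp ((Real.pi * y : ℝ) * Complex.I) : ℂ) : ℍ[ℝ]) = _ at this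
    rw [this]
    ext <;> simp [quatI_re, quatI_imI, quatI_imJ, quatI_imK]
  have h1 : Continuous fun y : ℝ ↦ ((Real.cos (Real.pi * y) : ℝ) : ℍ[ℝ]) :=
    Quaternion.continuous_coe.comp (by fun_prop : Continuous fun y : ℝ ↦ Real.cos (Real.pi * y))
  have h2 : Continuous fun y : ℝ ↦ Real.sin (Real.pi * y) • quatI :=
    (by fun_prop : Continuous fun y : ℝ ↦ Real.sin (Real.pi * y)).smul continuous_const
  exact (h1.add h2).congr fun y ↦ (h y).symm

theorem rot_add (x y : ℝ) : rot (.ofAdd (x + y)) = rot (.ofAdd x) * rot (.ofAdd y) := by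
  rw [ofAdd_add, map_mul]

theorem rot_int_coe (n : ℤ) : ((rot (.ofAdd (n : ℝ)) : S3) : ℍ[ℝ]) = 1 ∨
    ((rot (.ofAdd (n : ℝ)) : S3) : ℍ[ℝ]) = -1 := by
  rw [rot_coe, SL2Tilde.sin_pi_mul_int, mul_comm Real.pi, Real.cos_int_mul_pi]
  rcases Int.even_or_odd n with h | h
  · left; rw [h.neg_one_zpow]; rfl
  · right; rw [h.neg_one_zpow]; ext <;> simp

theorem isCircleLike_rot : IsCircleLike rot where
  continuous := continuous_rot
  int_mul n u := by
    apply Subtype.ext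
    rw [Metric.unitSphere.coe_mul, Metric.unitSphere.coe_mul]
    rcases rot_int_coe n with h | h <;> rw [h] <;> simp
  exists_int y h := by
    -- conjugation by `(i + j) / √2` interchanges `i` and `j`
    set u : S3 := ⟨⟨0, 1 / √2, 1 / √2, 0⟩, (mem_sphere_iff _).2 <| by
      field_simp
      rw [Real.sq_sqrt zero_le_two]
      norm_num⟩
    have hu0 : (u : ℍ[ℝ]).re = 0 := rfl
    have hu1 : (u : ℍ[ℝ]).imI = 1 / √2 := rfl
    have hu2 : (u : ℍ[ℝ]).imJ = 1 / √2 := rfl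
    have hu3 : (u : ℍ[ℝ]).imK = 0 := rfl
    obtain ⟨x, hx⟩ := h u
    have h2 : rot x * u = u * rot (.ofAdd y) := by rw [hx, inv_mul_cancel_right]
    rw [← ofAdd_toAdd x] at h2
    have h4 := congrArg (fun v : S3 ↦ (v : ℍ[ℝ]).re) h2
    have h5 := congrArg (fun v : S3 ↦ (v : ℍ[ℝ]).imK) h2
    simp only [Metric.unitSphere.coe_mul, Quaternion.re_mul, Quaternion.imK_mul, rot_re, rot_imI,
      rot_imJ, rot_imK, hu0, hu1, hu2, hu3] at h4 h5
    have h6 : (1 / √2 : ℝ) ≠ 0 := by positivity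
    refine SL2Tilde.exists_int_of_sin_eq_zero ((mul_eq_zero_iff_right h6).1 ?_)
    linarith

end S3

section Core

variable {K : Type} [Group K] {c : Multiplicative ℝ →* K}

theorem tau_apply (c : Multiplicative ℝ →* K) (a b x y : ℝ) : tau c a b (.ofAdd (x, y)) =
    (SL2Tilde.rot (.ofAdd x), c (.ofAdd y), .ofAdd (x * a + y * b)) := rfl

theorem exists_tau_of_mem_range {a b : ℝ} {g : SL2Tilde × K × Multiplicative ℝ}
    (hg : g ∈ (tau c a b).range) : ∃ x y : ℝ, g = tau c a b (.ofAdd (x, y)) := by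
  obtain ⟨p, rfl⟩ := hg
  exact ⟨p.toAdd.1, p.toAdd.2, rfl⟩

theorem mk_mem_tauStabilizer {a b : ℝ} {g : SL2Tilde × K × Multiplicative ℝ} :
    (QuotientGroup.mk' (tau c a b).range.normalCore g) ∈ TauStabilizer c a b ↔
      g ∈ (tau c a b).range := by
  change g ∈ (TauStabilizer c a b).comap (QuotientGroup.mk' _) ↔ _
  rw [Subgroup.comap_map_eq, QuotientGroup.ker_mk', sup_eq_left.2 (Subgroup.normalCore_le _)]

theorem tauGroup_faithful (a b : ℝ) :
    FaithfulSMul (TauGroup c a b) (TauGroup c a b ⧸ TauStabilizer c a b) := by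
  refine ⟨fun {g₁ g₂} h ↦ ?_⟩
  obtain ⟨g, hg⟩ := QuotientGroup.mk'_surjective (tau c a b).range.normalCore (g₂⁻¹ * g₁)
  have h1 : g ∈ (tau c a b).range.normalCore := fun q ↦ by
    rw [← mk_mem_tauStabilizer, map_mul, map_mul, map_inv, hg]
    set q' := QuotientGroup.mk' (tau c a b).range.normalCore q
    have h2 : (QuotientGroup.mk (g₁ * q'⁻¹) : TauGroup c a b ⧸ TauStabilizer c a b) =
      QuotientGroup.mk (g₂ * q'⁻¹) := h (QuotientGroup.mk q'⁻¹)
    have h3 := QuotientGroup.eq.1 h2.symm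
    simpa [mul_assoc] using h3
  have h2 : g₂⁻¹ * g₁ = 1 := by
    rw [← hg]
    exact (QuotientGroup.eq_one_iff g).2 h1
  exact (inv_mul_eq_one.1 h2).symm

variable [TopologicalSpace K]

theorem IsCircleLike.tau_int_mul (hc : IsCircleLike c) (a b : ℝ) (m n : ℤ)
    (h : SL2Tilde × K × Multiplicative ℝ) :
    tau c a b (.ofAdd ((m : ℝ), (n : ℝ))) * h = h * tau c a b (.ofAdd ((m : ℝ), (n : ℝ))) :=
  Prod.ext (SL2Tilde.rot_int_mul _ _) (Prod.ext (hc.int_mul _ _) (mul_comm _ _))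

/-- The kernel of the action is `τ(ℤ²)`. -/
theorem IsCircleLike.mem_normalCore (hc : IsCircleLike c) {a b : ℝ}
    {g : SL2Tilde × K × Multiplicative ℝ} :
    g ∈ (tau c a b).range.normalCore ↔ ∃ m n : ℤ, g = tau c a b (.ofAdd ((m : ℝ), (n : ℝ))) := by
  constructor
  · intro hg
    obtain ⟨x, y, rfl⟩ := exists_tau_of_mem_range (Subgroup.normalCore_le _ hg)
    obtain ⟨m, rfl⟩ := SL2Tilde.isCircleLike_rot.exists_int x fun q ↦ by
      obtain ⟨x', y', h⟩ := exists_tau_of_mem_range (hg (q, 1, 1))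
      exact ⟨.ofAdd x', (congrArg Prod.fst h).symm⟩
    obtain ⟨n, rfl⟩ := hc.exists_int y fun u ↦ by
      obtain ⟨x', y', h⟩ := exists_tau_of_mem_range (hg (1, u, 1))
      exact ⟨.ofAdd y', (congrArg (fun z ↦ z.2.1) h).symm⟩
    exact ⟨m, n, rfl⟩
  · rintro ⟨m, n, rfl⟩ h
    rw [← hc.tau_int_mul, mul_inv_cancel_right]
    exact ⟨_, rfl⟩

/-! ### Stabilizers -/

/-- The stabilizer of the base point is the image of the unit square, hence compact. -/
theorem IsCircleLike.isCompact_tauStabilizer (hc : IsCircleLike c) (a b : ℝ) :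
    IsCompact (TauStabilizer c a b : Set (TauGroup c a b)) := by
  set f : ℝ × ℝ → TauGroup c a b := fun q ↦ QuotientGroup.mk (tau c a b (.ofAdd q)) with hf
  have hfc : Continuous f := by
    refine QuotientGroup.continuous_mk.comp ?_
    refine (SL2Tilde.continuous_rot.comp continuous_fst).prodMk
      ((hc.continuous.comp continuous_snd).prodMk (continuous_ofAdd.comp ?_))
    exact (continuous_fst.mul continuous_const).add (continuous_snd.mul continuous_const)
  have hK := ((isCompact_Icc (a := (0 : ℝ)) (b := 1)).prod
    (isCompact_Icc (a := (0 : ℝ)) (b := 1))).image hfc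
  convert hK using 1
  ext g
  constructor
  · rintro ⟨_, ⟨q, rfl⟩, rfl⟩
    refine ⟨(Int.fract q.toAdd.1, Int.fract q.toAdd.2), ⟨⟨Int.fract_nonneg _,
      (Int.fract_lt_one _).le⟩, ⟨Int.fract_nonneg _, (Int.fract_lt_one _).le⟩⟩, ?_⟩
    refine QuotientGroup.eq.2 ?_
    rw [hc.mem_normalCore]
    refine ⟨⌊q.toAdd.1⌋, ⌊q.toAdd.2⌋, ?_⟩
    rw [inv_mul_eq_iff_eq_mul, ← map_mul, ← ofAdd_add]
    rw [Prod.mk_add_mk, Int.fract_add_floor, Int.fract_add_floor]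
    rfl
  · rintro ⟨q, -, rfl⟩
    exact ⟨_, ⟨_, rfl⟩, rfl⟩

variable [IsTopologicalGroup K]

theorem IsCircleLike.isCompact_stabilizer (hc : IsCircleLike c) (a b : ℝ)
    (x : TauGroup c a b ⧸ TauStabilizer c a b) :
    IsCompact (MulAction.stabilizer (TauGroup c a b) x : Set (TauGroup c a b)) := by
  obtain ⟨g, rfl⟩ := QuotientGroup.mk_surjective x
  convert (hc.isCompact_tauStabilizer a b).image
    (by fun_prop : Continuous fun h : TauGroup c a b ↦ g * h * g⁻¹) using 1
  ext h
  constructor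
  · intro hh
    have h1 : (QuotientGroup.mk (h * g) : TauGroup c a b ⧸ TauStabilizer c a b) =
      QuotientGroup.mk g := hh
    exact ⟨g⁻¹ * (h * g), QuotientGroup.eq.1 h1.symm, by group⟩
  · rintro ⟨k, hk, rfl⟩
    change (QuotientGroup.mk (g * k * g⁻¹ * g) : TauGroup c a b ⧸ TauStabilizer c a b) =
      QuotientGroup.mk g
    rw [inv_mul_cancel_right]
    exact (QuotientGroup.eq.2 (by simpa using hk)).symm

/-! ### Freely acting lattices -/

/-- The homomorphism that is trivial on the free factor of the preimage of `Γ(2)` and takes the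
rotation by `π` to `a`. -/
def levelTwoChar (a : ℝ) : SL2Tilde.levelTwo →* Multiplicative ℝ :=
  (AddMonoidHom.toMultiplicative (zmultiplesHom ℝ a)).comp SL2Tilde.levelTwoWinding

theorem levelTwoChar_rot (a : ℝ) (n : ℤ)
    (h : SL2Tilde.rot (.ofAdd (n : ℝ)) ∈ SL2Tilde.levelTwo) :
    (levelTwoChar a ⟨SL2Tilde.rot (.ofAdd (n : ℝ)), h⟩).toAdd = n * a := by
  have := SL2Tilde.levelTwoWinding_rot n
  simp only [levelTwoChar, MonoidHom.comp_apply]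
  rw [this]
  simp

open MeasureTheory Measure in
/-- Let `M` be a discrete subgroup of `K` of finite covolume that contains no conjugate of `c y` for
nonintegral `y`, with a character `ψ` that takes `c n` to `n b` modulo `s`. The lattice in `G` is
the image of the twisted product of the preimage of `Γ(2)` and `M`. The twist makes it contain the
kernel `τ(ℤ²)`, whatever the ratio of `a` and `b`. -/
theorem IsCircleLike.hasPuncturedSurfaceQuotient [PolishSpace K] [MeasurableSpace K] [BorelSpace K]
    (hc : IsCircleLike c) (a b : ℝ)
    (ν : Measure K) [IsHaarMeasure ν] [ν.IsMulRightInvariant] [SigmaFinite ν]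
    {M : Subgroup K} [DiscreteTopology M] (ψ : M →* Multiplicative ℝ) {s : ℝ} (hs : 0 < s)
    {T : Set K} (hT : MeasurableSet T) (hTfin : ν T < ⊤) (hTcov : ∀ g, ∃ γ ∈ M, g * γ ∈ T)
    (hM : ∀ n : ℤ, ∃ (h : c (.ofAdd (n : ℝ)) ∈ M) (k : ℤ), n * b = (ψ ⟨_, h⟩).toAdd + k * s)
    (hfree : ∀ (u : K) (y : ℝ), u * c (.ofAdd y) * u⁻¹ ∈ M → ∃ n : ℤ, y = n) :
    HasPuncturedSurfaceQuotient c a b := by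
  set L := twistedLattice (levelTwoChar a) ψ s with hL
  obtain ⟨S, hS, hSfin, hScov⟩ := SL2Tilde.exists_cover_levelTwo
  have hlat : IsLattice L :=
    isLattice_twistedLattice haar ν _ _ hs hS hSfin hScov hT hTfin hTcov
  have hker : (QuotientGroup.mk' (tau c a b).range.normalCore).ker ≤ L := by
    rw [QuotientGroup.ker_mk']
    intro g hg
    obtain ⟨m, n, rfl⟩ := hc.mem_normalCore.1 hg
    obtain ⟨h, k, hk⟩ := hM n
    refine mem_twistedLattice.2 ⟨SL2Tilde.rot_int_mem_levelTwo m, h, k, ?_⟩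
    change (m : ℝ) * a + n * b = (levelTwoChar a ⟨SL2Tilde.rot (.ofAdd (m : ℝ)), _⟩).toAdd +
      (ψ ⟨c (.ofAdd (n : ℝ)), h⟩).toAdd + k * s
    rw [levelTwoChar_rot, hk]
    ring
  refine ⟨L.map (QuotientGroup.mk' (tau c a b).range.normalCore),
    hlat.map _ QuotientGroup.continuous_mk QuotientGroup.isOpenMap_coe
      (QuotientGroup.mk'_surjective _) hker, ?_, SL2Tilde.puncturedSphereGroup,
      SL2Tilde.isPuncturedSurfaceGroup, ?_⟩
  · rintro _ ⟨g, hg, rfl⟩ x hx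
    obtain ⟨x, rfl⟩ := QuotientGroup.mk_surjective x
    obtain ⟨h, rfl⟩ := QuotientGroup.mk'_surjective (tau c a b).range.normalCore x
    have h1 : h⁻¹ * (g * h) ∈ (tau c a b).range := by
      rw [← mk_mem_tauStabilizer, map_mul, map_inv, map_mul]
      exact QuotientGroup.eq.1 (Eq.symm hx)
    obtain ⟨x, y, hxy⟩ := exists_tau_of_mem_range h1
    have hg' : g = h * tau c a b (.ofAdd (x, y)) * h⁻¹ := by rw [← hxy]; group
    obtain ⟨hg1, hg2, -⟩ := mem_twistedLattice.1 hg
    rw [hg'] at hg1 hg2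
    obtain ⟨m, rfl⟩ := SL2Tilde.exists_int_of_conj_rot_mem_levelTwo (q := h.1) hg1
    obtain ⟨n, rfl⟩ := hfree h.2.1 y hg2
    refine (QuotientGroup.eq_one_iff g).2 ?_
    rw [hg', ← hc.tau_int_mul, mul_inv_cancel_right]
    exact hc.mem_normalCore.2 ⟨m, n, rfl⟩
  · rw [Subgroup.comap_map_eq, sup_eq_left.2 hker]
    refine Eq.trans ?_ SL2Tilde.comap_toPSL_puncturedSphereGroup.symm
    ext p
    constructor
    · rintro ⟨g, hg, rfl⟩
      exact (mem_twistedLattice.1 hg).1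
    · intro hp
      refine ⟨(p, 1, levelTwoChar a ⟨p, hp⟩), mem_twistedLattice.2 ⟨hp, M.one_mem, 0, ?_⟩, rfl⟩
      have h1 : (⟨1, M.one_mem⟩ : M) = 1 := rfl
      change (levelTwoChar a ⟨p, hp⟩).toAdd = (levelTwoChar a ⟨p, hp⟩).toAdd +
        (ψ ⟨1, M.one_mem⟩).toAdd + _
      rw [h1, map_one ψ, toAdd_one]
      simp

end Core

open MeasureTheory Measure in
theorem SL2Tilde.hasPuncturedSurfaceQuotient (a b : ℝ) :
    HasPuncturedSurfaceQuotient SL2Tilde.rot a b := by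
  obtain ⟨S, hS, hSfin, hScov⟩ := exists_cover_levelTwo
  -- both factors carry the same lattice, and the twists by `a` and `b` are independent
  refine isCircleLike_rot.hasPuncturedSurfaceQuotient a b haar (levelTwoChar b) one_pos hS hSfin
    hScov (fun n ↦ ⟨rot_int_mem_levelTwo n, 0, ?_⟩)
    fun u y h ↦ exists_int_of_conj_rot_mem_levelTwo h
  rw [levelTwoChar_rot]
  simp

open MeasureTheory Measure in
theorem S3.hasPuncturedSurfaceQuotient (a b : ℝ) : HasPuncturedSurfaceQuotient S3.rot a b := by
  borelize S3
  have : IsMulRightInvariant (haar : Measure S3) := isMulRightInvariant_of_compactSpace _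
  set M := Subgroup.zpowers (S3.rot (.ofAdd 1))
  have hMmem : ∀ n : ℤ, S3.rot (.ofAdd (n : ℝ)) ∈ M := fun n ↦ by
    refine Subgroup.mem_zpowers_iff.2 ⟨n, ?_⟩
    rw [← map_zpow, ← ofAdd_zsmul]
    simp
  have hMex : ∀ u ∈ M, ∃ n : ℤ, u = S3.rot (.ofAdd (n : ℝ)) := by
    rintro _ ⟨n, rfl⟩
    refine ⟨n, ?_⟩
    change S3.rot (.ofAdd 1) ^ n = _
    rw [← map_zpow, ← ofAdd_zsmul]
    simp
  have hfin : Finite M := by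
    have h2 : Set.Finite (Subtype.val ⁻¹' {(1 : ℍ[ℝ]), -1} : Set S3) :=
      (Set.toFinite _).preimage Subtype.val_injective.injOn
    refine (h2.subset fun u hu ↦ ?_).to_subtype
    obtain ⟨n, rfl⟩ := hMex u hu
    exact S3.rot_int_coe n
  -- The finite group `M` has no nontrivial real character, so `b` has to be a multiple of `s`.
  obtain ⟨s, hs, hsb⟩ : ∃ s : ℝ, 0 < s ∧ ∃ k : ℤ, b = k * s := by
    rcases lt_trichotomy b 0 with h | h | h
    · exact ⟨-b, by linarith, -1, by simp⟩
    · exact ⟨1, one_pos, 0, by simp [h]⟩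
    · exact ⟨b, h, 1, by simp⟩
  obtain ⟨k, hk⟩ := hsb
  refine S3.isCircleLike_rot.hasPuncturedSurfaceQuotient a b haar (M := M) 1 hs MeasurableSet.univ
    (measure_lt_top _ _) (fun _ ↦ ⟨1, M.one_mem, trivial⟩) (fun n ↦ ⟨hMmem n, n * k, ?_⟩) ?_
  · rw [hk]
    simp [mul_assoc]
  · intro u y h
    obtain ⟨n, hn⟩ := hMex _ h
    have h1 : S3.rot (.ofAdd y) = S3.rot (.ofAdd (n : ℝ)) := by
      have : S3.rot (.ofAdd y) = u⁻¹ * S3.rot (.ofAdd (n : ℝ)) * u := by rw [← hn]; group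
      rw [this, mul_assoc, S3.isCircleLike_rot.int_mul, inv_mul_cancel_left]
    apply SL2Tilde.exists_int_of_sin_eq_zero
    have h2 := congrArg (fun v : S3 ↦ (v : ℍ[ℝ]).imI) h1
    simpa only [S3.rot_imI, SL2Tilde.sin_pi_mul_int] using h2

/-! ### Spheres are simply connected -/

section Sphere

open Metric Module

variable {E : Type*} [NormedAddCommGroup E] [InnerProductSpace ℝ E]

/-- A loop in the sphere that misses a point is contractible, because stereographic projection
carries it to a vector space. -/
theorem Path.homotopic_refl_of_sphere_of_ne {x : sphere (0 : E) 1} (γ : Path x x)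
    {v : sphere (0 : E) 1} (hv : ∀ t, γ t ≠ v) : γ.Homotopic (Path.refl x) := by
  set e := stereographic (norm_eq_of_mem_sphere v)
  have hs : ∀ t, γ t ∈ e.source := fun t ↦ by
    rw [stereographic_source]
    exact hv t
  have hcont : Continuous fun t ↦ e (γ t) :=
    e.continuousOn.comp_continuous γ.continuous hs
  have hsymm : Continuous e.symm := by
    refine continuousOn_univ.1 ?_
    rw [← stereographic_target (norm_eq_of_mem_sphere v)]
    exact e.continuousOn_symm
  set δ : Path (e x) (e x) := ⟨⟨fun t ↦ e (γ t), hcont⟩, by simp, by simp⟩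
  have hδ : δ.Homotopic (Path.refl _) := SimplyConnectedSpace.paths_homotopic _ _
  have hx : x = e.symm (e x) := by
    have := e.left_inv (hs 0)
    rw [γ.source] at this
    exact this.symm
  have h := (hδ.map ⟨e.symm, hsymm⟩)
  have h1 : γ = (δ.map hsymm).cast hx hx := by
    ext t
    exact congrArg Subtype.val (e.left_inv (hs t)).symm
  have h2 : Path.refl x = ((Path.refl (e x)).map hsymm).cast hx hx := by
    ext t
    exact congrArg Subtype.val hx
  rw [h1, h2]
  obtain ⟨F⟩ := h
  exact ⟨F.cast (by ext; rfl) (by ext; rfl)⟩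

/-- The radial projection of a nowhere vanishing map to the unit sphere. -/
def toUnitSphere {X : Type*} [TopologicalSpace X] {f : X → E} (hf : Continuous f)
    (h0 : ∀ x, f x ≠ 0) : C(X, sphere (0 : E) 1) where
  toFun x := ⟨‖f x‖⁻¹ • f x, by
    rw [mem_sphere_zero_iff_norm, norm_smul, norm_inv, norm_norm,
      inv_mul_cancel₀ (norm_ne_zero_iff.2 (h0 x))]⟩
  continuous_toFun := by
    refine Continuous.subtype_mk (Continuous.smul ?_ hf) _
    exact hf.norm.inv₀ fun x ↦ norm_ne_zero_iff.2 (h0 x)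

/-- A smooth curve does not meet every ray, in dimension at least three. -/
theorem ContDiff.exists_forall_smul_ne [FiniteDimensional ℝ E] (hE : 2 < finrank ℝ E)
    {f : ℝ → E} (hf : ContDiff ℝ 1 f) : ∃ v : sphere (0 : E) 1, ∀ (s t : ℝ), s • f t ≠ v := by
  have h1 : ContDiff ℝ 1 fun p : ℝ × ℝ ↦ p.1 • f p.2 := contDiff_fst.smul (hf.comp contDiff_snd)
  have hd := h1.dense_compl_range_of_finrank_lt_finrank (by simpa using hE)
  obtain ⟨w, hw⟩ := hd.nonempty
  have hw0 : w ≠ 0 := by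
    rintro rfl
    exact hw ⟨(0, 0), by simp⟩
  refine ⟨⟨‖w‖⁻¹ • w, ?_⟩, fun s t h ↦ hw ⟨(‖w‖ * s, t), ?_⟩⟩
  · rw [mem_sphere_zero_iff_norm, norm_smul, norm_inv, norm_norm,
      inv_mul_cancel₀ (norm_ne_zero_iff.2 hw0)]
  · change (‖w‖ * s) • f t = w
    rw [mul_smul, h, smul_smul, mul_inv_cancel₀ (norm_ne_zero_iff.2 hw0), one_smul]

/-- A loop is homotopic, by radial projection of the straight-line homotopy, to a loop that is the
radial projection of a smooth curve and therefore misses a point. -/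
theorem simplyConnectedSpace_sphere [FiniteDimensional ℝ E] (hE : 2 < finrank ℝ E) :
    SimplyConnectedSpace (sphere (0 : E) 1) := by
  rw [simply_connected_iff_loops_nullhomotopic]
  have hrank : 1 < Module.rank ℝ E := by
    rw [← finrank_eq_rank]
    exact_mod_cast (by lia : 1 < finrank ℝ E)
  refine ⟨isPathConnected_iff_pathConnectedSpace.1
    (isPathConnected_sphere hrank 0 zero_le_one), fun x γ ↦ ?_⟩
  have hγ : Continuous fun t : ℝ ↦ (γ.extend t : E) :=
    continuous_subtype_val.comp γ.continuous_extend
  obtain ⟨f, hf, hfγ, -⟩ := hγ.exists_contDiff_approx 1 (ε := fun _ ↦ 1 / 4) continuous_const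
    fun _ ↦ by norm_num
  -- correct `f` by an affine function so that it is a loop at `x`
  set g : ℝ → E := fun t ↦ f t + (1 - t) • ((x : E) - f 0) + t • ((x : E) - f 1) with hg
  have hgs : ContDiff ℝ 1 g := by
    have : ContDiff ℝ 1 f := hf
    fun_prop
  have hg0 : g 0 = x := by simp [hg]
  have hg1 : g 1 = x := by simp [hg]
  have hgγ : ∀ t ∈ Set.Icc (0 : ℝ) 1, ‖g t - γ.extend t‖ < 1 := by
    intro t ht
    have e : g t - γ.extend t = (f t - γ.extend t) + ((1 - t) • ((γ.extend 0 : E) - f 0) +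
      t • ((γ.extend 1 : E) - f 1)) := by
      simp only [hg, Path.extend_zero, Path.extend_one]
      abel
    have h1 : ‖f t - γ.extend t‖ < 1 / 4 := by simpa [dist_eq_norm] using hfγ t
    have h2 : ‖(γ.extend 0 : E) - f 0‖ < 1 / 4 := by
      simpa [dist_eq_norm, norm_sub_rev] using hfγ 0
    have h3 : ‖(γ.extend 1 : E) - f 1‖ < 1 / 4 := by
      simpa [dist_eq_norm, norm_sub_rev] using hfγ 1
    have h4 := norm_add_le (f t - γ.extend t) ((1 - t) • ((γ.extend 0 : E) - f 0) +
      t • ((γ.extend 1 : E) - f 1))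
    have h5 := norm_add_le ((1 - t) • ((γ.extend 0 : E) - f 0)) (t • ((γ.extend 1 : E) - f 1))
    rw [norm_smul, norm_smul, Real.norm_of_nonneg ht.1,
      Real.norm_of_nonneg (sub_nonneg.2 ht.2)] at h5
    rw [e]
    nlinarith [ht.1, ht.2]
  set k : unitInterval × unitInterval → E := fun p ↦
    (1 - (p.1 : ℝ)) • (γ p.2 : E) + (p.1 : ℝ) • g p.2 with hk
  have hkc : Continuous k := by
    have h1 : Continuous fun p : unitInterval × unitInterval ↦ (γ p.2 : E) := by fun_prop
    have h2 : Continuous fun p : unitInterval × unitInterval ↦ g p.2 :=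
      hgs.continuous.comp (by fun_prop)
    exact (Continuous.smul (by fun_prop) h1).add (Continuous.smul (by fun_prop) h2)
  have hk0 : ∀ p, k p ≠ 0 := by
    intro p h0
    have e : (p.1 : ℝ) • (g p.2 - γ.extend p.2) = -(γ p.2 : E) := by
      rw [Path.extend_apply _ p.2.2]
      have : (1 - (p.1 : ℝ)) • (γ p.2 : E) + (p.1 : ℝ) • g p.2 = 0 := h0
      rw [sub_smul, one_smul] at this
      rw [eq_neg_iff_add_eq_zero, Subtype.coe_eta, smul_sub]
      exact Eq.trans (by abel) this
    have h1 := congrArg norm e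
    rw [norm_smul, norm_neg, norm_eq_of_mem_sphere, Real.norm_of_nonneg p.1.2.1] at h1
    have h2 := hgγ p.2 p.2.2
    have h3 := p.1.2.2
    have h4 := norm_nonneg (g p.2 - γ.extend p.2)
    nlinarith [p.1.2.1]
  set F := toUnitSphere hkc hk0 with hF
  have hkx : ∀ s : unitInterval, ∀ t : unitInterval, (t = 0 ∨ t = 1) → k (s, t) = x := by
    rintro s t (rfl | rfl) <;> simp [hk, hg0, hg1, sub_smul]
  have hFx : ∀ s : unitInterval, ∀ t : unitInterval, (t = 0 ∨ t = 1) → F (s, t) = x := by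
    intro s t h
    apply Subtype.ext
    change ‖k (s, t)‖⁻¹ • k (s, t) = x
    rw [hkx s t h, norm_eq_of_mem_sphere, inv_one, one_smul]
  set δ : Path x x := ⟨F.comp ⟨fun t ↦ (1, t), by fun_prop⟩, hFx 1 0 (.inl rfl),
    hFx 1 1 (.inr rfl)⟩ with hδ
  have h1 : γ.Homotopic δ := by
    refine ⟨⟨⟨F, fun t ↦ ?_, fun t ↦ rfl⟩, fun s t ht ↦ ?_⟩⟩
    · apply Subtype.ext
      change ‖k (0, t)‖⁻¹ • k (0, t) = γ t
      have : k (0, t) = γ t := by simp [hk]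
      rw [this, norm_eq_of_mem_sphere, inv_one, one_smul]
    · have ht' : t = 0 ∨ t = 1 := ht
      refine (hFx s t ht').trans ?_
      rcases ht' with rfl | rfl <;> simp
  obtain ⟨v, hv⟩ := hgs.exists_forall_smul_ne hE
  refine h1.trans (δ.homotopic_refl_of_sphere_of_ne (v := v) fun t h ↦ ?_)
  have h2 : ‖k (1, t)‖⁻¹ • k (1, t) = v := congrArg Subtype.val h
  have h3 : k (1, t) = g t := by simp [hk]
  exact hv _ _ (h3 ▸ h2)

end Sphere

/-- A contractible factor does not affect simple connectedness. -/
theorem simplyConnectedSpace_prod_of_contractible {A X : Type*} [TopologicalSpace A]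
    [TopologicalSpace X] [ContractibleSpace A] [SimplyConnectedSpace X] :
    SimplyConnectedSpace (A × X) := by
  obtain ⟨e⟩ := ContractibleSpace.hequiv_unit A
  exact ((e.prodCongr (ContinuousMap.HomotopyEquiv.refl X)).trans
    (Homeomorph.punitProd X).toHomotopyEquiv).simplyConnectedSpace

/-- Two quotient maps with the same fibres have homeomorphic targets. -/
def homeomorphOfIsQuotientMap {X Y Z : Type*} [TopologicalSpace X] [TopologicalSpace Y]
    [TopologicalSpace Z] {q : Z → X} {f : Z → Y} (hq : Topology.IsQuotientMap q)
    (hf : Topology.IsQuotientMap f) (h : ∀ z z', q z = q z' ↔ f z = f z') : X ≃ₜ Y where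
  toFun x := f (Function.surjInv hq.surjective x)
  invFun y := q (Function.surjInv hf.surjective y)
  left_inv x := by
    exact ((h _ _).2 (Function.surjInv_eq hf.surjective _)).trans
      (Function.surjInv_eq hq.surjective x)
  right_inv y := by
    exact ((h _ _).1 (Function.surjInv_eq hq.surjective _)).trans
      (Function.surjInv_eq hf.surjective y)
  continuous_toFun := hq.continuous_iff.2 <|
    hf.continuous.congr fun z ↦ ((h _ _).1 (Function.surjInv_eq hq.surjective (q z))).symm
  continuous_invFun := hf.continuous_iff.2 <|
    hq.continuous.congr fun z ↦ ((h _ _).2 (Function.surjInv_eq hf.surjective (f z))).symm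

theorem homeomorphOfIsQuotientMap_apply {X Y Z : Type*} [TopologicalSpace X] [TopologicalSpace Y]
    [TopologicalSpace Z] {q : Z → X} {f : Z → Y} (hq : Topology.IsQuotientMap q)
    (hf : Topology.IsQuotientMap f) (h : ∀ z z', q z = q z' ↔ f z = f z') (z : Z) :
    homeomorphOfIsQuotientMap hq hf h (q z) = f z :=
  (h _ _).1 (Function.surjInv_eq hq.surjective _)

/-! ### The homogeneous spaces are simply connected -/

namespace SL2Tilde

/-- The invariant `β e^{i θ}` of the cosets `p (rot ℝ)`: a coordinate on `SL2Tilde ⧸ rot ℝ`. -/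
def plane (p : SL2Tilde) : ℂ := slBeta p.mat * Complex.exp (p.arg * Complex.I)

theorem continuous_plane : Continuous plane := by
  have h1 := continuous_slBeta.comp continuous_mat
  have h2 := continuous_arg
  exact h1.mul (by fun_prop)

theorem plane_mul_rot (p : SL2Tilde) (x : ℝ) : plane (p * rot (.ofAdd x)) = plane p := by
  rw [plane, plane, arg_mul_rot, mul_mat, slBeta_mul, slAlpha_rot, slBeta_rot, mul_zero, zero_add,
    ← Complex.exp_conj, mul_assoc, ← Complex.exp_add]
  congr 2
  simp
  ring

theorem eq_mul_rot_of_plane_eq {p q : SL2Tilde} (h : plane p = plane q) :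
    q = p * rot (.ofAdd ((q.arg - p.arg) / Real.pi)) := by
  have harg : (p * rot (.ofAdd ((q.arg - p.arg) / Real.pi))).arg = q.arg := by
    rw [arg_mul_rot]
    field_simp
    ring
  refine homeoProd.injective (Prod.ext ?_ harg.symm)
  rw [← plane_mul_rot p ((q.arg - p.arg) / Real.pi), plane, plane, harg] at h
  exact (mul_right_cancel₀ (Complex.exp_ne_zero _) h).symm

/-- A continuous section of `plane`. -/
def planeSection (w : ℂ) : SL2Tilde := homeoProd.symm (w, 0)

theorem continuous_planeSection : Continuous planeSection :=
  homeoProd.symm.continuous.comp (by fun_prop)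

theorem planeSection_arg (w : ℂ) : (planeSection w).arg = 0 :=
  congrArg Prod.snd (homeoProd.apply_symm_apply (w, 0))

theorem plane_planeSection (w : ℂ) : plane (planeSection w) = w := by
  have : slBeta (planeSection w).mat = w :=
    congrArg Prod.fst (homeoProd.apply_symm_apply (w, 0))
  rw [plane, planeSection_arg, this]
  simp

end SL2Tilde

section Model

variable {K : Type}

/-- The coordinate of `SL2Tilde × K × ℝ` that is invariant under `τ(ℝ × 0)`. -/
def height (a : ℝ) (g : SL2Tilde × K × Multiplicative ℝ) : ℝ :=
  g.2.2.toAdd - a * (g.1.arg / Real.pi)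

theorem continuous_height [TopologicalSpace K] (a : ℝ) : Continuous (height (K := K) a) := by
  have h1 : Continuous fun g : SL2Tilde × K × Multiplicative ℝ ↦ g.1.arg :=
    SL2Tilde.continuous_arg.comp continuous_fst
  have h2 : Continuous fun g : SL2Tilde × K × Multiplicative ℝ ↦ g.2.2.toAdd :=
    continuous_toAdd.comp (by fun_prop)
  unfold height
  fun_prop

variable [Group K] {c : Multiplicative ℝ →* K} {a b : ℝ}

theorem height_mul_tau (g : SL2Tilde × K × Multiplicative ℝ) (x y : ℝ) :
    height a (g * tau c a b (.ofAdd (x, y))) = height a g + y * b := by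
  rw [height, height, tau_apply]
  simp only [Prod.fst_mul, Prod.snd_mul, SL2Tilde.arg_mul_rot, toAdd_mul, toAdd_ofAdd]
  field_simp
  ring

/-- Two elements are in the same coset if their invariants `plane` agree and their other two
components differ by `τ(0 × ℝ)`. -/
theorem inv_mul_mem_range_tau {g g' : SL2Tilde × K × Multiplicative ℝ}
    (h1 : g.1.plane = g'.1.plane) {y : ℝ} (h2 : g'.2.1 = g.2.1 * c (.ofAdd y))
    (h3 : height a g' = height a g + y * b) : g⁻¹ * g' ∈ (tau c a b).range := by
  refine ⟨.ofAdd ((g'.1.arg - g.1.arg) / Real.pi, y), ?_⟩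
  rw [eq_inv_mul_iff_mul_eq, tau_apply]
  refine Prod.ext (SL2Tilde.eq_mul_rot_of_plane_eq h1).symm (Prod.ext h2.symm ?_)
  refine Multiplicative.toAdd.injective ?_
  simp only [height] at h3
  simp only [Prod.snd_mul, toAdd_mul, toAdd_ofAdd]
  rw [← sub_eq_zero] at h3 ⊢
  rw [← neg_eq_zero, ← h3]
  field_simp
  ring

theorem exists_mul_tau_eq {g g' : SL2Tilde × K × Multiplicative ℝ}
    (h : g⁻¹ * g' ∈ (tau c a b).range) : ∃ x y : ℝ, g' = g * tau c a b (.ofAdd (x, y)) := by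
  obtain ⟨x, y, h⟩ := exists_tau_of_mem_range h
  exact ⟨x, y, by rw [← h, mul_inv_cancel_left]⟩

variable [TopologicalSpace K]

/-- A quotient map from `SL2Tilde × K × ℝ` whose fibres are the cosets of `τ_{a,b}(ℝ²)` identifies
its target with the homogeneous space. -/
theorem simplyConnectedSpace_of_isQuotientMap {X : Type} [TopologicalSpace X]
    [SimplyConnectedSpace X] {f : SL2Tilde × K × Multiplicative ℝ → X}
    (hf : Topology.IsQuotientMap f) (h : ∀ g g', f g = f g' ↔ g⁻¹ * g' ∈ (tau c a b).range) :
    SimplyConnectedSpace (TauGroup c a b ⧸ TauStabilizer c a b) := by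
  set q : SL2Tilde × K × Multiplicative ℝ → TauGroup c a b ⧸ TauStabilizer c a b :=
    fun g ↦ QuotientGroup.mk (QuotientGroup.mk' (tau c a b).range.normalCore g) with hq
  have hqq : Topology.IsQuotientMap q :=
    (QuotientGroup.isQuotientMap_mk (TauStabilizer c a b)).comp
      (QuotientGroup.isQuotientMap_mk (tau c a b).range.normalCore)
  have hfib : ∀ g g', q g = q g' ↔ f g = f g' := fun g g' ↦ by
    rw [h, ← mk_mem_tauStabilizer, map_mul, map_inv]
    exact QuotientGroup.eq
  exact (homeomorphOfIsQuotientMap hqq hf hfib).toHomotopyEquiv.simplyConnectedSpace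

variable [IsTopologicalGroup K]

/-- If `b ≠ 0`, then `ℂ × K` is a model of the homogeneous space. -/
theorem simplyConnectedSpace_of_ne_zero [SimplyConnectedSpace K]
    (hc : Continuous fun y : ℝ ↦ c (.ofAdd y)) (hb : b ≠ 0) :
    SimplyConnectedSpace (TauGroup c a b ⧸ TauStabilizer c a b) := by
  have : SimplyConnectedSpace (ℂ × K) := simplyConnectedSpace_prod_of_contractible
  set f : SL2Tilde × K × Multiplicative ℝ → ℂ × K :=
    fun g ↦ (g.1.plane, g.2.1 * c (.ofAdd (-(height a g / b)))) with hf
  have hfc : Continuous f := by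
    have h1 := continuous_height (K := K) a
    exact (SL2Tilde.continuous_plane.comp continuous_fst).prodMk
      ((by fun_prop : Continuous fun g : SL2Tilde × K × Multiplicative ℝ ↦ g.2.1).mul
        (hc.comp (by fun_prop)))
  refine simplyConnectedSpace_of_isQuotientMap (f := f) ?_ fun g g' ↦ ⟨fun h ↦ ?_, fun h ↦ ?_⟩
  · refine Topology.IsQuotientMap.of_inverse
      (f := fun x : ℂ × K ↦ (SL2Tilde.planeSection x.1, x.2, 1))
      ?_ hfc fun x ↦ Prod.ext (SL2Tilde.plane_planeSection _) ?_
    · exact (SL2Tilde.continuous_planeSection.comp continuous_fst).prodMk (by fun_prop)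
    · simp [hf, height, SL2Tilde.planeSection_arg]
  · have h2 : g.2.1 * c (.ofAdd (-(height a g / b))) = g'.2.1 * c (.ofAdd (-(height a g' / b))) :=
      congrArg Prod.snd h
    refine inv_mul_mem_range_tau (y := (height a g' - height a g) / b) (congrArg Prod.fst h) ?_ ?_
    · have e : Multiplicative.ofAdd ((height a g' - height a g) / b) =
          .ofAdd (-(height a g / b)) * (.ofAdd (-(height a g' / b)))⁻¹ := by
        rw [← ofAdd_neg, ← ofAdd_add]
        congr 1
        ring
      rw [e, map_mul, ← mul_assoc, h2, map_inv, mul_inv_cancel_right]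
    · field_simp
      ring
  · obtain ⟨x, y, rfl⟩ := exists_mul_tau_eq h
    refine Prod.ext (SL2Tilde.plane_mul_rot _ _).symm ?_
    simp only [hf, height_mul_tau]
    change _ = g.2.1 * c (.ofAdd y) * _
    rw [mul_assoc, ← map_mul, ← ofAdd_add]
    congr 3
    field_simp
    ring

/-- If `b = 0`, then `ℂ × K ⧸ c(ℝ) × ℝ` is a model of the homogeneous space. -/
theorem simplyConnectedSpace_of_eq_zero [SimplyConnectedSpace (K ⧸ c.range)] :
    SimplyConnectedSpace (TauGroup c a 0 ⧸ TauStabilizer c a 0) := by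
  have : SimplyConnectedSpace ((ℂ × ℝ) × K ⧸ c.range) := simplyConnectedSpace_prod_of_contractible
  set f₁ : SL2Tilde × K × Multiplicative ℝ → (ℂ × ℝ) × K :=
    fun g ↦ ((g.1.plane, height a g), g.2.1) with hf₁
  have hf₁q : Topology.IsQuotientMap f₁ := by
    refine Topology.IsQuotientMap.of_inverse
      (f := fun x : (ℂ × ℝ) × K ↦
        (SL2Tilde.planeSection x.1.1, x.2, Multiplicative.ofAdd x.1.2)) ?_ ?_
      fun x ↦ Prod.ext (Prod.ext (SL2Tilde.plane_planeSection _) ?_) rfl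
    · exact (SL2Tilde.continuous_planeSection.comp (by fun_prop)).prodMk
        (continuous_snd.prodMk (continuous_ofAdd.comp (by fun_prop)))
    · exact ((SL2Tilde.continuous_plane.comp continuous_fst).prodMk (continuous_height a)).prodMk
        (by fun_prop)
    · simp [hf₁, height, SL2Tilde.planeSection_arg]
  set f₂ : (ℂ × ℝ) × K → (ℂ × ℝ) × K ⧸ c.range := Prod.map id QuotientGroup.mk with hf₂
  have hf₂q : Topology.IsQuotientMap f₂ :=
    (IsOpenMap.id.prodMap QuotientGroup.isOpenMap_coe).isQuotientMap
      (continuous_id.prodMap QuotientGroup.continuous_mk)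
      (Function.surjective_id.prodMap QuotientGroup.mk_surjective)
  refine simplyConnectedSpace_of_isQuotientMap (hf₂q.comp hf₁q) fun g g' ↦ ⟨fun h ↦ ?_, fun h ↦ ?_⟩
  · obtain ⟨y, hy⟩ := QuotientGroup.eq.1 (congrArg Prod.snd h :
      (QuotientGroup.mk g.2.1 : K ⧸ c.range) = QuotientGroup.mk g'.2.1)
    have h1 : (g.1.plane, height a g) = (g'.1.plane, height a g') := congrArg Prod.fst h
    refine inv_mul_mem_range_tau (y := y.toAdd) (congrArg Prod.fst h1) ?_ ?_
    · rw [ofAdd_toAdd, hy, mul_inv_cancel_left]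
    · rw [mul_zero, add_zero]
      exact (congrArg Prod.snd h1).symm
  · obtain ⟨x, y, rfl⟩ := exists_mul_tau_eq h
    refine Prod.ext (Prod.ext (SL2Tilde.plane_mul_rot _ _).symm ?_) (QuotientGroup.eq.2 ?_)
    · change height a g = height a (g * _)
      rw [height_mul_tau, mul_zero, add_zero]
    · change g.2.1⁻¹ * (g.2.1 * c (.ofAdd y)) ∈ c.range
      rw [inv_mul_cancel_left]
      exact ⟨_, rfl⟩

end Model

theorem SL2Tilde.simplyConnectedSpace_quotient (a b : ℝ) :
    SimplyConnectedSpace (TauGroup rot a b ⧸ TauStabilizer rot a b) := by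
  rcases eq_or_ne b 0 with rfl | hb
  · have h : SimplyConnectedSpace (SL2Tilde ⧸ rot.range) := by
      have hf : Topology.IsQuotientMap plane :=
        .of_inverse continuous_planeSection continuous_plane plane_planeSection
      refine (homeomorphOfIsQuotientMap (QuotientGroup.isQuotientMap_mk rot.range) hf
        fun p q ↦ ?_).toHomotopyEquiv.simplyConnectedSpace
      refine QuotientGroup.eq.trans ⟨?_, fun h ↦
        ⟨_, (inv_mul_eq_of_eq_mul (eq_mul_rot_of_plane_eq h)).symm⟩⟩
      rintro ⟨x, hx⟩
      rw [← mul_inv_cancel_left p q, ← hx, ← ofAdd_toAdd x, plane_mul_rot]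
    exact simplyConnectedSpace_of_eq_zero
  · exact simplyConnectedSpace_of_ne_zero continuous_rot hb

namespace S3

instance : SimplyConnectedSpace S3 :=
  simplyConnectedSpace_sphere (by rw [Quaternion.finrank_eq_four]; norm_num)

/-- The Hopf map: the coordinates of `u i u⁻¹`. -/
def hopf (u : S3) : EuclideanSpace ℝ (Fin 3) :=
  !₂[(u : ℍ[ℝ]).re ^ 2 + (u : ℍ[ℝ]).imI ^ 2 - (u : ℍ[ℝ]).imJ ^ 2 - (u : ℍ[ℝ]).imK ^ 2,
    2 * ((u : ℍ[ℝ]).imI * (u : ℍ[ℝ]).imJ + (u : ℍ[ℝ]).re * (u : ℍ[ℝ]).imK),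
    2 * ((u : ℍ[ℝ]).imI * (u : ℍ[ℝ]).imK - (u : ℍ[ℝ]).re * (u : ℍ[ℝ]).imJ)]

theorem continuous_hopf : Continuous hopf := by
  have h0 : Continuous fun u : S3 ↦ (u : ℍ[ℝ]).re :=
    Quaternion.continuous_re.comp continuous_subtype_val
  have h1 : Continuous fun u : S3 ↦ (u : ℍ[ℝ]).imI :=
    Quaternion.continuous_imI.comp continuous_subtype_val
  have h2 : Continuous fun u : S3 ↦ (u : ℍ[ℝ]).imJ :=
    Quaternion.continuous_imJ.comp continuous_subtype_val
  have h3 : Continuous fun u : S3 ↦ (u : ℍ[ℝ]).imK :=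
    Quaternion.continuous_imK.comp continuous_subtype_val
  refine (PiLp.continuous_toLp 2 _).comp (continuous_pi fun i ↦ ?_)
  fin_cases i
  · exact (((h0.pow 2).add (h1.pow 2)).sub (h2.pow 2)).sub (h3.pow 2)
  · exact ((h1.mul h2).add (h0.mul h3)).const_mul 2
  · exact ((h1.mul h3).sub (h0.mul h2)).const_mul 2

theorem coe_inv (u : S3) : ((u⁻¹ : S3) : ℍ[ℝ]) = star (u : ℍ[ℝ]) := by
  rw [Metric.unitSphere.coe_inv, Quaternion.inv_def, Quaternion.normSq_eq_norm_mul_self,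
    norm_eq_of_mem_sphere, mul_one, inv_one, one_smul]

theorem sum_sq (u : S3) : (u : ℍ[ℝ]).re ^ 2 + (u : ℍ[ℝ]).imI ^ 2 + (u : ℍ[ℝ]).imJ ^ 2 +
    (u : ℍ[ℝ]).imK ^ 2 = 1 := (mem_sphere_iff _).1 u.2

theorem mem_sphere_three_iff (x : EuclideanSpace ℝ (Fin 3)) :
    x ∈ Metric.sphere (0 : EuclideanSpace ℝ (Fin 3)) 1 ↔ x 0 ^ 2 + x 1 ^ 2 + x 2 ^ 2 = 1 := by
  rw [mem_sphere_zero_iff_norm, EuclideanSpace.norm_eq, Real.sqrt_eq_one, Fin.sum_univ_three]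
  simp

theorem hopf_mem_sphere (u : S3) : hopf u ∈ Metric.sphere (0 : EuclideanSpace ℝ (Fin 3)) 1 := by
  rw [mem_sphere_three_iff]
  have h := sum_sq u
  simp [hopf]
  generalize (u : ℍ[ℝ]).re = r at *
  generalize (u : ℍ[ℝ]).imI = x at *
  generalize (u : ℍ[ℝ]).imJ = y at *
  generalize (u : ℍ[ℝ]).imK = z at *
  linear_combination (r ^ 2 + x ^ 2 + y ^ 2 + z ^ 2 + 1) * h

theorem imJ_inv_mul (u v : S3) : ((u⁻¹ * v : S3) : ℍ[ℝ]).imJ =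
    (u : ℍ[ℝ]).re * (v : ℍ[ℝ]).imJ + (u : ℍ[ℝ]).imI * (v : ℍ[ℝ]).imK -
      (u : ℍ[ℝ]).imJ * (v : ℍ[ℝ]).re - (u : ℍ[ℝ]).imK * (v : ℍ[ℝ]).imI := by
  rw [Metric.unitSphere.coe_mul, coe_inv, Quaternion.imJ_mul, Quaternion.re_star,
    Quaternion.imI_star, Quaternion.imJ_star, Quaternion.imK_star]
  ring

theorem imK_inv_mul (u v : S3) : ((u⁻¹ * v : S3) : ℍ[ℝ]).imK =
    (u : ℍ[ℝ]).re * (v : ℍ[ℝ]).imK - (u : ℍ[ℝ]).imI * (v : ℍ[ℝ]).imJ +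
      (u : ℍ[ℝ]).imJ * (v : ℍ[ℝ]).imI - (u : ℍ[ℝ]).imK * (v : ℍ[ℝ]).re := by
  rw [Metric.unitSphere.coe_mul, coe_inv, Quaternion.imK_mul, Quaternion.re_star,
    Quaternion.imI_star, Quaternion.imJ_star, Quaternion.imK_star]
  ring

theorem mem_range_rot {u : S3} (h1 : (u : ℍ[ℝ]).imJ = 0) (h2 : (u : ℍ[ℝ]).imK = 0) :
    u ∈ rot.range := by
  have h := sum_sq u
  rw [h1, h2] at h
  set z : ℂ := ⟨(u : ℍ[ℝ]).re, (u : ℍ[ℝ]).imI⟩ with hz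
  have hn : ‖z‖ = 1 := by
    rw [← sq_eq_sq₀ (norm_nonneg _) zero_le_one, ← Complex.normSq_eq_norm_sq, Complex.normSq_apply]
    simp only [hz]
    linarith
  have he := Complex.norm_mul_exp_arg_mul_I z
  rw [hn, Complex.ofReal_one, one_mul] at he
  refine ⟨.ofAdd (z.arg / Real.pi), Subtype.ext ?_⟩
  rw [rot_coe, mul_div_cancel₀ _ Real.pi_ne_zero]
  ext
  · rw [← Complex.exp_ofReal_mul_I_re, he]
  · rw [← Complex.exp_ofReal_mul_I_im, he]
  · exact h1.symm
  · exact h2.symm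

/-- With `w = u⁻¹ v`, the inner product of `hopf u` and `hopf v` is `1 - 2 (w_j² + w_k²)`. -/
theorem inner_hopf (u v : S3) :
    hopf u 0 * hopf v 0 + hopf u 1 * hopf v 1 + hopf u 2 * hopf v 2 =
      1 - 2 * (((u⁻¹ * v : S3) : ℍ[ℝ]).imJ ^ 2 + ((u⁻¹ * v : S3) : ℍ[ℝ]).imK ^ 2) := by
  rw [imJ_inv_mul, imK_inv_mul]
  have hu := sum_sq u
  have hv := sum_sq v
  simp only [hopf, PiLp.toLp_apply, Matrix.cons_val]
  generalize (u : ℍ[ℝ]).re = r at *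
  generalize (u : ℍ[ℝ]).imI = x at *
  generalize (u : ℍ[ℝ]).imJ = y at *
  generalize (u : ℍ[ℝ]).imK = z at *
  linear_combination hu * ((v : ℍ[ℝ]).re ^ 2 + (v : ℍ[ℝ]).imI ^ 2 + (v : ℍ[ℝ]).imJ ^ 2 +
    (v : ℍ[ℝ]).imK ^ 2) + hv

theorem hopf_eq_iff (u v : S3) : hopf u = hopf v ↔ u⁻¹ * v ∈ rot.range := by
  have h := inner_hopf u v
  have hu := (mem_sphere_three_iff _).1 (hopf_mem_sphere u)
  have hv := (mem_sphere_three_iff _).1 (hopf_mem_sphere v)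
  constructor
  · intro e
    rw [e] at h
    refine mem_range_rot ?_ ?_ <;> refine pow_eq_zero_iff two_ne_zero |>.1 ?_ <;>
      nlinarith [sq_nonneg ((u⁻¹ * v : S3) : ℍ[ℝ]).imJ, sq_nonneg ((u⁻¹ * v : S3) : ℍ[ℝ]).imK]
  · rintro ⟨y, hy⟩
    rw [← hy, ← ofAdd_toAdd y, rot_imJ, rot_imK] at h
    have h0 : (hopf u 0 - hopf v 0) ^ 2 + (hopf u 1 - hopf v 1) ^ 2 +
        (hopf u 2 - hopf v 2) ^ 2 = 0 := by
      linear_combination hu + hv - 2 * h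
    ext i
    rw [← sub_eq_zero, ← pow_eq_zero_iff two_ne_zero]
    fin_cases i
    · change (hopf u 0 - hopf v 0) ^ 2 = 0
      nlinarith [sq_nonneg (hopf u 0 - hopf v 0), sq_nonneg (hopf u 1 - hopf v 1),
        sq_nonneg (hopf u 2 - hopf v 2)]
    · change (hopf u 1 - hopf v 1) ^ 2 = 0
      nlinarith [sq_nonneg (hopf u 0 - hopf v 0), sq_nonneg (hopf u 1 - hopf v 1),
        sq_nonneg (hopf u 2 - hopf v 2)]
    · change (hopf u 2 - hopf v 2) ^ 2 = 0
      nlinarith [sq_nonneg (hopf u 0 - hopf v 0), sq_nonneg (hopf u 1 - hopf v 1),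
        sq_nonneg (hopf u 2 - hopf v 2)]

/-- With `s = √((1 + x₀) / 2)`, the quaternion `s i + (x₁ j + x₂ k) / (2 s)` is a preimage of `x`;
it is defined unless `x` is `-i`, which is the image of `j`. -/
theorem surjective_hopf {x : EuclideanSpace ℝ (Fin 3)} (hx : x 0 ^ 2 + x 1 ^ 2 + x 2 ^ 2 = 1) :
    ∃ u, hopf u = x := by
  rcases eq_or_ne (x 0) (-1) with h | h
  · have h1 : x 1 = 0 := by nlinarith [sq_nonneg (x 1), sq_nonneg (x 2)]
    have h2 : x 2 = 0 := by nlinarith [sq_nonneg (x 1), sq_nonneg (x 2)]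
    refine ⟨⟨⟨0, 0, 1, 0⟩, (mem_sphere_iff _).2 (by norm_num)⟩, ?_⟩
    ext i
    fin_cases i
    · exact Eq.trans (by norm_num [hopf]) h.symm
    · exact Eq.trans (by norm_num [hopf]) h1.symm
    · exact Eq.trans (by norm_num [hopf]) h2.symm
  · have hpos : 0 < 1 + x 0 := by
      rcases lt_or_gt_of_ne h with h | h
      · nlinarith [sq_nonneg (x 1), sq_nonneg (x 2)]
      · linarith
    set s := √((1 + x 0) / 2) with hs
    have hs2 : s ^ 2 = (1 + x 0) / 2 := Real.sq_sqrt (by positivity)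
    have hs0 : s ≠ 0 := (Real.sqrt_pos.2 (by positivity)).ne'
    have e : (x 1 / (2 * s)) ^ 2 + (x 2 / (2 * s)) ^ 2 = (1 - x 0) / 2 := by
      rw [div_pow, div_pow, mul_pow, hs2]
      field_simp
      linear_combination hx
    refine ⟨⟨⟨0, s, x 1 / (2 * s), x 2 / (2 * s)⟩, (mem_sphere_iff _).2 ?_⟩, ?_⟩
    · change 0 ^ 2 + s ^ 2 + (x 1 / (2 * s)) ^ 2 + (x 2 / (2 * s)) ^ 2 = 1
      linear_combination hs2 + e
    ext i
    fin_cases i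
    · change 0 ^ 2 + s ^ 2 - (x 1 / (2 * s)) ^ 2 - (x 2 / (2 * s)) ^ 2 = x 0
      linear_combination hs2 - e
    · change 2 * (s * (x 1 / (2 * s)) + 0 * (x 2 / (2 * s))) = x 1
      field_simp
      ring
    · change 2 * (s * (x 2 / (2 * s)) - 0 * (x 1 / (2 * s))) = x 2
      field_simp
      ring

/-- The Hopf map identifies the quotient with the two-dimensional sphere. -/
theorem simplyConnectedSpace_quotient_rot : SimplyConnectedSpace (S3 ⧸ rot.range) := by
  have : SimplyConnectedSpace (Metric.sphere (0 : EuclideanSpace ℝ (Fin 3)) 1) :=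
    simplyConnectedSpace_sphere (by simp)
  set f : S3 → Metric.sphere (0 : EuclideanSpace ℝ (Fin 3)) 1 := fun u ↦ ⟨hopf u, hopf_mem_sphere u⟩
  have hfc : Continuous f := continuous_hopf.subtype_mk _
  have hf : Topology.IsQuotientMap f := hfc.isClosedMap.isQuotientMap hfc fun x ↦ by
    obtain ⟨u, hu⟩ := surjective_hopf ((mem_sphere_three_iff _).1 x.2)
    exact ⟨u, Subtype.ext hu⟩
  exact (homeomorphOfIsQuotientMap (QuotientGroup.isQuotientMap_mk rot.range) hf fun u v ↦
    QuotientGroup.eq.trans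
      ((hopf_eq_iff u v).symm.trans (Subtype.ext_iff (a1 := f u) (a2 := f v)).symm)).toHomotopyEquiv
    |>.simplyConnectedSpace

theorem simplyConnectedSpace_quotient (a b : ℝ) :
    SimplyConnectedSpace (TauGroup rot a b ⧸ TauStabilizer rot a b) := by
  rcases eq_or_ne b 0 with rfl | hb
  · have := simplyConnectedSpace_quotient_rot
    exact simplyConnectedSpace_of_eq_zero
  · exact simplyConnectedSpace_of_ne_zero continuous_rot hb

end S3

/-! ### Lie group structures on quotients by discrete subgroups -/

section Lie

open scoped Manifold ContDiff
open Set Filter Topology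

/-- The map `φ` is a global chart of the group `G` in which the group operations are smooth. -/
structure IsSmoothChart {G E : Type*} [Group G] [TopologicalSpace G] [NormedAddCommGroup E]
    [NormedSpace ℝ E] (φ : OpenPartialHomeomorph G E) : Prop where
  source_eq : φ.source = univ
  mul : ContDiffOn ℝ ∞ (fun v : E × E ↦ φ (φ.symm v.1 * φ.symm v.2)) (φ.target ×ˢ φ.target)
  inv : ContDiffOn ℝ ∞ (fun v : E ↦ φ (φ.symm v)⁻¹) φ.target

variable {G G' E F : Type*} [Group G] [TopologicalSpace G] [Group G'] [TopologicalSpace G']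
  [NormedAddCommGroup E] [NormedSpace ℝ E] [NormedAddCommGroup F] [NormedSpace ℝ F]
  {φ : OpenPartialHomeomorph G E}

theorem IsSmoothChart.prod {ψ : OpenPartialHomeomorph G' F} (hφ : IsSmoothChart φ)
    (hψ : IsSmoothChart ψ) : IsSmoothChart (φ.prod ψ) where
  source_eq := by simp [hφ.source_eq, hψ.source_eq]
  mul :=
    (hφ.mul.comp (g := fun v : E × E ↦ φ (φ.symm v.1 * φ.symm v.2))
      (f := fun v : (E × F) × E × F ↦ (v.1.1, v.2.1)) (by fun_prop)
      fun v hv ↦ ⟨hv.1.1, hv.2.1⟩).prodMk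
    (hψ.mul.comp (g := fun v : F × F ↦ ψ (ψ.symm v.1 * ψ.symm v.2))
      (f := fun v : (E × F) × E × F ↦ (v.1.2, v.2.2)) (by fun_prop)
      fun v hv ↦ ⟨hv.1.2, hv.2.2⟩)
  inv :=
    (hφ.inv.comp (g := fun v : E ↦ φ (φ.symm v)⁻¹) (f := fun v : E × F ↦ v.1) (by fun_prop)
      fun v hv ↦ hv.1).prodMk
    (hψ.inv.comp (g := fun v : F ↦ ψ (ψ.symm v)⁻¹) (f := fun v : E × F ↦ v.2) (by fun_prop)
      fun v hv ↦ hv.2)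

theorem IsSmoothChart.trans_continuousLinearEquiv (hφ : IsSmoothChart φ) (L : E ≃L[ℝ] F) :
    IsSmoothChart (φ.trans L.toHomeomorph.toOpenPartialHomeomorph) where
  source_eq := by simp [hφ.source_eq]
  mul := L.contDiff.comp_contDiffOn
    (hφ.mul.comp (g := fun v : E × E ↦ φ (φ.symm v.1 * φ.symm v.2))
      (f := fun v : F × F ↦ (L.symm v.1, L.symm v.2)) (by fun_prop) fun v hv ↦ ⟨hv.1.2, hv.2.2⟩)
  inv := L.contDiff.comp_contDiffOn
    (hφ.inv.comp (g := fun v : E ↦ φ (φ.symm v)⁻¹)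
      (f := fun v : F ↦ L.symm v) (by fun_prop) fun v hv ↦ hv.2)

theorem IsSmoothChart.symm_apply (hφ : IsSmoothChart φ) (g : G) : φ.symm (φ g) = g :=
  φ.left_inv (hφ.source_eq ▸ mem_univ g)

theorem IsSmoothChart.mem_target (hφ : IsSmoothChart φ) (g : G) : φ g ∈ φ.target :=
  φ.map_source (hφ.source_eq ▸ mem_univ g)

/-- Two lifts of a point along a homomorphism with local inverses differ by an element of the
kernel; so the local inverses are smooth in the chart, being right translations there. -/
theorem IsSmoothChart.contDiffAt_localInverse [ContinuousMul G] (hφ : IsSmoothChart φ) {p : G →* G'}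
    {P : OpenPartialHomeomorph G G'} (hP : ⇑p = P) {v₀ : E} (hv₀ : v₀ ∈ φ.target)
    (h : p (φ.symm v₀) ∈ P.target) :
    ContDiffAt ℝ ∞ (fun v ↦ φ (P.symm (p (φ.symm v)))) v₀ := by
  set w₀ := P.symm (p (φ.symm v₀)) with hw₀
  set n := (φ.symm v₀)⁻¹ * w₀ with hn
  have hpw : p w₀ = p (φ.symm v₀) := by
    rw [hw₀, hP]
    rw [hP] at h
    exact P.right_inv h
  have hpn : p n = 1 := by rw [hn, map_mul, map_inv, hpw, inv_mul_cancel]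
  have hev : ∀ᶠ v in 𝓝 v₀, φ.symm v * n ∈ P.source := by
    refine ContinuousAt.eventually_mem (f := fun v ↦ φ.symm v * n)
      ((φ.continuousAt_symm hv₀).mul continuousAt_const) (P.open_source.mem_nhds ?_)
    rw [hn, mul_inv_cancel_left]
    exact P.map_target h
  have hM : ContDiffAt ℝ ∞ (fun v ↦ φ (φ.symm v * φ.symm (φ n))) v₀ := by
    have h1 := hφ.mul.contDiffAt ((φ.open_target.prod φ.open_target).mem_nhds
      (show (v₀, φ n) ∈ _ from ⟨hv₀, hφ.mem_target n⟩))
    exact h1.comp (f := fun v ↦ (v, φ n)) v₀ (by fun_prop)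
  refine hM.congr_of_eventuallyEq ?_
  filter_upwards [hev] with v hv
  have h2 : p (φ.symm v) = P (φ.symm v * n) := by rw [← hP, map_mul, hpn, mul_one]
  rw [hφ.symm_apply, h2, P.left_inv hv]

/-- Let `p` be a covering homomorphism from a group with a smooth global chart. Then the target is a
Lie group: its charts are the compositions of the global chart with the local inverses of the
projection. -/
theorem IsSmoothChart.exists_lieGroup [ContinuousMul G] {n : ℕ}
    {φ : OpenPartialHomeomorph G (EuclideanSpace ℝ (Fin n))} (hφ : IsSmoothChart φ)
    {p : G →* G'} (hp : IsLocalHomeomorph p) (hs : Function.Surjective p) :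
    ∃ _ : ChartedSpace (EuclideanSpace ℝ (Fin n)) G', LieGroup (𝓡 n) ∞ G' := by
  choose P hPmem hP using hp
  set chart : G → OpenPartialHomeomorph G' (EuclideanSpace ℝ (Fin n)) :=
    fun x ↦ (P x).symm.trans φ with hchart
  have hsource : ∀ x, (chart x).source = (P x).target := fun x ↦ by
    simp [hchart, hφ.source_eq]
  have hmem : ∀ x, p x ∈ (chart x).source := fun x ↦ by
    rw [hsource, hP x]
    exact (P x).map_source (hPmem x)
  have happ : ∀ x g, chart x g = φ ((P x).symm g) := fun x g ↦ rfl
  have hsymm : ∀ x v, (chart x).symm v = p (φ.symm v) := fun x v ↦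
    (congrFun (hP x) (φ.symm v)).symm
  let cs : ChartedSpace (EuclideanSpace ℝ (Fin n)) G' :=
    { atlas := range chart
      chartAt := fun g ↦ chart (Function.surjInv hs g)
      mem_chart_source := fun g ↦ by
        have := hmem (Function.surjInv hs g)
        rwa [Function.surjInv_eq hs] at this
      chart_mem_atlas := fun g ↦ mem_range_self _ }
  have hmfd : IsManifold (𝓡 n) ∞ G' := by
    refine isManifold_of_contDiffOn _ _ _ ?_
    rintro _ _ ⟨x, rfl⟩ ⟨y, rfl⟩ v hv
    have hv' : v ∈ ((chart x).symm.trans (chart y)).source := hv.1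
    rw [OpenPartialHomeomorph.trans_source] at hv'
    have h1 : v ∈ φ.target := hv'.1.1
    have h2 : (chart x).symm v ∈ (chart y).source := hv'.2
    rw [hsource, hsymm] at h2
    refine ((hφ.contDiffAt_localInverse (hP y) h1 h2).congr_of_eventuallyEq
      (Eventually.of_forall fun w ↦ ?_)).contDiffWithinAt
    change chart y ((chart x).symm w) = _
    rw [hsymm, happ]
  have hatlas : ∀ x, chart x ∈ IsManifold.maximalAtlas (𝓡 n) ∞ G' := fun x ↦
    IsManifold.subset_maximalAtlas (mem_range_self x)
  have hchartm : ∀ x, ContMDiffAt (𝓡 n) (𝓡 n) ∞ (chart x) (p x) := fun x ↦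
    (contMDiffOn_of_mem_maximalAtlas (hatlas x)).contMDiffAt
      ((chart x).open_source.mem_nhds (hmem x))
  have hproj : ∀ v ∈ φ.target, ContMDiffAt (𝓡 n) (𝓡 n) ∞ (fun v ↦ p (φ.symm v)) v := by
    intro v hv
    have h1 := contMDiffOn_symm_of_mem_maximalAtlas (hatlas (φ.symm v))
    have h2 : v ∈ (chart (φ.symm v)).target := ⟨hv, hPmem _⟩
    have h3 := h1.contMDiffAt ((chart (φ.symm v)).open_target.mem_nhds h2)
    exact h3.congr_of_eventuallyEq (Eventually.of_forall fun w ↦ (hsymm _ w).symm)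
  have hlift : ∀ x, ∀ᶠ g in 𝓝 (p x), p (φ.symm (chart x g)) = g := fun x ↦ by
    filter_upwards [(chart x).open_source.mem_nhds (hmem x)] with g hg
    rw [← hsymm x, (chart x).left_inv hg]
  have hchart0 : ∀ x, φ.symm (chart x (p x)) = x := fun x ↦ by
    rw [happ, hφ.symm_apply, hP x, (P x).left_inv (hPmem x)]
  refine ⟨cs, { toIsManifold := hmfd, contMDiff_mul := ?_, contMDiff_inv := ?_ }⟩
  · rintro ⟨g, h⟩
    obtain ⟨x, rfl⟩ := hs g
    obtain ⟨y, rfl⟩ := hs h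
    have h1 : ContMDiffAt ((𝓡 n).prod (𝓡 n))
        𝓘(ℝ, EuclideanSpace ℝ (Fin n) × EuclideanSpace ℝ (Fin n)) ∞
        (fun q : G' × G' ↦ (chart x q.1, chart y q.2)) (p x, p y) :=
      ((hchartm x).comp (p x, p y) contMDiffAt_fst).prodMk_space
        ((hchartm y).comp (p x, p y) contMDiffAt_snd)
    have h2 := (hφ.mul.contDiffAt ((φ.open_target.prod φ.open_target).mem_nhds
      (show (chart x (p x), chart y (p y)) ∈ _ from
        ⟨hφ.mem_target _, hφ.mem_target _⟩))).contMDiffAt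
    have h3 := (hproj _
      (hφ.mem_target (φ.symm (chart x (p x)) * φ.symm (chart y (p y))))).comp (p x, p y)
      (f := fun q : G' × G' ↦ φ (φ.symm (chart x q.1) * φ.symm (chart y q.2)))
      (h2.comp (f := fun q : G' × G' ↦ (chart x q.1, chart y q.2)) (p x, p y) h1)
    refine h3.congr_of_eventuallyEq ?_
    rw [nhds_prod_eq]
    filter_upwards [(hlift x).prod_mk (hlift y)] with q hq
    simp only [Function.comp_apply, hφ.symm_apply, map_mul, hq.1, hq.2]
  · intro g
    obtain ⟨x, rfl⟩ := hs g
    have h2 := (hφ.inv.contDiffAt (φ.open_target.mem_nhds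
      (hφ.mem_target ((P x).symm (p x))))).contMDiffAt
    have h3 := (hproj _ (hφ.mem_target (φ.symm (chart x (p x)))⁻¹)).comp (p x)
      (f := fun q ↦ φ (φ.symm (chart x q))⁻¹)
      (h2.comp (f := chart x) (p x) (hchartm x))
    refine h3.congr_of_eventuallyEq ?_
    filter_upwards [hlift x] with q hq
    simp only [Function.comp_apply, hφ.symm_apply, map_inv, hq]

theorem IsSmoothChart.admitsLieGroupStructure {G G' : Type} [Group G] [TopologicalSpace G]
    [ContinuousMul G] [Group G'] [TopologicalSpace G'] [T2Space G'] [SecondCountableTopology G']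
    [FiniteDimensional ℝ E] {φ : OpenPartialHomeomorph G E} (hφ : IsSmoothChart φ)
    {p : G →* G'} (hp : IsLocalHomeomorph p) (hs : Function.Surjective p) :
    AdmitsLieGroupStructure G' :=
  ⟨inferInstance, inferInstance, _,
    (hφ.trans_continuousLinearEquiv toEuclidean).exists_lieGroup hp hs⟩

/-! ### Global charts -/

theorem isSmoothChart_real :
    IsSmoothChart (Homeomorph.toOpenPartialHomeomorph (X := Multiplicative ℝ) (Y := ℝ)
      ⟨Multiplicative.toAdd, continuous_toAdd, continuous_ofAdd⟩) where
  source_eq := rfl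
  mul := (contDiff_fst.add contDiff_snd).contDiffOn
  inv := contDiff_neg.contDiffOn

namespace SL2Tilde

theorem contDiff_normSq : ContDiff ℝ ∞ Complex.normSq := by
  have : (Complex.normSq : ℂ → ℝ) = fun z ↦ ‖z‖ ^ 2 := by
    funext z
    rw [Complex.normSq_eq_norm_sq]
  rw [this]
  exact contDiff_norm_sq ℝ

theorem contDiff_ofReal : ContDiff ℝ ∞ Complex.ofReal := Complex.ofRealCLM.contDiff

/-- The function `α` in the coordinates `(β, θ)`. -/
def alphaCoord (v : ℂ × ℝ) : ℂ := √(1 + Complex.normSq v.1) * Complex.exp (v.2 * Complex.I)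

theorem contDiff_alphaCoord : ContDiff ℝ ∞ alphaCoord := by
  refine ContDiff.mul (contDiff_ofReal.comp (ContDiff.sqrt ?_ fun v ↦ ?_)) (ContDiff.cexp ?_)
  · exact contDiff_const.add (contDiff_normSq.comp contDiff_fst)
  · have := Complex.normSq_nonneg v.1
    positivity
  · exact (contDiff_ofReal.comp contDiff_snd).mul contDiff_const

theorem slAlpha_homeoProd_symm (v : ℂ × ℝ) : slAlpha (homeoProd.symm v).mat = alphaCoord v :=
  slAlpha_slOfAlphaBeta _ _ (normSq_sqrt_mul_exp _ _)

theorem slBeta_homeoProd_symm (v : ℂ × ℝ) : slBeta (homeoProd.symm v).mat = v.1 :=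
  slBeta_slOfAlphaBeta _ _ (normSq_sqrt_mul_exp _ _)

theorem arg_homeoProd_symm (v : ℂ × ℝ) : (homeoProd.symm v).arg = v.2 := rfl

theorem contDiff_conj : ContDiff ℝ ∞ (starRingEnd ℂ) := Complex.conjCLE.contDiff

/-- In the coordinates `(β, θ)` the product is smooth because the cocycle is the imaginary part of a
logarithm at a point of the right half plane. -/
theorem isSmoothChart_homeoProd : IsSmoothChart homeoProd.toOpenPartialHomeomorph where
  source_eq := rfl
  mul := by
    have ha1 : ContDiff ℝ ∞ fun v : (ℂ × ℝ) × ℂ × ℝ ↦ alphaCoord v.1 :=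
      contDiff_alphaCoord.comp contDiff_fst
    have ha2 : ContDiff ℝ ∞ fun v : (ℂ × ℝ) × ℂ × ℝ ↦ alphaCoord v.2 :=
      contDiff_alphaCoord.comp contDiff_snd
    have hb1 : ContDiff ℝ ∞ fun v : (ℂ × ℝ) × ℂ × ℝ ↦ v.1.1 := by fun_prop
    have hb2 : ContDiff ℝ ∞ fun v : (ℂ × ℝ) × ℂ × ℝ ↦ v.2.1 := by fun_prop
    have h1 : ContDiff ℝ ∞ fun v : (ℂ × ℝ) × ℂ × ℝ ↦
        slBeta (homeoProd.symm v.1 * homeoProd.symm v.2).mat := by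
      simp only [mul_mat, slBeta_mul, slAlpha_homeoProd_symm, slBeta_homeoProd_symm]
      exact (ha1.mul hb2).add (hb1.mul (contDiff_conj.comp ha2))
    have h2 : ContDiff ℝ ∞ fun v : (ℂ × ℝ) × ℂ × ℝ ↦
        (homeoProd.symm v.1 * homeoProd.symm v.2).arg := by
      simp only [mul_arg, arg_homeoProd_symm]
      refine ContDiff.add (by fun_prop) (contDiff_iff_contDiffAt.2 fun v ↦ ?_)
      have hr : ContDiffAt ℝ ∞ (fun v : (ℂ × ℝ) × ℂ × ℝ ↦
          slAlpha ((homeoProd.symm v.1).mat * (homeoProd.symm v.2).mat) /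
            (slAlpha (homeoProd.symm v.1).mat * slAlpha (homeoProd.symm v.2).mat)) v := by
        simp only [slAlpha_mul, slAlpha_homeoProd_symm, slBeta_homeoProd_symm]
        simp only [div_eq_mul_inv]
        refine ContDiffAt.mul ?_ (ContDiffAt.fun_inv (ha1.mul ha2).contDiffAt ?_)
        · exact ((ha1.mul ha2).add (hb1.mul (contDiff_conj.comp hb2))).contDiffAt
        · rw [← slAlpha_homeoProd_symm, ← slAlpha_homeoProd_symm]
          exact mul_ne_zero (slAlpha_ne_zero _) (slAlpha_ne_zero _)
      have hlog := ((Complex.contDiffAt_log (n := ∞)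
        (Or.inl (slAlpha_ratio_re_pos (homeoProd.symm v.1).mat (homeoProd.symm v.2).mat)))
          |>.restrict_scalars ℝ).comp v hr
      refine (Complex.imCLM.contDiff.contDiffAt.comp v hlog).congr_of_eventuallyEq
        (Eventually.of_forall fun w ↦ ?_)
      exact (Complex.log_im _).symm
    exact (h1.prodMk h2).contDiffOn
  inv := by
    have h1 : ContDiff ℝ ∞ fun v : ℂ × ℝ ↦ slBeta ((homeoProd.symm v)⁻¹).mat := by
      have e : ∀ g : SL(2, ℝ), slBeta g⁻¹ = -slBeta g := fun g ↦ by
        apply Complex.ext <;> simp [slBeta, Matrix.SpecialLinearGroup.SL2_inv_expl] <;> ring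
      simp only [inv_mat, e, slBeta_homeoProd_symm]
      exact contDiff_fst.neg
    have h2 : ContDiff ℝ ∞ fun v : ℂ × ℝ ↦ ((homeoProd.symm v)⁻¹).arg := by
      simp only [inv_arg, arg_homeoProd_symm]
      exact contDiff_snd.neg
    exact (h1.prodMk h2).contDiffOn

end SL2Tilde

namespace S3

/-- Polar coordinates: `(u, t) ↦ e^t u` identifies the group `S3 × ℝ` with the multiplicative group
of nonzero quaternions. -/
def polar (g : S3 × Multiplicative ℝ) : ℍ[ℝ] := Real.exp g.2.toAdd • (g.1 : ℍ[ℝ])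

theorem isOpenEmbedding_polar : IsOpenEmbedding polar := by
  set e : S3 × Multiplicative ℝ ≃ₜ ({0}ᶜ : Set ℍ[ℝ]) :=
    ((Homeomorph.refl S3).prodCongr ((Homeomorph.mk Multiplicative.toAdd continuous_toAdd
      continuous_ofAdd).trans Real.expOrderIso.toHomeomorph)).trans
      (homeomorphUnitSphereProd ℍ[ℝ]).symm with he
  have h : polar = Subtype.val ∘ e := rfl
  rw [h]
  exact (isOpen_compl_singleton.isOpenEmbedding_subtypeVal).comp e.isOpenEmbedding

theorem polar_mul (g h : S3 × Multiplicative ℝ) : polar (g * h) = polar g * polar h := by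
  simp [polar, Real.exp_add, smul_smul, mul_comm]

theorem polar_ne_zero (g : S3 × Multiplicative ℝ) : polar g ≠ 0 :=
  smul_ne_zero (Real.exp_ne_zero _) (ne_zero_of_mem_unit_sphere g.1)

theorem polar_inv (g : S3 × Multiplicative ℝ) : polar g⁻¹ = (polar g)⁻¹ := by
  refine eq_inv_of_mul_eq_one_left ?_
  rw [← polar_mul, inv_mul_cancel]
  simp [polar]

theorem isSmoothChart_polar : IsSmoothChart isOpenEmbedding_polar.toOpenPartialHomeomorph where
  source_eq := rfl
  mul := by
    have h : ContDiff ℝ ∞ fun v : ℍ[ℝ] × ℍ[ℝ] ↦ v.1 * v.2 := contDiff_mul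
    refine h.contDiffOn.congr fun v hv ↦ ?_
    refine (polar_mul _ _).trans ?_
    exact congrArg₂ (· * ·) (isOpenEmbedding_polar.toOpenPartialHomeomorph.right_inv hv.1)
      (isOpenEmbedding_polar.toOpenPartialHomeomorph.right_inv hv.2)
  inv := by
    intro v hv
    have hpv : polar (isOpenEmbedding_polar.toOpenPartialHomeomorph.symm v) = v :=
      isOpenEmbedding_polar.toOpenPartialHomeomorph.right_inv hv
    have hv0 : v ≠ 0 := hpv ▸ polar_ne_zero _
    refine ContDiffWithinAt.congr (f := Ring.inverse)
      (contDiffAt_ringInverse ℝ (Units.mk0 v hv0)).contDiffWithinAt (fun w hw ↦ ?_) ?_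
    · rw [Ring.inverse_eq_inv]
      exact (polar_inv _).trans
        (congrArg _ (isOpenEmbedding_polar.toOpenPartialHomeomorph.right_inv hw))
    · rw [Ring.inverse_eq_inv]
      exact (polar_inv _).trans (congrArg _ hpv)

end S3

end Lie

/-! ### The groups `G` are Lie groups -/

section Geometry

variable {K : Type} [Group K] [TopologicalSpace K] [IsTopologicalGroup K]
  {c : Multiplicative ℝ →* K} {a b : ℝ}

theorem Subgroup.discreteTopology_of_isOpen {G : Type*} [Group G] [TopologicalSpace G]
    [IsTopologicalGroup G] {N : Subgroup G} {U : Set G} (hU : IsOpen U) (h1 : 1 ∈ U)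
    (h : ∀ g ∈ N, g ∈ U → g = 1) : DiscreteTopology N := by
  refine discreteTopology_of_isOpen_singleton_one ?_
  convert hU.preimage continuous_subtype_val
  ext g
  exact ⟨fun hg ↦ by rw [Set.mem_singleton_iff.1 hg]; exact h1,
    fun hg ↦ Subtype.ext (h g g.2 hg)⟩

theorem QuotientGroup.isCoveringMap_mk' {G : Type*} [Group G] [TopologicalSpace G]
    [IsTopologicalGroup G] (N : Subgroup G) [N.Normal] [DiscreteTopology N] :
    IsCoveringMap (QuotientGroup.mk' N) :=
  ((QuotientGroup.isQuotientMap_mk N).isQuotientCoveringMap_of_isDiscrete_ker_monoidHom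
    (f := QuotientGroup.mk' N) (by
      rw [QuotientGroup.ker_mk']
      exact ⟨inferInstance⟩)).isCoveringMap

/-- The arguments of the first two components separate the points of `τ(ℤ²)`. -/
theorem SL2Tilde.discreteTopology_normalCore (a b : ℝ) :
    DiscreteTopology (tau SL2Tilde.rot a b).range.normalCore := by
  refine Subgroup.discreteTopology_of_isOpen
    (U := {g | |g.1.arg| < Real.pi ∧ |g.2.1.arg| < Real.pi}) ?_ ?_ fun g hg hU ↦ ?_
  · exact (isOpen_lt (continuous_arg.comp continuous_fst).abs continuous_const).inter
      (isOpen_lt (continuous_arg.comp (by fun_prop)).abs continuous_const)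
  · change |(1 : SL2Tilde).arg| < _ ∧ |(1 : SL2Tilde).arg| < _
    simp [one_arg, Real.pi_pos]
  · obtain ⟨m, n, rfl⟩ := isCircleLike_rot.mem_normalCore.1 hg
    have h0 : ∀ k : ℤ, |(rot (.ofAdd (k : ℝ))).arg| < Real.pi → k = 0 := fun k hk ↦ by
      rw [rot_arg, abs_mul, abs_of_pos Real.pi_pos] at hk
      rw [← Int.abs_lt_one_iff]
      have : |(k : ℝ)| < 1 := by nlinarith [Real.pi_pos]
      exact_mod_cast this
    rw [h0 m hU.1, h0 n hU.2]
    simp [tau_apply]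

/-- Near the identity, the argument of the first component forces `m = 0`, the real part of the
second forces `n` to be even, and the last component is `n b`. -/
theorem S3.discreteTopology_normalCore (a b : ℝ) :
    DiscreteTopology (tau S3.rot a b).range.normalCore := by
  obtain ⟨s, hs, hsb⟩ : ∃ s : ℝ, 0 < s ∧ ∀ n : ℤ, |n * b| < s → n * b = 0 := by
    rcases eq_or_ne b 0 with rfl | hb
    · exact ⟨1, one_pos, fun n _ ↦ mul_zero _⟩
    · refine ⟨|b|, abs_pos.2 hb, fun n hn ↦ ?_⟩
      rw [abs_mul, mul_lt_iff_lt_one_left (abs_pos.2 hb)] at hn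
      have : |n| < 1 := by exact_mod_cast hn
      rw [Int.abs_lt_one_iff.1 this]
      simp
  refine Subgroup.discreteTopology_of_isOpen
    (U := {g | |g.1.arg| < Real.pi ∧ 0 < (g.2.1 : ℍ[ℝ]).re ∧ |g.2.2.toAdd| < s}) ?_ ?_
    fun g hg hU ↦ ?_
  · exact (isOpen_lt (SL2Tilde.continuous_arg.comp continuous_fst).abs continuous_const).inter
      ((isOpen_lt continuous_const (Quaternion.continuous_re.comp
        (continuous_subtype_val.comp (continuous_fst.comp continuous_snd)))).inter
        (isOpen_lt (continuous_toAdd.comp (continuous_snd.comp continuous_snd)).abs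
          continuous_const))
  · change |(1 : SL2Tilde).arg| < _ ∧ 0 < (1 : ℍ[ℝ]).re ∧ |(0 : ℝ)| < s
    simp [SL2Tilde.one_arg, Real.pi_pos, hs]
  · obtain ⟨m, n, rfl⟩ := isCircleLike_rot.mem_normalCore.1 hg
    obtain ⟨h1, h2, h3⟩ := hU
    change |Real.pi * (m : ℝ)| < Real.pi at h1
    change |(m : ℝ) * a + n * b| < s at h3
    change 0 < ((rot (.ofAdd (n : ℝ)) : S3) : ℍ[ℝ]).re at h2
    have hm : m = 0 := by
      rw [abs_mul, abs_of_pos Real.pi_pos] at h1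
      rw [← Int.abs_lt_one_iff]
      have : |(m : ℝ)| < 1 := by nlinarith [Real.pi_pos]
      exact_mod_cast this
    subst hm
    have h4 : (n : ℝ) * b = 0 := hsb n (by simpa using h3)
    have h5 : rot (.ofAdd (n : ℝ)) = 1 := by
      apply Subtype.ext
      rcases rot_int_coe n with h | h
      · exact h
      · rw [h] at h2
        norm_num at h2
    rw [tau_apply, h5, h4]
    simp

/-- The chart is required on `K × ℝ` rather than on `K`, because `S3 × ℝ` has a global chart and
`S3` has none. -/
theorem IsCircleLike.isGeometry [ConnectedSpace K] [T2Space K] [SecondCountableTopology K]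
    [DiscreteTopology (tau c a b).range.normalCore] (hc : IsCircleLike c)
    {E : Type*} [NormedAddCommGroup E] [NormedSpace ℝ E] [FiniteDimensional ℝ E]
    {φ : OpenPartialHomeomorph (K × Multiplicative ℝ) E} (hφ : IsSmoothChart φ)
    (hsimp : SimplyConnectedSpace (TauGroup c a b ⧸ TauStabilizer c a b)) :
    IsGeometry (TauGroup c a b) (TauStabilizer c a b) where
  lieGroup := by
    have hclosed : IsClosed ((tau c a b).range.normalCore :
      Set (SL2Tilde × K × Multiplicative ℝ)) := Subgroup.isClosed_of_discrete
    have : SecondCountableTopology (Multiplicative ℝ) :=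
      inferInstanceAs (SecondCountableTopology ℝ)
    exact (SL2Tilde.isSmoothChart_homeoProd.prod hφ).admitsLieGroupStructure
      (QuotientGroup.isCoveringMap_mk' _).isLocalHomeomorph (QuotientGroup.mk'_surjective _)
  connected := by
    have : ConnectedSpace (Multiplicative ℝ) := inferInstanceAs (ConnectedSpace ℝ)
    exact (QuotientGroup.mk'_surjective (tau c a b).range.normalCore).connectedSpace
      QuotientGroup.continuous_mk
  faithful := tauGroup_faithful a b
  compact_stabilizer := hc.isCompact_stabilizer a b
  simplyConnected := hsimp

end Geometry

theorem IsGeometry.isModelGeometry {K : Type} [Group K] [TopologicalSpace K]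
    {c : Multiplicative ℝ →* K} {a b : ℝ} (h : IsGeometry (TauGroup c a b) (TauStabilizer c a b))
    (hΓ : HasPuncturedSurfaceQuotient c a b) :
    IsModelGeometry (TauGroup c a b) (TauStabilizer c a b) := by
  obtain ⟨Γ, h1, h2, -⟩ := hΓ
  exact ⟨h, Γ, h1, h2⟩

theorem SL2Tilde.isModelGeometry (a b : ℝ) :
    IsModelGeometry (TauGroup rot a b) (TauStabilizer rot a b) := by
  have := discreteTopology_normalCore a b
  exact (isCircleLike_rot.isGeometry (isSmoothChart_homeoProd.prod isSmoothChart_real)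
    (simplyConnectedSpace_quotient a b)).isModelGeometry (hasPuncturedSurfaceQuotient a b)

theorem S3.isModelGeometry (a b : ℝ) :
    IsModelGeometry (TauGroup rot a b) (TauStabilizer rot a b) := by
  have := discreteTopology_normalCore a b
  exact (isCircleLike_rot.isGeometry isSmoothChart_polar
    (simplyConnectedSpace_quotient a b)).isModelGeometry (hasPuncturedSurfaceQuotient a b)

/-! ### One-parameter groups of the circle -/

/-- A continuous homomorphism from `ℝ` to the circle lifts to `ℝ`, where it is linear. -/
theorem exists_eq_circleExp_mul {f : ℝ → Circle} (hf : Continuous f)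
    (h : ∀ x y, f (x + y) = f x * f y) :
    ∃ k : ℝ, ∀ x, f x = Circle.exp (2 * Real.pi * (k * x)) := by
  have h0 : f 0 = 1 := by
    have := h 0 0
    rwa [add_zero, left_eq_mul] at this
  obtain ⟨F, ⟨hF0, hF⟩, -⟩ := Circle.isCoveringMap_exp.existsUnique_continuousMap_lifts
    (⟨f, hf⟩ : C(ℝ, Circle)) 0 0 (by simp [h0])
  have hFx : ∀ x, Circle.exp (F x) = f x := fun x ↦ congrFun hF x
  have hadd : ∀ x y, F (x + y) = F x + F y := by
    intro x y
    -- both sides are lifts of `f (x + ·)` with the same value at `0`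
    have h1 := Circle.isCoveringMap_exp.eq_of_comp_eq (g₁ := fun y ↦ F (x + y))
      (g₂ := fun y ↦ F x + F y) (by fun_prop) (by fun_prop)
      (by funext y; simp [hFx, h, Circle.exp_add]) 0 (by simp [hF0])
    exact congrFun h1 y
  set L := AddMonoidHom.toRealLinearMap (AddMonoidHom.mk' F hadd) F.continuous with hL
  refine ⟨F 1 / (2 * Real.pi), fun x ↦ ?_⟩
  have h1 : F x = x * F 1 := by
    have h2 : L (x • (1 : ℝ)) = x • L 1 := map_smul L x 1
    rw [smul_eq_mul, mul_one, smul_eq_mul] at h2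
    exact h2
  rw [← hFx, h1]
  congr 1
  field_simp

theorem Circle.exp_two_pi_mul_eq_iff {x y : ℝ} :
    Circle.exp (2 * Real.pi * x) = Circle.exp (2 * Real.pi * y) ↔ ∃ n : ℤ, x = y + n := by
  rw [Circle.exp_eq_exp]
  refine exists_congr fun n ↦ ?_
  have := Real.pi_ne_zero
  constructor
  · intro h
    have h1 : 2 * Real.pi * x = 2 * Real.pi * (y + n) := by rw [h]; ring
    exact mul_left_cancel₀ (by positivity) h1
  · rintro rfl
    ring

/-- Up to integers, a continuous automorphism of the circle `ℝ / ℤ` is `±1`. -/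
theorem exists_sign_of_circle_automorphism {f : ℝ → ℝ}
    (hf : Continuous fun x ↦ Circle.exp (2 * Real.pi * f x))
    (hadd : ∀ x y, ∃ n : ℤ, f (x + y) = f x + f y + n)
    (hint : ∀ x, (∃ n : ℤ, f x = n) ↔ ∃ n : ℤ, x = n) :
    ∃ ε : ℝ, (ε = 1 ∨ ε = -1) ∧ ∀ x, ∃ n : ℤ, f x = ε * x + n := by
  obtain ⟨k, hk⟩ := exists_eq_circleExp_mul hf fun x y ↦ by
    rw [← Circle.exp_add, ← mul_add]
    exact Circle.exp_two_pi_mul_eq_iff.2 (hadd x y)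
  have hk' : ∀ x, ∃ n : ℤ, f x = k * x + n := fun x ↦ Circle.exp_two_pi_mul_eq_iff.1 (hk x)
  have hiff : ∀ x, (∃ n : ℤ, k * x = n) ↔ ∃ n : ℤ, x = n := by
    intro x
    rw [← hint x]
    obtain ⟨n, hn⟩ := hk' x
    constructor
    · rintro ⟨m, hm⟩
      exact ⟨m + n, by rw [hn, hm]; push_cast; ring⟩
    · rintro ⟨m, hm⟩
      exact ⟨m - n, by push_cast; linarith⟩
  obtain ⟨m, hm⟩ := (hiff 1).2 ⟨1, by simp⟩
  rw [mul_one] at hm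
  have hk0 : k ≠ 0 := by
    rintro rfl
    obtain ⟨n, hn⟩ := (hiff (1 / 2)).1 ⟨0, by simp⟩
    have h2 : (1 : ℝ) = ((2 * n : ℤ) : ℝ) := by push_cast; linarith
    have h3 : (1 : ℤ) = 2 * n := by exact_mod_cast h2
    lia
  obtain ⟨n, hn⟩ := (hiff k⁻¹).1 ⟨1, by rw [mul_inv_cancel₀ hk0, Int.cast_one]⟩
  have hmn : m * n = 1 := by
    have : (m : ℝ) * n = 1 := by rw [← hm, ← hn, mul_inv_cancel₀ hk0]
    exact_mod_cast this
  refine ⟨k, ?_, hk'⟩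
  rcases Int.eq_one_or_neg_one_of_mul_eq_one hmn with h | h
  · left; rw [hm, h, Int.cast_one]
  · right; rw [hm, h]; simp

/-! ### Isomorphisms of homogeneous spaces -/

section Iso

variable {G G' : Type} [Group G] [TopologicalSpace G] [Group G']
  [TopologicalSpace G'] {H : Subgroup G} {H' : Subgroup G'}

/-- An isomorphism can be composed with an inner automorphism so as to respect the base points, and
then it matches the stabilizers. -/
theorem HomogeneousIso.exists_mem_iff [IsTopologicalGroup G'] (h : HomogeneousIso G H G' H') :
    ∃ φ : G ≃ₜ* G', ∀ g, φ g ∈ H' ↔ g ∈ H := by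
  obtain ⟨φ, F, hF⟩ := h
  obtain ⟨k, hk⟩ := QuotientGroup.mk_surjective (F (QuotientGroup.mk 1))
  refine ⟨φ.trans
    { toMulEquiv := MulAut.conj k⁻¹
      continuous_toFun := by
        change Continuous fun g : G' ↦ k⁻¹ * g * (k⁻¹)⁻¹
        fun_prop
      continuous_invFun := by
        change Continuous fun g : G' ↦ k⁻¹⁻¹ * g * k⁻¹
        fun_prop }, fun g ↦ ?_⟩
  have h1 : F (QuotientGroup.mk g) = QuotientGroup.mk (φ g * k) := by
    have := hF g (QuotientGroup.mk 1)
    rw [← hk] at this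
    have e : (QuotientGroup.mk g : G ⧸ H) = g • QuotientGroup.mk 1 := by
      change _ = QuotientGroup.mk (g * 1)
      rw [mul_one]
    rw [e, this]
    rfl
  have h2 : g ∈ H ↔ (QuotientGroup.mk 1 : G ⧸ H) = QuotientGroup.mk g := by
    rw [QuotientGroup.eq, inv_one, one_mul]
  rw [h2, ← F.injective.eq_iff, h1, ← hk, QuotientGroup.eq]
  change k⁻¹ * φ g * (k⁻¹)⁻¹ ∈ H' ↔ _
  rw [inv_inv, mul_assoc]

theorem homogeneousIso_of_mem_iff (φ : G ≃ₜ* G') (h : ∀ g, φ g ∈ H' ↔ g ∈ H) :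
    HomogeneousIso G H G' H' := by
  have hq : Topology.IsQuotientMap fun g : G ↦ (QuotientGroup.mk (φ g) : G' ⧸ H') :=
    (QuotientGroup.isQuotientMap_mk H').comp φ.toHomeomorph.isQuotientMap
  refine ⟨φ, homeomorphOfIsQuotientMap (QuotientGroup.isQuotientMap_mk H) hq fun g g' ↦ ?_,
    fun g x ↦ ?_⟩
  · rw [QuotientGroup.eq, QuotientGroup.eq, ← map_inv, ← map_mul, h]
  · obtain ⟨x, rfl⟩ := QuotientGroup.mk_surjective x
    have e : ∀ g : G, homeomorphOfIsQuotientMap (QuotientGroup.isQuotientMap_mk H) hq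
        (fun g g' ↦ by rw [QuotientGroup.eq, QuotientGroup.eq, ← map_inv, ← map_mul, h])
        (QuotientGroup.mk g) = QuotientGroup.mk (φ g) := fun g ↦
      homeomorphOfIsQuotientMap_apply _ _ _ _
    refine (e (g * x)).trans ?_
    rw [e, map_mul]
    rfl

/-- The elements whose conjugacy class is relatively compact. -/
def HasBoundedConj (g : G) : Prop := ∃ C : Set G, IsCompact C ∧ ∀ x, x * g * x⁻¹ ∈ C

/-- The elements that commute with all conjugates of those elements of `H` whose conjugacy class is
relatively compact. -/
def CentralizesBounded (H : Subgroup G) (g : G) : Prop :=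
  ∀ h ∈ H, HasBoundedConj h → ∀ x, g * (x * h * x⁻¹) = x * h * x⁻¹ * g

theorem HasBoundedConj.map (φ : G ≃ₜ* G') {g : G} (h : HasBoundedConj g) :
    HasBoundedConj (φ g) := by
  obtain ⟨C, hC, hg⟩ := h
  refine ⟨φ '' C, hC.image φ.continuous, fun x ↦ ⟨φ.symm x * g * (φ.symm x)⁻¹, hg _, ?_⟩⟩
  simp

theorem CentralizesBounded.map (φ : G ≃ₜ* G') (hφ : ∀ g, φ g ∈ H' ↔ g ∈ H) {g : G}
    (h : CentralizesBounded H g) : CentralizesBounded H' (φ g) := by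
  intro k hk hkb x
  have h1 := h (φ.symm k) ((hφ _).1 (by simpa using hk)) (hkb.map φ.symm) (φ.symm x)
  have h2 := congrArg φ h1
  simpa using h2

end Iso

namespace S3

/-! ### The stabilizer torus for `K = S3` -/

section Torus

variable {a b a' b' : ℝ}

/-- The parametrization of the stabilizer by `ℝ²`. -/
def torus (a b x y : ℝ) : TauGroup rot a b :=
  QuotientGroup.mk' (tau rot a b).range.normalCore (tau rot a b (.ofAdd (x, y)))

theorem torus_mem (x y : ℝ) : torus a b x y ∈ TauStabilizer rot a b :=
  mk_mem_tauStabilizer.2 ⟨_, rfl⟩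

theorem exists_torus {g : TauGroup rot a b} (hg : g ∈ TauStabilizer rot a b) :
    ∃ x y, g = torus a b x y := by
  obtain ⟨_, ⟨p, rfl⟩, rfl⟩ := hg
  exact ⟨p.toAdd.1, p.toAdd.2, rfl⟩

theorem torus_mul (x y x' y' : ℝ) :
    torus a b x y * torus a b x' y' = torus a b (x + x') (y + y') := by
  rw [torus, torus, torus, ← map_mul, ← map_mul, ← ofAdd_add, Prod.mk_add_mk]

theorem mk_eq_mk_iff {g g' : SL2Tilde × S3 × Multiplicative ℝ} :
    QuotientGroup.mk' (tau rot a b).range.normalCore g = QuotientGroup.mk' _ g' ↔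
      ∃ m n : ℤ, g' = g * tau rot a b (.ofAdd ((m : ℝ), (n : ℝ))) := by
  refine QuotientGroup.eq.trans (isCircleLike_rot.mem_normalCore.trans ?_)
  simp only [inv_mul_eq_iff_eq_mul]

theorem mk_conj (g h : SL2Tilde × S3 × Multiplicative ℝ) :
    QuotientGroup.mk' (tau rot a b).range.normalCore g * QuotientGroup.mk' _ h *
      (QuotientGroup.mk' _ g)⁻¹ = QuotientGroup.mk' _ (g * h * g⁻¹) := rfl

theorem torus_add_int (x y : ℝ) (m n : ℤ) : torus a b (x + m) (y + n) = torus a b x y := by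
  refine (mk_eq_mk_iff.2 ⟨m, n, ?_⟩).symm
  rw [← map_mul, ← ofAdd_add, Prod.mk_add_mk]

theorem continuous_torus : Continuous fun q : ℝ × ℝ ↦ torus a b q.1 q.2 := by
  refine QuotientGroup.continuous_mk.comp ?_
  refine (SL2Tilde.continuous_rot.comp continuous_fst).prodMk
    ((continuous_rot.comp continuous_snd).prodMk (continuous_ofAdd.comp ?_))
  exact (continuous_fst.mul continuous_const).add (continuous_snd.mul continuous_const)

theorem exists_int_of_torus_fst_eq_one {x : ℝ} (h : torus a b x 0 = 1) : ∃ m : ℤ, x = m := by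
  obtain ⟨m, n, h⟩ := isCircleLike_rot.mem_normalCore.1 ((QuotientGroup.eq_one_iff _).1 h)
  exact ⟨m, SL2Tilde.rot_injective (congrArg Prod.fst h)⟩

theorem exists_int_of_torus_snd_eq_one (hb : b ≠ 0) {y : ℝ} (h : torus a b 0 y = 1) :
    ∃ n : ℤ, y = n := by
  obtain ⟨m, n, h⟩ := isCircleLike_rot.mem_normalCore.1 ((QuotientGroup.eq_one_iff _).1 h)
  have h1 : (0 : ℝ) = m := SL2Tilde.rot_injective (congrArg Prod.fst h)
  have h2 : 0 * a + y * b = m * a + n * b :=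
    congrArg (fun g : SL2Tilde × S3 × Multiplicative ℝ ↦ g.2.2.toAdd) h
  rw [← h1] at h2
  exact ⟨n, mul_right_cancel₀ hb (add_left_cancel h2)⟩

theorem torus_int (m n : ℤ) : torus a b m n = 1 :=
  (QuotientGroup.eq_one_iff _).2 (isCircleLike_rot.mem_normalCore.2 ⟨m, n, rfl⟩)

/-- Continuous functions on `SL2Tilde × S3 × ℝ` that are invariant under `τ(ℤ²)` descend to the
group `G`. -/
theorem exists_continuous_lift {X : Type} [TopologicalSpace X]
    {f : SL2Tilde × S3 × Multiplicative ℝ → X} (hf : Continuous f)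
    (h : ∀ g (m n : ℤ), f (g * tau rot a b (.ofAdd ((m : ℝ), (n : ℝ)))) = f g) :
    ∃ F : TauGroup rot a b → X, Continuous F ∧ ∀ g, F (QuotientGroup.mk' _ g) = f g := by
  refine ⟨Quotient.lift f fun g g' hg ↦ ?_, hf.quotient_lift _, fun g ↦ rfl⟩
  obtain ⟨m, n, rfl⟩ := mk_eq_mk_iff.1 (Quotient.sound hg)
  exact (h _ _ _).symm

/-- A continuous function on the group that determines the first coordinate of the torus modulo `1`.
-/
theorem exists_torus_fst (a b : ℝ) : ∃ F : TauGroup rot a b → Circle, Continuous F ∧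
    ∀ x y, F (torus a b x y) = Circle.exp (2 * Real.pi * x) := by
  obtain ⟨F, hF, h⟩ := exists_continuous_lift (a := a) (b := b)
    (f := fun g ↦ Circle.exp (2 * g.1.arg)) (Circle.exp.continuous.comp
      (continuous_const.mul (SL2Tilde.continuous_arg.comp continuous_fst))) fun g m n ↦ by
    rw [Circle.exp_eq_exp]
    refine ⟨m, ?_⟩
    rw [tau_apply, Prod.fst_mul, SL2Tilde.arg_mul_rot]
    ring
  refine ⟨F, hF, fun x y ↦ ?_⟩
  rw [torus, h]
  change Circle.exp (2 * (Real.pi * x)) = _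
  rw [mul_assoc]

/-- A continuous function on the group that determines the second coordinate of the torus modulo
`1`. -/
theorem exists_torus_snd (a b : ℝ) : ∃ F : TauGroup rot a b → ℂ, Continuous F ∧
    ∀ x y, F (torus a b x y) = Circle.exp (2 * Real.pi * y) := by
  have h1 : Continuous fun g : SL2Tilde × S3 × Multiplicative ℝ ↦ (g.2.1 : ℍ[ℝ]) :=
    continuous_subtype_val.comp (continuous_fst.comp continuous_snd)
  have h2 := Quaternion.continuous_re.comp h1
  have h3 := Quaternion.continuous_imI.comp h1
  -- the square is invariant under the central element `-1`
  obtain ⟨F, hF, h⟩ := exists_continuous_lift (a := a) (b := b)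
    (f := fun g ↦ (((g.2.1 : ℍ[ℝ]).re : ℂ) + ((g.2.1 : ℍ[ℝ]).imI : ℂ) * Complex.I) ^ 2)
    (((Complex.continuous_ofReal.comp h2).add
      ((Complex.continuous_ofReal.comp h3).mul continuous_const)).pow 2) fun g m n ↦ by
    rw [tau_apply, Prod.snd_mul, Prod.fst_mul, Metric.unitSphere.coe_mul]
    rcases rot_int_coe n with h | h
    · simp only [h, mul_one]
    · simp only [h, mul_neg, mul_one, Quaternion.re_neg, Quaternion.imI_neg]
      push_cast
      ring
  refine ⟨F, hF, fun x y ↦ ?_⟩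
  rw [torus, h, tau_apply]
  simp only [rot_re, rot_imI]
  rw [Complex.ofReal_cos, Complex.ofReal_sin, ← Complex.exp_mul_I, ← Complex.exp_nat_mul,
    Circle.coe_exp]
  congr 1
  push_cast
  ring

/-! ### Conjugacy classes of the elements of the torus -/

/-- The conjugates of `τ(0, y)` stay in the compact set `1 × S3 × {y b}`. -/
theorem hasBoundedConj_torus (y : ℝ) : HasBoundedConj (torus a b 0 y) := by
  refine ⟨Set.range fun u : S3 ↦ QuotientGroup.mk' (tau rot a b).range.normalCore
    (1, u, .ofAdd (0 * a + y * b)), isCompact_range (QuotientGroup.continuous_mk.comp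
      (continuous_const.prodMk (continuous_id.prodMk continuous_const))), fun x ↦ ?_⟩
  obtain ⟨g, rfl⟩ := QuotientGroup.mk'_surjective _ x
  refine ⟨g.2.1 * rot (.ofAdd y) * g.2.1⁻¹, ?_⟩
  rw [torus, mk_conj]
  refine congrArg _ (Prod.ext ?_ (Prod.ext rfl ?_))
  · change 1 = g.1 * SL2Tilde.rot (.ofAdd 0) * g.1⁻¹
    rw [SL2Tilde.rot_zero, mul_one, mul_inv_cancel]
  · change _ = g.2.2 * .ofAdd (0 * a + y * b) * g.2.2⁻¹
    rw [mul_comm g.2.2, mul_inv_cancel_right]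

theorem _root_.SL2Tilde.normSq_slBeta_conj_rot (l x : ℝ) :
    Complex.normSq (slBeta (SL2Tilde.upper l 0 * SL2Tilde.rot (.ofAdd x) *
      (SL2Tilde.upper l 0)⁻¹).mat) =
      ((Real.exp (2 * l) - Real.exp (-(2 * l))) / 2 * Real.sin (Real.pi * x)) ^ 2 := by
  have h : ((SL2Tilde.upper l 0 * SL2Tilde.rot (.ofAdd x) * (SL2Tilde.upper l 0)⁻¹).mat :
      Matrix (Fin 2) (Fin 2) ℝ) =
      !![Real.cos (Real.pi * x), -(Real.exp (2 * l) * Real.sin (Real.pi * x));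
        Real.exp (-(2 * l)) * Real.sin (Real.pi * x), Real.cos (Real.pi * x)] := by
    rw [SL2Tilde.upper_inv, SL2Tilde.mul_mat, SL2Tilde.mul_mat]
    simp only [Matrix.SpecialLinearGroup.coe_mul, SL2Tilde.rot_mat, SL2Tilde.upper_mat, slUpper_coe]
    have e : Real.exp l * Real.exp (-l) = 1 := by rw [← Real.exp_add]; simp
    ext i j
    fin_cases i <;> fin_cases j <;>
      simp [Matrix.mul_apply, Fin.sum_univ_two, two_mul, Real.exp_add]
    · linear_combination Real.cos (Real.pi * x) * e
    · ring
    · ring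
    · linear_combination Real.cos (Real.pi * x) * e
  rw [slBeta, Complex.normSq_mk]
  simp only [h, Matrix.of_apply, Matrix.cons_val]
  ring

/-- Conjugation by large diagonal matrices takes a noncentral rotation out of every compact set. -/
theorem exists_int_of_hasBoundedConj {x y : ℝ} (h : HasBoundedConj (torus a b x y)) :
    ∃ m : ℤ, x = m := by
  obtain ⟨C, hC, hx⟩ := h
  obtain ⟨F, hF, hFmk⟩ := exists_continuous_lift (a := a) (b := b)
    (f := fun g ↦ Complex.normSq (slBeta g.1.mat)) (Complex.continuous_normSq.comp
      (continuous_slBeta.comp (SL2Tilde.continuous_mat.comp continuous_fst))) fun g m n ↦ by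
    rw [tau_apply, Prod.fst_mul, SL2Tilde.mul_mat, slBeta_mul, SL2Tilde.slBeta_rot, mul_zero,
      zero_add, map_mul, Complex.normSq_conj, normSq_slAlpha, SL2Tilde.slBeta_rot]
    simp
  obtain ⟨M, hM⟩ := (hC.image hF).bddAbove
  have hbound : ∀ l : ℝ,
      ((Real.exp (2 * l) - Real.exp (-(2 * l))) / 2 * Real.sin (Real.pi * x)) ^ 2 ≤ M := by
    intro l
    have h1 := hM ⟨_, hx (QuotientGroup.mk' _ (SL2Tilde.upper l 0, 1, 1)), rfl⟩
    rw [torus, mk_conj, hFmk] at h1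
    exact (SL2Tilde.normSq_slBeta_conj_rot l x).symm.trans_le h1
  apply SL2Tilde.exists_int_of_sin_eq_zero
  by_contra hs
  have hM0 : 0 ≤ M := (sq_nonneg _).trans (hbound 0)
  set s := |Real.sin (Real.pi * x)| with hsdef
  have hs0 : 0 < s := abs_pos.2 hs
  set R := 2 * (M + 1) / s with hR
  have hRs : R / 2 * s = M + 1 := by rw [hR]; field_simp
  have hR0 : 0 < R := by positivity
  have h1 := hbound (Real.log (1 + R) / 2)
  rw [mul_div_cancel₀ _ (two_ne_zero), Real.exp_neg, Real.exp_log (by positivity), ← sq_abs,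
    abs_mul, ← hsdef] at h1
  have h2 : (1 + R)⁻¹ ≤ 1 := inv_le_one_of_one_le₀ (by linarith)
  have h3 : R / 2 ≤ |(1 + R - (1 + R)⁻¹) / 2| := (by linarith : R / 2 ≤ _).trans (le_abs_self _)
  have h4 : M + 1 ≤ |(1 + R - (1 + R)⁻¹) / 2| * s := by
    rw [← hRs]
    exact mul_le_mul_of_nonneg_right h3 hs0.le
  nlinarith

/-- The elements of the torus with relatively compact conjugacy class have a central first
component, and `τ(x, 0)` has a trivial second component. -/
theorem centralizesBounded_torus (x : ℝ) :
    CentralizesBounded (TauStabilizer rot a b) (torus a b x 0) := by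
  intro h hh hb k
  obtain ⟨x', y', rfl⟩ := exists_torus hh
  obtain ⟨m, rfl⟩ := exists_int_of_hasBoundedConj hb
  obtain ⟨g, rfl⟩ := QuotientGroup.mk'_surjective _ k
  rw [torus, torus, mk_conj, ← map_mul, ← map_mul]
  refine congrArg _ (Prod.ext ?_ (Prod.ext ?_ (mul_comm _ _)))
  · change SL2Tilde.rot (.ofAdd x) * (g.1 * SL2Tilde.rot (.ofAdd (m : ℝ)) * g.1⁻¹) =
      g.1 * SL2Tilde.rot (.ofAdd (m : ℝ)) * g.1⁻¹ * SL2Tilde.rot (.ofAdd x)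
    rw [← SL2Tilde.rot_int_mul, mul_inv_cancel_right, SL2Tilde.rot_int_mul]
  · change rot (.ofAdd 0) * _ = _ * rot (.ofAdd 0)
    rw [ofAdd_zero, map_one, one_mul, mul_one]

/-- The quaternion `j`. -/
def unitJ : S3 := ⟨⟨0, 0, 1, 0⟩, (mem_sphere_iff _).2 (by norm_num)⟩

theorem unitJ_re : (unitJ : ℍ[ℝ]).re = 0 := rfl

theorem unitJ_imI : (unitJ : ℍ[ℝ]).imI = 0 := rfl

theorem unitJ_imJ : (unitJ : ℍ[ℝ]).imJ = 1 := rfl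

theorem unitJ_imK : (unitJ : ℍ[ℝ]).imK = 0 := rfl

/-- The quaternions `i` and `j` are conjugate. -/
theorem exists_conj_rot_half : ∃ u : S3, u * rot (.ofAdd (1 / 2)) * u⁻¹ = unitJ := by
  set u : S3 := ⟨⟨0, 1 / √2, 1 / √2, 0⟩, (mem_sphere_iff _).2 <| by
    field_simp
    rw [Real.sq_sqrt zero_le_two]
    norm_num⟩
  have hu0 : (u : ℍ[ℝ]).re = 0 := rfl
  have hu1 : (u : ℍ[ℝ]).imI = 1 / √2 := rfl
  have hu2 : (u : ℍ[ℝ]).imJ = 1 / √2 := rfl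
  have hu3 : (u : ℍ[ℝ]).imK = 0 := rfl
  have hc : Real.pi * (1 / 2) = Real.pi / 2 := by ring
  refine ⟨u, mul_inv_eq_iff_eq_mul.2 (Subtype.ext ?_)⟩
  rw [Metric.unitSphere.coe_mul, Metric.unitSphere.coe_mul]
  ext <;> simp only [Quaternion.re_mul, Quaternion.imI_mul, Quaternion.imJ_mul, Quaternion.imK_mul,
    rot_re, rot_imI, rot_imJ, rot_imK, hu0, hu1, hu2, hu3, unitJ_re, unitJ_imI, unitJ_imJ,
    unitJ_imK, hc, Real.cos_pi_div_two, Real.sin_pi_div_two] <;> ring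

/-- A rotation of `S3` that commutes with the conjugate `j` of `i` is `±1`. -/
theorem exists_int_of_centralizesBounded (hb : b ≠ 0) {x y : ℝ}
    (h : CentralizesBounded (TauStabilizer rot a b) (torus a b x y)) : ∃ n : ℤ, y = n := by
  obtain ⟨u, hu⟩ := exists_conj_rot_half
  have h1 := h _ (torus_mem 0 (1 / 2)) (hasBoundedConj_torus _) (QuotientGroup.mk' _ (1, u, 1))
  rw [torus, torus, mk_conj, ← map_mul, ← map_mul] at h1
  obtain ⟨m, n, h2⟩ := mk_eq_mk_iff.1 h1
  have e1 : (1 : SL2Tilde) * SL2Tilde.rot (.ofAdd 0) * 1⁻¹ * SL2Tilde.rot (.ofAdd x) =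
      SL2Tilde.rot (.ofAdd x) * (1 * SL2Tilde.rot (.ofAdd 0) * 1⁻¹) *
        SL2Tilde.rot (.ofAdd (m : ℝ)) := congrArg Prod.fst h2
  have e2 : u * rot (.ofAdd (1 / 2)) * u⁻¹ * rot (.ofAdd y) =
      rot (.ofAdd y) * (u * rot (.ofAdd (1 / 2)) * u⁻¹) * rot (.ofAdd (n : ℝ)) :=
    congrArg (fun g ↦ g.2.1) h2
  have e3 : 0 + (0 * a + 1 / 2 * b) + -0 + (x * a + y * b) =
      x * a + y * b + (0 + (0 * a + 1 / 2 * b) + -0) + (m * a + n * b) :=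
    congrArg (fun g : SL2Tilde × S3 × Multiplicative ℝ ↦ g.2.2.toAdd) h2
  have hm : (m : ℝ) = 0 := by
    rw [SL2Tilde.rot_zero, inv_one, one_mul, one_mul, mul_one, one_mul, left_eq_mul] at e1
    exact SL2Tilde.rot_injective (e1.trans SL2Tilde.rot_zero.symm)
  have hn : (n : ℝ) = 0 := by
    rw [hm] at e3
    exact (mul_eq_zero_iff_right hb).1 (by linarith)
  rw [hu, hn, ofAdd_zero, map_one, mul_one] at e2
  have e4 := congrArg (fun v : S3 ↦ (v : ℍ[ℝ]).imK) e2
  simp only [Metric.unitSphere.coe_mul, Quaternion.imK_mul, rot_re, rot_imI, rot_imJ, rot_imK,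
    unitJ_re, unitJ_imI, unitJ_imJ, unitJ_imK] at e4
  exact SL2Tilde.exists_int_of_sin_eq_zero (by linarith)

end Torus

end S3

namespace S3

/-! ### The invariant `a / b` -/

section Invariant

variable {a b a' b' : ℝ}

theorem commutator_rot_unitJ (y : ℝ) : rot (.ofAdd (y / 2)) * unitJ *
    (rot (.ofAdd (y / 2)))⁻¹ * unitJ⁻¹ = rot (.ofAdd y) := by
  have h : unitJ * rot (.ofAdd (-(y / 2))) = rot (.ofAdd (y / 2)) * unitJ := by
    apply Subtype.ext
    rw [Metric.unitSphere.coe_mul, Metric.unitSphere.coe_mul]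
    ext <;> simp only [Quaternion.re_mul, Quaternion.imI_mul, Quaternion.imJ_mul,
      Quaternion.imK_mul, rot_re, rot_imI, rot_imJ, rot_imK, unitJ_re, unitJ_imI, unitJ_imJ,
      unitJ_imK, mul_neg, Real.cos_neg, Real.sin_neg] <;> ring
  rw [← map_inv, ← ofAdd_neg, mul_assoc _ unitJ, h, ← mul_assoc, ← rot_add,
    add_halves, mul_inv_cancel_right]

/-- A homomorphism to a commutative group vanishes on the elements with trivial last component of
`SL2Tilde × c(ℝ) × ℝ`, because these are products of commutators. -/
theorem map_eq_one_of_commGroup {A : Type} [CommGroup A]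
    (θ : SL2Tilde × S3 × Multiplicative ℝ →* A) (p : SL2Tilde) (y : ℝ) :
    θ (p, rot (.ofAdd y), 1) = 1 := by
  have h1 : θ (p, 1, 1) = 1 := by
    have h2 := Abelianization.commutator_subset_ker
      (θ.comp (MonoidHom.inl SL2Tilde (S3 × Multiplicative ℝ)))
    rw [SL2Tilde.commutator_eq_top] at h2
    exact h2 (Subgroup.mem_top p)
  have h2 : θ (1, rot (.ofAdd y), 1) = 1 := by
    have e : ((1, rot (.ofAdd y), 1) : SL2Tilde × S3 × Multiplicative ℝ) =
        (1, rot (.ofAdd (y / 2)), 1) * (1, unitJ, 1) * (1, rot (.ofAdd (y / 2)), 1)⁻¹ *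
          (1, unitJ, 1)⁻¹ := by
      refine Prod.ext ?_ (Prod.ext (commutator_rot_unitJ y).symm ?_)
      · change (1 : SL2Tilde) = 1 * 1 * 1⁻¹ * 1⁻¹
        simp
      · change (1 : Multiplicative ℝ) = 1 * 1 * 1⁻¹ * 1⁻¹
        simp
    rw [e, map_mul, map_mul, map_mul, map_inv, map_inv, mul_inv_cancel_comm, mul_inv_cancel]
  have e : ((p, rot (.ofAdd y), 1) : SL2Tilde × S3 × Multiplicative ℝ) =
      (p, 1, 1) * (1, rot (.ofAdd y), 1) :=
    Prod.ext (mul_one _).symm (Prod.ext (one_mul _).symm (one_mul _).symm)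
  rw [e, map_mul, h1, h2, one_mul]

/-- The elements of the torus with `x a + y b = 0` lie in the commutator subgroup, so the same holds
for their images. Modulo the contribution of `τ(ℤ²)`, the last component vanishes on the commutator
subgroup. -/
theorem exists_int_of_commutator (φ : TauGroup rot a b →* TauGroup rot a' b') {x y x' y' : ℝ}
    (h0 : x * a + y * b = 0) (h : φ (torus a b x y) = torus a' b' x' y') :
    ∃ m n : ℤ, x' * a' + y' * b' = m * a' + n * b' := by
  set π : SL2Tilde × S3 × Multiplicative ℝ →* Multiplicative ℝ :=
    (MonoidHom.snd S3 (Multiplicative ℝ)).comp (MonoidHom.snd SL2Tilde (S3 × Multiplicative ℝ))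
  set N := (tau rot a' b').range.normalCore
  set χ : TauGroup rot a' b' →* Multiplicative ℝ ⧸ N.map π :=
    QuotientGroup.map N (N.map π) π (Subgroup.le_comap_map _ _)
  have h1 := map_eq_one_of_commGroup
    ((χ.comp φ).comp (QuotientGroup.mk' (tau rot a b).range.normalCore))
    (SL2Tilde.rot (.ofAdd x)) y
  have h2 : torus a b x y = QuotientGroup.mk' (tau rot a b).range.normalCore
      (SL2Tilde.rot (.ofAdd x), rot (.ofAdd y), 1) := by
    rw [torus, tau_apply, h0, ofAdd_zero]
  have h3 : χ (torus a' b' x' y') = 1 := by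
    rw [← h, h2]
    exact h1
  have h4 : (QuotientGroup.mk (.ofAdd (x' * a' + y' * b')) : Multiplicative ℝ ⧸ N.map π) = 1 := h3
  obtain ⟨g, hg, hgπ⟩ := (QuotientGroup.eq_one_iff _).1 h4
  obtain ⟨m, n, rfl⟩ := isCircleLike_rot.mem_normalCore.1 hg
  exact ⟨m, n, (congrArg Multiplicative.toAdd hgπ).symm⟩

/-- The first circle of the stabilizer torus consists of the elements of the torus that commute with
all conjugates of elements of the second circle. So an isomorphism preserves it, and acts on it by
`±1`. -/
theorem exists_sign_fst (hb' : b' ≠ 0) (φ : TauGroup rot a b ≃ₜ* TauGroup rot a' b')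
    (hφ : ∀ g, φ g ∈ TauStabilizer rot a' b' ↔ g ∈ TauStabilizer rot a b) :
    ∃ ε : ℝ, (ε = 1 ∨ ε = -1) ∧ ∀ x, φ (torus a b x 0) = torus a' b' (ε * x) 0 := by
  have h : ∀ x, ∃ x', φ (torus a b x 0) = torus a' b' x' 0 := by
    intro x
    obtain ⟨x', y', h1⟩ := exists_torus ((hφ _).2 (torus_mem x 0))
    have h2 := (centralizesBounded_torus x).map φ hφ
    rw [h1] at h2
    obtain ⟨n, rfl⟩ := exists_int_of_centralizesBounded hb' h2
    refine ⟨x', ?_⟩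
    rw [h1, ← torus_add_int x' 0 0 n, Int.cast_zero, add_zero, zero_add]
  choose f hf using h
  obtain ⟨F, hF, hFt⟩ := exists_torus_fst a' b'
  have hcont : Continuous fun x ↦ Circle.exp (2 * Real.pi * f x) := by
    refine (hF.comp (φ.continuous.comp (continuous_torus.comp
      (continuous_id.prodMk (continuous_const (y := (0 : ℝ))))))).congr fun x ↦ ?_
    exact (congrArg F (hf x)).trans (hFt _ _)
  have hadd : ∀ x y, ∃ n : ℤ, f (x + y) = f x + f y + n := by
    intro x y
    have h1 : torus a' b' (f (x + y) - (f x + f y)) 0 = 1 := by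
      have h2 : torus a' b' (f (x + y)) 0 = torus a' b' (f x + f y) 0 := by
        rw [← hf, ← add_zero (0 : ℝ), ← torus_mul, ← torus_mul, map_mul, hf, hf]
      rw [sub_eq_add_neg, ← add_zero (0 : ℝ), ← torus_mul, h2, torus_mul]
      simpa using torus_int (a := a') (b := b') 0 0
    obtain ⟨n, hn⟩ := exists_int_of_torus_fst_eq_one h1
    exact ⟨n, by linarith⟩
  have hint : ∀ x, (∃ n : ℤ, f x = n) ↔ ∃ n : ℤ, x = n := by
    refine fun x ↦ ⟨fun ⟨n, hn⟩ ↦ exists_int_of_torus_fst_eq_one (a := a) (b := b) ?_,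
      fun ⟨n, hn⟩ ↦ exists_int_of_torus_fst_eq_one (a := a') (b := b') ?_⟩
    · refine φ.injective ?_
      rw [hf, hn, map_one]
      simpa using torus_int (a := a') (b := b') n 0
    · rw [← hf, hn, ← map_one φ]
      congr 1
      simpa using torus_int (a := a) (b := b) n 0
  obtain ⟨ε, hε, h⟩ := exists_sign_of_circle_automorphism hcont hadd hint
  refine ⟨ε, hε, fun x ↦ ?_⟩
  obtain ⟨n, hn⟩ := h x
  rw [hf, hn, ← torus_add_int (ε * x) 0 n 0, Int.cast_zero, add_zero]

/-- The second circle of the stabilizer torus consists of the elements of the torus whose conjugacy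
class is relatively compact. So an isomorphism preserves it, and acts on it by `±1`. -/
theorem exists_sign_snd (hb : b ≠ 0) (hb' : b' ≠ 0) (φ : TauGroup rot a b ≃ₜ* TauGroup rot a' b')
    (hφ : ∀ g, φ g ∈ TauStabilizer rot a' b' ↔ g ∈ TauStabilizer rot a b) :
    ∃ ε : ℝ, (ε = 1 ∨ ε = -1) ∧ ∀ y, φ (torus a b 0 y) = torus a' b' 0 (ε * y) := by
  have h : ∀ y, ∃ y', φ (torus a b 0 y) = torus a' b' 0 y' := by
    intro y
    obtain ⟨x', y', h1⟩ := exists_torus ((hφ _).2 (torus_mem 0 y))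
    have h2 := (hasBoundedConj_torus y).map φ
    rw [h1] at h2
    obtain ⟨m, rfl⟩ := exists_int_of_hasBoundedConj h2
    refine ⟨y', ?_⟩
    rw [h1, ← torus_add_int 0 y' m 0, Int.cast_zero, add_zero, zero_add]
  choose f hf using h
  obtain ⟨F, hF, hFt⟩ := exists_torus_snd a' b'
  have hcont : Continuous fun x ↦ Circle.exp (2 * Real.pi * f x) := by
    refine Topology.IsInducing.subtypeVal.continuous_iff.2 ((hF.comp (φ.continuous.comp
      (continuous_torus.comp ((continuous_const (y := (0 : ℝ))).prodMk continuous_id)))).congr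
        fun x ↦ ?_)
    exact (congrArg F (hf x)).trans (hFt _ _)
  have hadd : ∀ x y, ∃ n : ℤ, f (x + y) = f x + f y + n := by
    intro x y
    have h1 : torus a' b' 0 (f (x + y) - (f x + f y)) = 1 := by
      have h2 : torus a' b' 0 (f (x + y)) = torus a' b' 0 (f x + f y) := by
        rw [← hf, ← add_zero (0 : ℝ), ← torus_mul, ← torus_mul, map_mul, hf, hf]
      rw [sub_eq_add_neg, ← add_zero (0 : ℝ), ← torus_mul, h2, torus_mul]
      simpa using torus_int (a := a') (b := b') 0 0
    obtain ⟨n, hn⟩ := exists_int_of_torus_snd_eq_one hb' h1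
    exact ⟨n, by linarith⟩
  have hint : ∀ x, (∃ n : ℤ, f x = n) ↔ ∃ n : ℤ, x = n := by
    refine fun x ↦ ⟨fun ⟨n, hn⟩ ↦ exists_int_of_torus_snd_eq_one (a := a) hb ?_,
      fun ⟨n, hn⟩ ↦ exists_int_of_torus_snd_eq_one (a := a') hb' ?_⟩
    · refine φ.injective ?_
      rw [hf, hn, map_one]
      simpa using torus_int (a := a') (b := b') 0 n
    · rw [← hf, hn, ← map_one φ]
      congr 1
      simpa using torus_int (a := a) (b := b) 0 n
  obtain ⟨ε, hε, h⟩ := exists_sign_of_circle_automorphism hcont hadd hint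
  refine ⟨ε, hε, fun x ↦ ?_⟩
  obtain ⟨n, hn⟩ := h x
  rw [hf, hn, ← torus_add_int 0 (ε * x) 0 n, Int.cast_zero, add_zero]

theorem not_forall_exists_int_combination (a b : ℝ) : ¬ ∀ t : ℝ, ∃ m n : ℤ, t = m * a + n * b := by
  intro h
  have hs : Function.Surjective fun q : ℤ × ℤ ↦ (q.1 : ℝ) * a + q.2 * b := fun t ↦ by
    obtain ⟨m, n, h⟩ := h t
    exact ⟨(m, n), h.symm⟩
  exact not_countable (α := ℝ) hs.countable

theorem div_eq_div_of_homogeneousIso (ha : 0 < a) (hb : 0 < b) (ha' : 0 < a') (hb' : 0 < b')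
    (h : HomogeneousIso (TauGroup rot a b) (TauStabilizer rot a b)
      (TauGroup rot a' b') (TauStabilizer rot a' b')) : a / b = a' / b' := by
  obtain ⟨φ, hφ⟩ := h.exists_mem_iff
  obtain ⟨ε, hε, h1⟩ := exists_sign_fst hb'.ne' φ hφ
  obtain ⟨δ, hδ, h2⟩ := exists_sign_snd hb.ne' hb'.ne' φ hφ
  -- on the image of the line `x a + y b = 0`, the form `x a' + y b'` has values in `ℤ a' + ℤ b'`
  have h3 : ∀ s : ℝ, ∃ m n : ℤ, s * (ε * b * a' - δ * a * b') = m * a' + n * b' := by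
    intro s
    have h4 : φ (torus a b (s * b) (-(s * a))) = torus a' b' (ε * (s * b)) (δ * -(s * a)) := by
      rw [← add_zero (s * b), ← zero_add (-(s * a)), ← torus_mul, map_mul, h1, h2, torus_mul,
        add_zero, zero_add, add_zero, zero_add]
    obtain ⟨m, n, h5⟩ := exists_int_of_commutator φ.toMulEquiv.toMonoidHom
      (show s * b * a + -(s * a) * b = 0 by ring) h4
    exact ⟨m, n, by rw [← h5]; ring⟩
  -- the values of a nonzero linear function on the line are not contained in a countable group
  have h4 : ε * b * a' - δ * a * b' = 0 := by
    by_contra h0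
    refine not_forall_exists_int_combination a' b' fun t ↦ ?_
    obtain ⟨m, n, h5⟩ := h3 (t / (ε * b * a' - δ * a * b'))
    rw [div_mul_cancel₀ _ h0] at h5
    exact ⟨m, n, h5⟩
  -- by positivity, the signs `ε` and `δ` agree
  have h5 := mul_pos hb ha'
  have h6 := mul_pos ha hb'
  rw [div_eq_div_iff hb.ne' hb'.ne']
  rcases hε with rfl | rfl <;> rcases hδ with rfl | rfl <;> linarith

/-- Multiplication by `l` on the last factor, an automorphism that takes `τ_{a,b}` to
`τ_{l a, l b}`. -/
def scale {l : ℝ} (hl : l ≠ 0) :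
    SL2Tilde × S3 × Multiplicative ℝ ≃ₜ* SL2Tilde × S3 × Multiplicative ℝ where
  toFun g := (g.1, g.2.1, .ofAdd (l * g.2.2.toAdd))
  invFun g := (g.1, g.2.1, .ofAdd (l⁻¹ * g.2.2.toAdd))
  left_inv g := Prod.ext rfl (Prod.ext rfl (by simp [hl]))
  right_inv g := Prod.ext rfl (Prod.ext rfl (by simp [hl]))
  map_mul' g h := Prod.ext rfl (Prod.ext rfl (by simp [mul_add, ofAdd_add]))
  continuous_toFun := continuous_fst.prodMk ((continuous_fst.comp continuous_snd).prodMk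
    (continuous_ofAdd.comp
      (continuous_const.mul (continuous_toAdd.comp (continuous_snd.comp continuous_snd)))))
  continuous_invFun := continuous_fst.prodMk ((continuous_fst.comp continuous_snd).prodMk
    (continuous_ofAdd.comp
      (continuous_const.mul (continuous_toAdd.comp (continuous_snd.comp continuous_snd)))))

theorem scale_tau {l : ℝ} (hl : l ≠ 0) (q : Multiplicative (ℝ × ℝ)) :
    scale hl (tau rot a b q) = tau rot (l * a) (l * b) q := by
  refine Prod.ext rfl (Prod.ext rfl (congrArg Multiplicative.ofAdd ?_))
  change l * (q.toAdd.1 * a + q.toAdd.2 * b) = q.toAdd.1 * (l * a) + q.toAdd.2 * (l * b)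
  ring

theorem scale_mem_range_iff {l : ℝ} (hl : l ≠ 0) {g : SL2Tilde × S3 × Multiplicative ℝ} :
    scale hl g ∈ (tau rot (l * a) (l * b)).range ↔ g ∈ (tau rot a b).range := by
  constructor
  · rintro ⟨q, hq⟩
    refine ⟨q, (scale hl).injective ?_⟩
    rw [scale_tau, hq]
  · rintro ⟨q, rfl⟩
    exact ⟨q, (scale_tau hl q).symm⟩

/-- Scaling the last factor carries `τ_{a,b}` to `τ_{l a, l b}`, hence also the kernels of the two
actions to each other. -/
theorem homogeneousIso_scale {l : ℝ} (hl : l ≠ 0) :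
    HomogeneousIso (TauGroup rot a b) (TauStabilizer rot a b)
      (TauGroup rot (l * a) (l * b)) (TauStabilizer rot (l * a) (l * b)) := by
  set N := (tau rot a b).range.normalCore
  set N' := (tau rot (l * a) (l * b)).range.normalCore
  have hmap : N.map ((scale hl).toMulEquiv : SL2Tilde × S3 × Multiplicative ℝ →*
      SL2Tilde × S3 × Multiplicative ℝ) = N' := by
    ext g
    obtain ⟨g, rfl⟩ := (scale hl).surjective g
    have h1 : scale hl g ∈ N.map ((scale hl).toMulEquiv : SL2Tilde × S3 × Multiplicative ℝ →*
        SL2Tilde × S3 × Multiplicative ℝ) ↔ g ∈ N :=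
      ⟨fun ⟨k, hk, h⟩ ↦ (scale hl).injective h ▸ hk, fun h ↦ ⟨g, h, rfl⟩⟩
    rw [h1]
    constructor
    · intro h k
      obtain ⟨k, rfl⟩ := (scale hl).surjective k
      rw [← map_inv, ← map_mul, ← map_mul, scale_mem_range_iff]
      exact h k
    · intro h k
      rw [← scale_mem_range_iff hl, map_mul, map_mul, map_inv]
      exact h _
  set e : TauGroup rot a b ≃* TauGroup rot (l * a) (l * b) :=
    QuotientGroup.congr N N' (scale hl).toMulEquiv hmap with he
  have hmk : ∀ g, e (QuotientGroup.mk' N g) = QuotientGroup.mk' N' (scale hl g) := fun g ↦ rfl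
  have hsymm : ∀ g, e.symm (QuotientGroup.mk' N' g) = QuotientGroup.mk' N ((scale hl).symm g) :=
    fun g ↦ rfl
  refine homogeneousIso_of_mem_iff
    { toMulEquiv := e
      continuous_toFun := (QuotientGroup.isQuotientMap_mk N).continuous_iff.2
        (QuotientGroup.continuous_mk.comp (scale hl).continuous)
      continuous_invFun := (QuotientGroup.isQuotientMap_mk N').continuous_iff.2
        (QuotientGroup.continuous_mk.comp (scale hl).symm.continuous) } fun g ↦ ?_
  obtain ⟨g, rfl⟩ := QuotientGroup.mk'_surjective _ g
  change e (QuotientGroup.mk' N g) ∈ _ ↔ _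
  rw [hmk, mk_mem_tauStabilizer, mk_mem_tauStabilizer, scale_mem_range_iff]

theorem homogeneousIso_iff (ha : 0 < a) (hb : 0 < b) (ha' : 0 < a') (hb' : 0 < b') :
    HomogeneousIso (TauGroup rot a b) (TauStabilizer rot a b)
      (TauGroup rot a' b') (TauStabilizer rot a' b') ↔ a / b = a' / b' := by
  refine ⟨div_eq_div_of_homogeneousIso ha hb ha' hb', fun h ↦ ?_⟩
  have h1 : a' / a * a = a' := div_mul_cancel₀ _ ha.ne'
  have h2 : a' / a * b = b' := by
    rw [div_eq_div_iff hb.ne' hb'.ne'] at h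
    field_simp
    linarith
  have h3 := homogeneousIso_scale (a := a) (b := b) (div_pos ha' ha).ne'
  rwa [h1, h2] at h3

end Invariant

end S3

end

theorem mainTheorem5 :
    (∀ a b : ℝ,
      (IsModelGeometry (TauGroup S3.rot a b) (TauStabilizer S3.rot a b) ∧
        HasPuncturedSurfaceQuotient S3.rot a b) ∧
      (IsModelGeometry (TauGroup SL2Tilde.rot a b) (TauStabilizer SL2Tilde.rot a b) ∧
        HasPuncturedSurfaceQuotient SL2Tilde.rot a b)) ∧
    (∀ a b a' b' : ℝ, 0 < a → 0 < b → 0 < a' → 0 < b' →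
      (HomogeneousIso (TauGroup S3.rot a b) (TauStabilizer S3.rot a b)
          (TauGroup S3.rot a' b') (TauStabilizer S3.rot a' b') ↔ a / b = a' / b')) := by
  exact ⟨fun a b ↦ ⟨⟨S3.isModelGeometry a b, S3.hasPuncturedSurfaceQuotient a b⟩,
    SL2Tilde.isModelGeometry a b, SL2Tilde.hasPuncturedSurfaceQuotient a b⟩,
    fun _ _ _ _ ha hb ha' hb' ↦ S3.homogeneousIso_iff ha hb ha' hb'⟩
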